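/- Let $a<b$ be real. A \emph{partition} $\kappa$ of $[a,b]$ is a finite set of points $a=x_0<x_1<\dots<x_n=b$; let $\lambda=\{\lambda_m\}_{m\ge1}$ be a nested sequence of partitions $\lambda_m=\{x_i^m\}_{i=0}^{n(m)}$ of $[a,b]$ with $\bigcup_m\lambda_m$ dense in $[a,b]$. For $a\le u<v\le b$ put $x_i^m(u,v)=\max(u,\min(v,x_i^m))$. A real function is \emph{regulated} on $[a,b]$ if it has finite left limits $f_-(t)=f(t-)$, $t\in(a,b]$, and finite right limits $f_+(t)=f(t+)$, $t\in[a,b)$; put $\Delta^-f(t)=f(t)-f(t-)$ and $\Delta^+f(t)=f(t+)-f(t)$. \emph{Classes of functions.} $\mathcal W_p$ is the class of functions on $[a,b]$ with $\sup_\kappa\sum_i|f(x_i)-f(x_{i-1})|^p<\infty$. $\mathrm{dual}(\mathcal W_1)$ is the class of regulated functions on $[a,b]$, and for $p>1$, $\mathrm{dual}(\mathcal W_p)=\bigcup\{\mathcal W_q: q>0,\ 1/p+1/q>1\}$. A regulated $f$ \emph{has the quadratic $\lambda$-variation} ($f\in Q_\lambda$) if there is a regulated $V$ on $[a,b]$ with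 $V(a)=0$ such that, for all $a\le s<t\le b$, $V(t)-V(s)=\lim_m\sum_i[f(x_i^m(s,t))-f(x_{i-1}^m(s,t))]^2$, $\Delta^-V(t)=(\Delta^-f(t))^2$ and $\Delta^+V(s)=(\Delta^+f(s))^2$. Then $[f]_\lambda:=V$ and $[f]_\lambda^c(t):=V(t)-\sum_{(a,t]}(\Delta^-f)^2-\sum_{[a,t)}(\Delta^+f)^2$. \emph{Decompositions.} For $1\le p<2$, $D_{\lambda,p}(f)$ is the set of pairs $(g,h)$ of regulated functions on $[a,b]$ with $g\in Q_\lambda\cap\mathrm{dual}(\mathcal W_p)$, $h\in\mathcal W_p$, $g(a)=h(a)=0$ and $f=C+g+h$ on $[a,b]$ for a constant $C$. $D^{+}_{\lambda,p}(f)$ (resp. $D^-_{\lambda,p}(f)$) is the subset of those pairs for which every $t\in(a,b)$ with $\Delta^{+}g(t)\ne0$ or $\Delta^{+}h(t)\neq0$ (resp. $\Delta^-g(t)\ne0$ or $\Delta^-h(t)\ne0$) lies in $\bigcup_m\lambda_m$. A regulated $f$ with $D_{\lambda,p}(f)\ne\emptyset$ is called \emph{$(\lambda,p)$-decomposable}.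 \emph{Integrals.} $(RS)\int$ and $(RRS)\int$ are the Riemann--Stieltjes integrals obtained as limits of tagged sums as the mesh tends to $0$, resp. under refinement of partitions. For $F,h$ regulated and $u<v$, let $F_{-}^{(u)}(u)=F(u)$ and $F_-^{(u)}(x)=F(x-)$ for $u<x\le v$; $F_+^{(v)}(v)=F(v)$ and $F_+^{(v)}(x)=F(x+)$ for $u\le x<v$. The Left and Right Young integrals are $$(LY)\!\int_u^v\! F\,dh=(RRS)\!\int_u^v\! F_-^{(u)}dh_+^{(v)}+[F\Delta^+h](u)+\sum_{(u,v)}\Delta^-F\Delta^+h,$$ $$(RY)\!\int_u^v\! F\,dh=(RRS)\!\int_u^v\! F_+^{(v)}dh_-^{(u)}-\sum_{(u,v)}\Delta^+F\Delta^-h+[F\Delta^-h](v),$$ provided the $RRS$ integral exists and the sum converges unconditionally; they are $0$ if $u=v$. For $F,g$ regulated, the Left Cauchy $\lambda$-integral $(LC)\int F\,d_\lambda g$ is defined on $[a,b]$ if there is a regulated $\Phi$ on $[a,b]$ with $\Phi(a)=0$ such that, for all $a\le u<v\le b$, $\Phi(v)-\Phi(u)=\lim_m\sum_iF(x_{i-1}^m(u,v))[g(x_i^m(u,v))-g(x_{i-1}^m(u,v))]$,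 $\Delta^-\Phi(v)=F(v-)\Delta^-g(v)$ and $\Delta^+\Phi(u)=F(u)\Delta^+g(u)$; then $(LC)\int_u^vF\,d_\lambda g:=\Phi(v)-\Phi(u)$. The Right Cauchy $\lambda$-integral $(RC)\int F\,d_\lambda g$ is defined likewise with $F(x_i^m(u,v))$ in the sums and jumps $\Delta^-\Phi(v)=F(v)\Delta^-g(v)$, $\Delta^+\Phi(u)=F(u+)\Delta^+g(u)$. For $A\subset D_{\lambda,p}(f)$ and $F$ regulated, the Left $\lambda$-integral $(L)\int F\,d_\lambda f$ is defined on $[a,b]$ with respect to $A$ if for every $(g,h)\in A$ the integrals $(LC)\int F\,d_\lambda g$ and $(LY)\int F\,dh$ are defined on $[a,b]$ and, for all $a\le u\le v\le b$, the value $(L)\int_u^vF\,d_\lambda f:=(LC)\int_u^vF\,d_\lambda g+(LY)\int_u^vF\,dh$ does not depend on $(g,h)\in A$. The Right $\lambda$-integral $(R)\int F\,d_\lambda f$ is defined likewise with $RC$, $RY$. \textbf{Theorem.} Let $1\le p<2$, let $f$ be $(\lambda,p)$-decomposable on $[a,b]$, and let $\phi$ be a $C^2$ function on an open set containing the closure of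 the range $f([a,b])$. If $D^+_{\lambda,p}(f)\cup D^-_{\lambda,p}(f)\ne\emptyset$, then $f$ has the quadratic $\lambda$-variation and $[g]^c_\lambda=[f]^c_\lambda$ on $[a,b]$ for every $(g,h)\in D^+_{\lambda,p}(f)\cup D^-_{\lambda,p}(f)$. Moreover: (a) If $D^+_{\lambda,p}(f)\neq\emptyset$, then $(L)\int(\phi'\circ f)\,d_\lambda f$ is defined on $[a,b]$ with respect to $D^+_{\lambda,p}(f)$, and for $a\le z<y\le b$ $$(\phi\circ f)(y)=(\phi\circ f)(z)+(L)\!\int_z^y(\phi'\circ f)\,d_\lambda f+\tfrac12(RS)\!\int_z^y(\phi''\circ f)\,d[f]^c_\lambda+\sum_{(z,y]}\{\Delta^-(\phi\circ f)-(\phi'\circ f)_-\Delta^-f\}+\sum_{[z,y)}\{\Delta^+(\phi\circ f)-(\phi'\circ f)\Delta^+f\},$$ where the $(RS)$ integral exists and the two sums converge unconditionally. (b) If $D^-_{\lambda,p}(f)\neq\emptyset$, then $(R)\int(\phi'\circ f)\,d_\lambda f$ is defined on $[a,b]$ with respect to $D^-_{\lambda,p}(f)$, and for $a\le z<y\le b$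 $$(\phi\circ f)(y)=(\phi\circ f)(z)+(R)\!\int_z^y(\phi'\circ f)\,d_\lambda f-\tfrac12(RS)\!\int_z^y(\phi''\circ f)\,d[f]^c_\lambda+\sum_{(z,y]}\{\Delta^-(\phi\circ f)-(\phi'\circ f)\Delta^-f\}+\sum_{[z,y)}\{\Delta^+(\phi\circ f)-(\phi'\circ f)_+\Delta^+f\},$$ where the $(RS)$ integral exists and the two sums converge unconditionally. -/

import Mathlib

open Filter Topology Set

namespace QVar

/-- A partition `a = x 0 < x 1 < ... < x n = b` of the interval `[a, b]`
(the values `x i` with `i > n` play no role). -/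
structure Part (a b : ℝ) where
  n : ℕ
  x : ℕ → ℝ
  strictMono : StrictMonoOn x (Iic n)
  left : x 0 = a
  right : x n = b

/-- The finite set of points of a partition. -/
def Part.pts {a b : ℝ} (κ : Part a b) : Set ℝ := κ.x '' Iic κ.n

/-- The class `Λ[a, b]`: nested sequences of partitions whose union is dense in `[a, b]`. -/
structure IsDenseNested {a b : ℝ} (lam : ℕ → Part a b) : Prop where
  nested : ∀ m, (lam m).pts ⊆ (lam (m + 1)).pts
  dense : Icc a b ⊆ closure (⋃ m, (lam m).pts)

/-- The point of `[s, t]` nearest to `x`. -/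
def clamp (s t x : ℝ) : ℝ := max s (min t x)

/-- Real functions which are regulated on `[a, b]`: all one-sided limits exist and are finite. -/
def IsRegulated (a b : ℝ) (f : ℝ → ℝ) : Prop :=
  (∀ t ∈ Ioc a b, ∃ l, Tendsto f (𝓝[<] t) (𝓝 l)) ∧
  (∀ t ∈ Ico a b, ∃ l, Tendsto f (𝓝[>] t) (𝓝 l))

/-- The left jump `Δ⁻f(t) = f(t) - f(t-)`. -/
noncomputable def jumpL (f : ℝ → ℝ) (t : ℝ) : ℝ := f t - Function.leftLim f t

/-- The right jump `Δ⁺f(t) = f(t+) - f(t)`. -/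
noncomputable def jumpR (f : ℝ → ℝ) (t : ℝ) : ℝ := Function.rightLim f t - f t

/-- The `p`-variation sum of `f` over a partition. -/
noncomputable def varSum {a b : ℝ} (p : ℝ) (f : ℝ → ℝ) (κ : Part a b) : ℝ :=
  ∑ i ∈ Finset.range κ.n, |f (κ.x (i + 1)) - f (κ.x i)| ^ p

/-- The Wiener class `W_p[a, b]` of functions of bounded `p`-variation on `[a, b]`. -/
def BddPVar (a b p : ℝ) (f : ℝ → ℝ) : Prop :=
  ∃ M : ℝ, ∀ κ : Part a b, varSum p f κ ≤ M

/-- The class `dual(W_p)[a, b]`: all regulated functions if `p = 1`, and the union of the classes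
`W_q[a, b]` with `1/p + 1/q > 1` if `p > 1`. -/
def DualW (a b p : ℝ) (g : ℝ → ℝ) : Prop :=
  (p = 1 ∧ IsRegulated a b g) ∨ (1 < p ∧ ∃ q : ℝ, 0 < q ∧ 1 < 1 / p + 1 / q ∧ BddPVar a b q g)

/-- `s₂(f; κ ⋒ [s, t])`: the sum of squared increments of `f` over the partition of `[s, t]`
induced by `κ`. -/
noncomputable def sqSum {a b : ℝ} (f : ℝ → ℝ) (κ : Part a b) (s t : ℝ) : ℝ :=
  ∑ i ∈ Finset.range κ.n, (f (clamp s t (κ.x (i + 1))) - f (clamp s t (κ.x i))) ^ 2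

/-- The Left Cauchy sum of `F` with respect to `g` over the partition of `[s, t]`
induced by `κ`. -/
noncomputable def sumLC {a b : ℝ} (F g : ℝ → ℝ) (κ : Part a b) (s t : ℝ) : ℝ :=
  ∑ i ∈ Finset.range κ.n,
    F (clamp s t (κ.x i)) * (g (clamp s t (κ.x (i + 1))) - g (clamp s t (κ.x i)))

/-- The Right Cauchy sum of `F` with respect to `g` over the partition of `[s, t]`
induced by `κ`. -/
noncomputable def sumRC {a b : ℝ} (F g : ℝ → ℝ) (κ : Part a b) (s t : ℝ) : ℝ :=
  ∑ i ∈ Finset.range κ.n,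
    F (clamp s t (κ.x (i + 1))) * (g (clamp s t (κ.x (i + 1))) - g (clamp s t (κ.x i)))

/-- `f` has the quadratic `λ`-variation on `[a, b]`, i.e. `f ∈ Q_λ[a, b]`. -/
def HasQV {a b : ℝ} (lam : ℕ → Part a b) (f : ℝ → ℝ) : Prop :=
  IsRegulated a b f ∧ ∃ V : ℝ → ℝ, IsRegulated a b V ∧ V a = 0 ∧
    (∀ s t, a ≤ s → s < t → t ≤ b →
      Tendsto (fun m => sqSum f (lam m) s t) atTop (𝓝 (V t - V s))) ∧
    (∀ t ∈ Ioc a b, jumpL V t = jumpL f t ^ 2) ∧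
    (∀ s ∈ Ico a b, jumpR V s = jumpR f s ^ 2)

/-- The bracket function `[f]_λ`; for `f ∈ Q_λ[a, b]` it is the function `V` of `HasQV`
on `[a, b]`. -/
noncomputable def bracket {a b : ℝ} (lam : ℕ → Part a b) (f : ℝ → ℝ) (t : ℝ) : ℝ :=
  limUnder atTop (fun m => sqSum f (lam m) a t)

/-- The continuous part `[f]^c_λ` of the bracket function. -/
noncomputable def bracketCont {a b : ℝ} (lam : ℕ → Part a b) (f : ℝ → ℝ) (t : ℝ) : ℝ :=
  bracket lam f t - ∑' s : Ioc a t, jumpL f s ^ 2 - ∑' s : Ico a t, jumpR f s ^ 2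

/-- The set `D_{λ,p}(f)` of `(λ,p)`-dual pairs `(g, h)` which `(λ,p)`-decompose `f`. -/
def dualPairs {a b : ℝ} (lam : ℕ → Part a b) (p : ℝ) (f : ℝ → ℝ) : Set ((ℝ → ℝ) × (ℝ → ℝ)) :=
  {gh | IsRegulated a b gh.1 ∧ IsRegulated a b gh.2 ∧
    HasQV lam gh.1 ∧ DualW a b p gh.1 ∧ BddPVar a b p gh.2 ∧ gh.1 a = 0 ∧ gh.2 a = 0 ∧
    ∃ C : ℝ, ∀ t ∈ Icc a b, f t = C + gh.1 t + gh.2 t}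

/-- `f` is `(λ,p)`-decomposable on `[a, b]`, i.e. `f ∈ 𝒟_{λ,p}[a, b]`. -/
def IsDecomposable {a b : ℝ} (lam : ℕ → Part a b) (p : ℝ) (f : ℝ → ℝ) : Prop :=
  IsRegulated a b f ∧ (dualPairs lam p f).Nonempty

/-- `D⁺_{λ,p}(f)`: the right discontinuity points in `(a, b)` of both components are accessible
by `λ`. -/
def dualPairsPlus {a b : ℝ} (lam : ℕ → Part a b) (p : ℝ) (f : ℝ → ℝ) :
    Set ((ℝ → ℝ) × (ℝ → ℝ)) :=
  {gh | gh ∈ dualPairs lam p f ∧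
    ∀ t ∈ Ioo a b, jumpR gh.1 t ≠ 0 ∨ jumpR gh.2 t ≠ 0 → t ∈ ⋃ m, (lam m).pts}

/-- `D⁻_{λ,p}(f)`: the left discontinuity points in `(a, b)` of both components are accessible
by `λ`. -/
def dualPairsMinus {a b : ℝ} (lam : ℕ → Part a b) (p : ℝ) (f : ℝ → ℝ) :
    Set ((ℝ → ℝ) × (ℝ → ℝ)) :=
  {gh | gh ∈ dualPairs lam p f ∧
    ∀ t ∈ Ioo a b, jumpL gh.1 t ≠ 0 ∨ jumpL gh.2 t ≠ 0 → t ∈ ⋃ m, (lam m).pts}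

/-- `y i` is a tag in `[x i, x (i+1)]` for each of the intervals of the partition. -/
def IsTagging {a b : ℝ} (κ : Part a b) (y : ℕ → ℝ) : Prop :=
  ∀ i < κ.n, y i ∈ Icc (κ.x i) (κ.x (i + 1))

/-- The Riemann-Stieltjes sum over a tagged partition. -/
noncomputable def sumRS {a b : ℝ} (F g : ℝ → ℝ) (κ : Part a b) (y : ℕ → ℝ) : ℝ :=
  ∑ i ∈ Finset.range κ.n, F (y i) * (g (κ.x (i + 1)) - g (κ.x i))

/-- `(RS) ∫_u^v F dg` exists and equals `I`: the limit as the mesh tends to zero. -/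
def HasRS (F g : ℝ → ℝ) (u v I : ℝ) : Prop :=
  ∀ ε > 0, ∃ δ > 0, ∀ (κ : Part u v) (y : ℕ → ℝ), IsTagging κ y →
    (∀ i < κ.n, κ.x (i + 1) - κ.x i < δ) → |sumRS F g κ y - I| < ε

/-- `(RRS) ∫_u^v F dg` exists and equals `I`: the limit under refinements of partitions. -/
def HasRRS (F g : ℝ → ℝ) (u v I : ℝ) : Prop :=
  ∀ ε > 0, ∃ κ₀ : Part u v, ∀ (κ : Part u v) (y : ℕ → ℝ), IsTagging κ y →
    κ₀.pts ⊆ κ.pts → |sumRS F g κ y - I| < ε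

/-- On `[u, v]`: the function `f(x-)` for `x ≠ u`, with the value `f(u)` at `u`. -/
noncomputable def leftMod (u : ℝ) (f : ℝ → ℝ) (x : ℝ) : ℝ :=
  if x = u then f u else Function.leftLim f x

/-- On `[u, v]`: the function `f(x+)` for `x ≠ v`, with the value `f(v)` at `v`. -/
noncomputable def rightMod (v : ℝ) (f : ℝ → ℝ) (x : ℝ) : ℝ :=
  if x = v then f v else Function.rightLim f x

/-- The Left Young integral `(LY) ∫_u^v F dh` exists and equals `I`
(`F` and `h` are regulated wherever this is used). -/
def HasLY (F h : ℝ → ℝ) (u v I : ℝ) : Prop :=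
  (u = v ∧ I = 0) ∨
  (u < v ∧ ∃ R S : ℝ, HasRRS (leftMod u F) (rightMod v h) u v R ∧
    HasSum (fun x : Ioo u v => jumpL F x * jumpR h x) S ∧
    I = R + F u * jumpR h u + S)

/-- The Right Young integral `(RY) ∫_u^v F dh` exists and equals `I`
(`F` and `h` are regulated wherever this is used). -/
def HasRY (F h : ℝ → ℝ) (u v I : ℝ) : Prop :=
  (u = v ∧ I = 0) ∨
  (u < v ∧ ∃ R S : ℝ, HasRRS (rightMod v F) (leftMod u h) u v R ∧
    HasSum (fun x : Ioo u v => jumpR F x * jumpL h x) S ∧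
    I = R - S + F v * jumpL h v)

/-- For regulated `F` and `g`, the Left Cauchy `λ`-integral `(LC) ∫ F d_λ g` is defined on
`[a, b]`, and `Φ` is its indefinite integral: `(LC) ∫_u^v F d_λ g = Φ v - Φ u`. -/
def HasLC {a b : ℝ} (lam : ℕ → Part a b) (F g Φ : ℝ → ℝ) : Prop :=
  IsRegulated a b Φ ∧ Φ a = 0 ∧
  (∀ u v, a ≤ u → u < v → v ≤ b →
    Tendsto (fun m => sumLC F g (lam m) u v) atTop (𝓝 (Φ v - Φ u))) ∧
  (∀ v ∈ Ioc a b, jumpL Φ v = Function.leftLim F v * jumpL g v) ∧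
  (∀ u ∈ Ico a b, jumpR Φ u = F u * jumpR g u)

/-- For regulated `F` and `g`, the Right Cauchy `λ`-integral `(RC) ∫ F d_λ g` is defined on
`[a, b]`, and `Ψ` is its indefinite integral: `(RC) ∫_u^v F d_λ g = Ψ v - Ψ u`. -/
def HasRC {a b : ℝ} (lam : ℕ → Part a b) (F g Ψ : ℝ → ℝ) : Prop :=
  IsRegulated a b Ψ ∧ Ψ a = 0 ∧
  (∀ u v, a ≤ u → u < v → v ≤ b →
    Tendsto (fun m => sumRC F g (lam m) u v) atTop (𝓝 (Ψ v - Ψ u))) ∧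
  (∀ v ∈ Ioc a b, jumpL Ψ v = F v * jumpL g v) ∧
  (∀ u ∈ Ico a b, jumpR Ψ u = Function.rightLim F u * jumpR g u)

/-- The Left `λ`-integral `(L) ∫ F d_λ f` is defined on `[a, b]` with respect to a set `A` of dual
pairs of `f`, with values `(L) ∫_u^v F d_λ f = L u v`: the sum
`(LC) ∫ F d_λ g + (LY) ∫ F dh` is defined for all `(g, h) ∈ A`, with values not depending on
the pair. -/
def HasLeftInt {a b : ℝ} (lam : ℕ → Part a b) (A : Set ((ℝ → ℝ) × (ℝ → ℝ))) (F : ℝ → ℝ)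
    (L : ℝ → ℝ → ℝ) : Prop :=
  IsRegulated a b F ∧ ∀ gh ∈ A, ∃ Φ : ℝ → ℝ, HasLC lam F gh.1 Φ ∧
    ∀ u v, a ≤ u → u ≤ v → v ≤ b → ∃ J : ℝ, HasLY F gh.2 u v J ∧ L u v = (Φ v - Φ u) + J

/-- The Right `λ`-integral `(R) ∫ F d_λ f` is defined on `[a, b]` with respect to a set `A` of dual
pairs of `f`, with values `(R) ∫_u^v F d_λ f = L u v`: the sum
`(RC) ∫ F d_λ g + (RY) ∫ F dh` is defined for all `(g, h) ∈ A`, with values not depending on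
the pair. -/
def HasRightInt {a b : ℝ} (lam : ℕ → Part a b) (A : Set ((ℝ → ℝ) × (ℝ → ℝ))) (F : ℝ → ℝ)
    (L : ℝ → ℝ → ℝ) : Prop :=
  IsRegulated a b F ∧ ∀ gh ∈ A, ∃ Ψ : ℝ → ℝ, HasRC lam F gh.1 Ψ ∧
    ∀ u v, a ≤ u → u ≤ v → v ≤ b → ∃ J : ℝ, HasRY F gh.2 u v J ∧ L u v = (Ψ v - Ψ u) + J

end QVar

open QVar

namespace QVar

open Function

/-! Write F for φ' ∘ f. For part (a), Taylor's formula at the left end of a partition interval [x,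
y] reads F(x)(g(y) - g(x)) = [φ(f y) - φ(f x)] - F(x)(h(y) - h(x)) - ψ(f x, f y), with ψ(x, y) =
φ(y) - φ(x) - φ'(x)(y - x). Sum this over the partition of [u, v] induced by `lam m`. The bracket
telescopes. The sums against h converge by Young's theory, and their limit is the Left Young
integral. The sums of ψ converge to some B(v) - B(u): half the integral of φ'' ∘ f against the
continuous part of the bracket, plus the jumps of the Taylor remainder. Hence the sums against g
converge too, and the limit has the jumps required of a Left Cauchy integral. Adding the Young
integral back leaves φ(f v) - φ(f u) - (B(v) - B(u)), where the pair (g, h) no longer appears. This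
gives at once the independence of the pair and the change of variables formula. Part (b) expands at
the right end instead: ψ(x, y) becomes -ψ(y, x), which reverses the sign of the second-order
coefficient.

All convergence statements rest on one principle, `tendsto_of_local` and `exists_tendsto_of_local`.
The sums are interval functions, asymptotically additive in the interval, so it suffices to estimate
them on short intervals ending or starting at a given point t, with an error ε times the increment
of a fixed monotone W; `interval_induction` glues these estimates. On one side of t, F and f are
close to their one-sided limits, and only the term touching t needs care. Additivity can fail only
through a partition interval having t in its interior. If t is accessible there is eventually none;
if not, the membership in D⁺ or D⁻ makes the relevant jump at t vanish.

The local estimates are of two kinds. For Young sums, the Love-Young inequality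
`exists_abs_youngSum_le` has a bound that is small as soon as F oscillates little, which is
essential because h may jump at t. For sums of second order, `IsBracket.asympWithin_left` and
`IsBracket.asympWithin_right` compare them with the bracket. Since p < 2, squares of increments of h
are negligible, and `IsBracket.add` shows that f has a bracket with the continuous part of that of
g. `IsBracket.exists_secondOrder` finds the limit of the Taylor remainders; `IsLeftPrim.hasLY` and
`IsRightPrim.hasRY` identify limits along λ with Young integrals, which are defined by refinement.
-/

/-- A transitive relation on the points of an interval which holds near each point, on either
side, holds throughout. -/
theorem interval_induction {a b : ℝ} {P : ℝ → ℝ → Prop}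
    (trans : ∀ u t v, a ≤ u → u < t → t < v → v ≤ b → P u t → P t v → P u v)
    (hl : ∀ t ∈ Ioc a b, ∀ᶠ s in 𝓝[<] t, P s t)
    (hr : ∀ t ∈ Ico a b, ∀ᶠ s in 𝓝[>] t, P t s)
    {u v : ℝ} (hu : a ≤ u) (huv : u < v) (hv : v ≤ b) : P u v := by
  have right_pt : ∀ t ∈ Ico a b, ∃ d, t < d ∧ ∀ s ∈ Ioo t d, P t s := by
    intro t ht
    obtain ⟨d, hd, h⟩ := mem_nhdsGT_iff_exists_Ioo_subset.1 (hr t ht)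
    exact ⟨d, hd, fun s hs => h hs⟩
  -- Continuous induction: the supremum c of S lies in S by the left condition at c, and c < v would
  -- contradict the right condition at c.
  set S := {x | x ∈ Ioc u v ∧ P u x}
  have hbdd : BddAbove S := ⟨v, fun x hx => hx.1.2⟩
  have hne : S.Nonempty := by
    obtain ⟨d, hd, h⟩ := right_pt u ⟨hu, huv.trans_le hv⟩
    have h1 : u < min d v := lt_min hd huv
    refine ⟨(u + min d v) / 2, ⟨⟨by linarith, by linarith [min_le_right d v]⟩, h _ ⟨by linarith, ?_⟩⟩⟩
    linarith [min_le_left d v]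
  set c := sSup S
  have hcv : c ≤ v := csSup_le hne fun x hx => hx.1.2
  have huc : u < c := by
    obtain ⟨x, hx⟩ := hne
    exact hx.1.1.trans_le (le_csSup hbdd hx)
  have hPc : P u c := by
    obtain ⟨d, hd, h⟩ :=
      mem_nhdsLT_iff_exists_Ioo_subset.1 (hl c ⟨hu.trans_lt huc, hcv.trans hv⟩)
    obtain ⟨x, hx, hdx⟩ := exists_lt_of_lt_csSup hne hd
    rcases (le_csSup hbdd hx).lt_or_eq with hxc | hxc
    · exact trans u x c hu hx.1.1 hxc (hcv.trans hv) hx.2 (h ⟨hdx, hxc⟩)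
    · exact (show x = c from hxc) ▸ hx.2
  rcases hcv.lt_or_eq with hlt | heq
  · exfalso
    obtain ⟨d, hd, h⟩ := right_pt c ⟨hu.trans huc.le, hlt.trans_le hv⟩
    have h1 : c < min d v := lt_min hd hlt
    set x := (c + min d v) / 2
    have hcx : c < x := by simp only [x]; linarith
    have hxd : x < d := by simp only [x]; linarith [min_le_left d v]
    have hxv : x ≤ v := by simp only [x]; linarith [min_le_right d v]
    have : x ∈ S := ⟨⟨huc.trans hcx, hxv⟩,
      trans u c x hu huc hcx (hxv.trans hv) hPc (h x ⟨hcx, hxd⟩)⟩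
    exact absurd (le_csSup hbdd this) (not_le.2 hcx)
  · exact heq ▸ hPc

/-! ### From local estimates to convergence of asymptotically additive interval functions -/

section LocalToGlobal

variable {α : Type*} {L : Filter α} {S : α → ℝ → ℝ → ℝ} {W : ℝ → ℝ} {a b : ℝ}

/-- `S i s t` is asymptotically within `r` of `c`. -/
def AsympWithin (L : Filter α) (S : α → ℝ → ℝ → ℝ) (s t c r : ℝ) : Prop :=
  ∀ η > 0, ∀ᶠ i in L, |S i s t - c| ≤ r + η

/-- `S` is asymptotically an additive interval function on `[a, b]`. -/
def AsympAdditive (L : Filter α) (S : α → ℝ → ℝ → ℝ) (a b : ℝ) : Prop :=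
  ∀ u t v, a ≤ u → u < t → t < v → v ≤ b →
    Tendsto (fun i => S i u v - S i u t - S i t v) L (𝓝 0)

/-- Errors of the form ε times an increment of `W` add up exactly when intervals are joined, so the
bound survives an uncontrolled number of gluings. The predicate `A` carries what is known of the
approximating value `c`: either that it is an increment of a given function, or nothing. -/
theorem asympWithin_of_local (hS : AsympAdditive L S a b) {A : ℝ → ℝ → ℝ → Prop}
    (hA : ∀ u t v c d, A u t c → A t v d → A u v (c + d)) {ε : ℝ}
    (hl : ∀ t ∈ Ioc a b, ∀ᶠ s in 𝓝[<] t, ∃ c, A s t c ∧ AsympWithin L S s t c (ε * (W t - W s)))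
    (hr : ∀ t ∈ Ico a b, ∀ᶠ s in 𝓝[>] t, ∃ c, A t s c ∧ AsympWithin L S t s c (ε * (W s - W t)))
    {u v : ℝ} (hu : a ≤ u) (huv : u < v) (hv : v ≤ b) :
    ∃ c, A u v c ∧ AsympWithin L S u v c (ε * (W v - W u)) := by
  refine interval_induction (P := fun u v => ∃ c, A u v c ∧
    AsympWithin L S u v c (ε * (W v - W u))) ?_ hl hr hu huv hv
  rintro u t v hu hut htv hv ⟨c, hc, hc'⟩ ⟨d, hd, hd'⟩
  refine ⟨c + d, hA _ _ _ _ _ hc hd, fun η hη => ?_⟩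
  have h0 := Metric.tendsto_nhds.1 (hS u t v hu hut htv hv) (η / 3) (by positivity)
  filter_upwards [h0, hc' (η / 3) (by positivity), hd' (η / 3) (by positivity)] with i h0 h1 h2
  rw [Real.dist_eq, sub_zero] at h0
  have := abs_lt.1 h0
  have := abs_le.1 h1
  have := abs_le.1 h2
  rw [abs_le]
  constructor <;> nlinarith

theorem tendsto_of_local (hW : Monotone W) (hS : AsympAdditive L S a b) (T : ℝ → ℝ)
    (hl : ∀ ε > 0, ∀ t ∈ Ioc a b, ∀ᶠ s in 𝓝[<] t,
      AsympWithin L S s t (T t - T s) (ε * (W t - W s)))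
    (hr : ∀ ε > 0, ∀ t ∈ Ico a b, ∀ᶠ s in 𝓝[>] t,
      AsympWithin L S t s (T s - T t) (ε * (W s - W t)))
    {u v : ℝ} (hu : a ≤ u) (huv : u < v) (hv : v ≤ b) :
    Tendsto (fun i => S i u v) L (𝓝 (T v - T u)) := by
  rw [Metric.tendsto_nhds]
  intro ε hε
  have hWuv := hW huv.le
  have hpos : 0 < W v - W u + 1 := by linarith
  -- Dividing by the total increment of `W`, plus one to keep the divisor positive, turns the
  -- relative error into an absolute one.
  obtain ⟨c, hc, h⟩ := asympWithin_of_local (W := W) (ε := ε / 4 / (W v - W u + 1)) hS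
    (A := fun s t c => c = T t - T s) (by rintro u t v c d rfl rfl; ring)
    (fun t ht => (hl _ (by positivity) t ht).mono fun s hs => ⟨_, rfl, hs⟩)
    (fun t ht => (hr _ (by positivity) t ht).mono fun s hs => ⟨_, rfl, hs⟩) hu huv hv
  filter_upwards [h (ε / 4) (by positivity)] with i hi
  rw [Real.dist_eq, ← hc]
  have : ε / 4 / (W v - W u + 1) * (W v - W u) ≤ ε / 4 := by
    rw [div_mul_eq_mul_div, div_le_iff₀ hpos]
    nlinarith
  linarith

/-- Here the local values need not be increments of one function. Joining them still confines the
sums eventually to arbitrarily small balls, so completeness produces the limit, and asymptotic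
additivity makes the limit additive. -/
theorem exists_tendsto_of_local [L.NeBot] (hW : Monotone W) (hS : AsympAdditive L S a b)
    (hl : ∀ ε > 0, ∀ t ∈ Ioc a b, ∀ᶠ s in 𝓝[<] t, ∃ c, AsympWithin L S s t c (ε * (W t - W s)))
    (hr : ∀ ε > 0, ∀ t ∈ Ico a b, ∀ᶠ s in 𝓝[>] t, ∃ c, AsympWithin L S t s c (ε * (W s - W t))) :
    ∃ T : ℝ → ℝ, ∀ u v, a ≤ u → u < v → v ≤ b → Tendsto (fun i => S i u v) L (𝓝 (T v - T u)) := by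
  have key : ∀ t ∈ Ioc a b, ∃ l, Tendsto (fun i => S i a t) L (𝓝 l) := by
    intro v hv
    refine cauchy_map_iff_exists_tendsto.1 (Metric.cauchy_iff.2 ⟨inferInstance, fun ε hε => ?_⟩)
    have hWuv := hW hv.1.le
    have hpos : 0 < W v - W a + 1 := by linarith
    obtain ⟨c, -, h⟩ := asympWithin_of_local (W := W) (ε := ε / 8 / (W v - W a + 1)) hS
      (A := fun s t c => True) (fun _ _ _ _ _ _ _ => trivial)
      (fun t ht => (hl _ (by positivity) t ht).mono fun s ⟨c, hs⟩ => ⟨c, trivial, hs⟩)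
      (fun t ht => (hr _ (by positivity) t ht).mono fun s ⟨c, hs⟩ => ⟨c, trivial, hs⟩)
      le_rfl hv.1 hv.2
    have : ε / 8 / (W v - W a + 1) * (W v - W a) ≤ ε / 8 := by
      rw [div_mul_eq_mul_div, div_le_iff₀ hpos]
      nlinarith
    refine ⟨Metric.closedBall c (ε / 4), ?_, fun x hx y hy => ?_⟩
    · rw [mem_map]
      filter_upwards [h (ε / 8) (by positivity)] with i hi
      rw [mem_preimage, Metric.mem_closedBall, Real.dist_eq]
      linarith
    · have := dist_triangle_right x y c
      rw [Metric.mem_closedBall] at hx hy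
      linarith
  choose! l hl' using key
  have hS' : ∀ v, a < v → v ≤ b → Tendsto (fun i => S i a v) L
      (𝓝 ((if a < v then l v else 0) - if a < a then l a else 0)) := by
    intro v hav hv
    simpa [hav] using hl' v ⟨hav, hv⟩
  -- The value at `a` is set to 0 by hand: nothing is assumed about `S` on degenerate intervals, so
  -- `l a` is arbitrary.
  refine ⟨fun t => if a < t then l t else 0, fun u v hu huv hv => ?_⟩
  rcases hu.lt_or_eq with hau | rfl
  · have h1 := ((hl' v ⟨hau.trans huv, hv⟩).sub (hl' u ⟨hau, huv.le.trans hv⟩)).sub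
      (hS a u v le_rfl hau huv hv)
    simp only [hau, hau.trans huv, if_true, sub_zero] at h1 ⊢
    exact h1.congr fun i => by ring
  · exact hS' v huv hv

theorem abs_sub_le_of_asympWithin [L.NeBot] {s t c d r : ℝ} (h : AsympWithin L S s t c r)
    (hd : Tendsto (fun i => S i s t) L (𝓝 d)) : |d - c| ≤ r := by
  refine le_of_forall_pos_le_add fun η hη => ?_
  exact le_of_tendsto (hd.sub_const c).abs (h η hη)

end LocalToGlobal

/-! ### One-sided limits and jumps -/

section OneSidedLimits

variable {a b t L : ℝ} {f : ℝ → ℝ}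

theorem IsRegulated.tendsto_left (hf : IsRegulated a b f) (ht : t ∈ Ioc a b) :
    Tendsto f (𝓝[<] t) (𝓝 (leftLim f t)) :=
  tendsto_leftLim_of_tendsto (hf.1 t ht)

theorem IsRegulated.tendsto_right (hf : IsRegulated a b f) (ht : t ∈ Ico a b) :
    Tendsto f (𝓝[>] t) (𝓝 (rightLim f t)) :=
  tendsto_rightLim_of_tendsto (hf.2 t ht)

theorem leftLim_eq (h : Tendsto f (𝓝[<] t) (𝓝 L)) : leftLim f t = L :=
  leftLim_eq_of_tendsto h

theorem rightLim_eq (h : Tendsto f (𝓝[>] t) (𝓝 L)) : rightLim f t = L :=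
  rightLim_eq_of_tendsto h

theorem tendsto_sub_left (h : Tendsto f (𝓝[<] t) (𝓝 (leftLim f t))) :
    Tendsto (fun s => f t - f s) (𝓝[<] t) (𝓝 (jumpL f t)) := h.const_sub _

theorem tendsto_sub_right (h : Tendsto f (𝓝[>] t) (𝓝 (rightLim f t))) :
    Tendsto (fun s => f s - f t) (𝓝[>] t) (𝓝 (jumpR f t)) := h.sub_const _

theorem tendsto_of_tendsto_sub_left (h : Tendsto (fun s => f t - f s) (𝓝[<] t) (𝓝 L)) :
    Tendsto f (𝓝[<] t) (𝓝 (f t - L)) := by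
  simpa using h.const_sub (f t)

theorem tendsto_of_tendsto_sub_right (h : Tendsto (fun s => f s - f t) (𝓝[>] t) (𝓝 L)) :
    Tendsto f (𝓝[>] t) (𝓝 (f t + L)) := by
  simpa using h.const_add (f t)

theorem jumpL_eq (h : Tendsto (fun s => f t - f s) (𝓝[<] t) (𝓝 L)) : jumpL f t = L := by
  rw [jumpL, leftLim_eq (tendsto_of_tendsto_sub_left h)]
  ring

theorem jumpR_eq (h : Tendsto (fun s => f s - f t) (𝓝[>] t) (𝓝 L)) : jumpR f t = L := by
  rw [jumpR, rightLim_eq (tendsto_of_tendsto_sub_right h)]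
  ring

theorem isRegulated_of_tendsto_sub {cl cr : ℝ → ℝ}
    (hl : ∀ t ∈ Ioc a b, Tendsto (fun s => f t - f s) (𝓝[<] t) (𝓝 (cl t)))
    (hr : ∀ t ∈ Ico a b, Tendsto (fun s => f s - f t) (𝓝[>] t) (𝓝 (cr t))) :
    IsRegulated a b f :=
  ⟨fun t ht => ⟨_, tendsto_of_tendsto_sub_left (hl t ht)⟩,
    fun t ht => ⟨_, tendsto_of_tendsto_sub_right (hr t ht)⟩⟩

theorem IsRegulated.mono {u v : ℝ} (hf : IsRegulated a b f) (hu : a ≤ u) (hv : v ≤ b) :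
    IsRegulated u v f :=
  ⟨fun t ht => hf.1 t ⟨hu.trans_lt ht.1, ht.2.trans hv⟩,
    fun t ht => hf.2 t ⟨hu.trans ht.1, ht.2.trans_le hv⟩⟩

theorem _root_.Monotone.isRegulated (hf : Monotone f) : IsRegulated a b f :=
  ⟨fun t _ => ⟨_, hf.tendsto_leftLim t⟩, fun t _ => ⟨_, hf.tendsto_rightLim t⟩⟩

theorem mem_Ico_of_nhdsLT (h : t ∈ Ioc a b) : ∀ᶠ s in 𝓝[<] t, s ∈ Ioo a t :=
  Ioo_mem_nhdsLT h.1

theorem mem_Ioc_of_nhdsGT (h : t ∈ Ico a b) : ∀ᶠ s in 𝓝[>] t, s ∈ Ioo t b :=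
  Ioo_mem_nhdsGT h.2

/-- What holds for all points close to `t` on the left holds, close to `t`, for all points
up to `t`. -/
theorem eventually_Ico_of_nhdsLT {p : ℝ → Prop} (h : ∀ᶠ s in 𝓝[<] t, p s) :
    ∀ᶠ s in 𝓝[<] t, ∀ r ∈ Ico s t, p r := by
  obtain ⟨d, hd, h⟩ := mem_nhdsLT_iff_exists_Ioo_subset.1 h
  filter_upwards [Ioo_mem_nhdsLT hd] with s hs r hr using h ⟨hs.1.trans_le hr.1, hr.2⟩

theorem eventually_Ioc_of_nhdsGT {p : ℝ → Prop} (h : ∀ᶠ s in 𝓝[>] t, p s) :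
    ∀ᶠ s in 𝓝[>] t, ∀ r ∈ Ioc t s, p r := by
  obtain ⟨d, hd, h⟩ := mem_nhdsGT_iff_exists_Ioo_subset.1 h
  filter_upwards [Ioo_mem_nhdsGT hd] with s hs r hr using h ⟨hr.1, hr.2.trans_lt hs.2⟩

/-- A function `T` with increments near `t` close to those of a convergent function. -/
theorem tendsto_of_forall_abs_sub_le {W T : ℝ → ℝ} {l : Filter ℝ} {c : ℝ → ℝ} {C : ℝ}
    (hW : ∀ᶠ s in l, W s ≤ C) (h : ∀ ε > 0, ∀ᶠ s in l, |T s - c s| ≤ ε * W s)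
    (hc : Tendsto c l (𝓝 L)) : Tendsto T l (𝓝 L) := by
  have : Tendsto (fun s => T s - c s) l (𝓝 0) := by
    rw [Metric.tendsto_nhds]
    intro ε hε
    have hC : 0 < |C| + 1 := by positivity
    filter_upwards [h (ε / 2 / (|C| + 1)) (by positivity), hW] with s hs hW
    rw [Real.dist_eq, sub_zero]
    have h1 : ε / 2 / (|C| + 1) * W s ≤ ε / 2 := by
      rw [div_mul_eq_mul_div, div_le_iff₀ hC]
      nlinarith [le_abs_self C]
    linarith
  simpa using this.add hc

end OneSidedLimits

/-! ### The Love-Young inequality for finite sums -/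

section Discrete

/-- The Young sum over `[i, k)` recentred at its last tag. -/
def youngSum (F h : ℕ → ℝ) (i k : ℕ) : ℝ :=
  ∑ m ∈ Finset.Ico i k, (F m - F k) * (h (m + 1) - h m)

theorem youngSum_split (F h : ℕ → ℝ) {i j k : ℕ} (hij : i ≤ j) (hjk : j ≤ k) :
    youngSum F h i k = youngSum F h i j + (F j - F k) * (h j - h i) + youngSum F h j k := by
  unfold youngSum
  rw [← Finset.sum_Ico_consecutive _ hij hjk, ← Finset.sum_Ico_sub h hij, Finset.mul_sum,
    ← Finset.sum_add_distrib]
  congr 1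
  exact Finset.sum_congr rfl fun m _ => by ring

/-- Bisection with respect to the control `c`. Cutting out one index `j` leaves two pieces carrying
at most half of the control each, and three cross terms bounded by `M * w ^ θ`. By induction the
pieces contribute `2 * 2 ^ (-θ) * K` and the cross terms 3, so the bound reproduces itself when `3 +
K * 2 ^ (1 - θ) ≤ K`, which is solvable because `θ > 1`. -/
theorem abs_youngSum_le {F h c : ℕ → ℝ} {n : ℕ} {θ M K : ℝ} (hθ : 1 < θ) (hM : 0 ≤ M)
    (hK : 3 + K * 2 ^ (1 - θ) ≤ K) (hK0 : 0 ≤ K) (hc : ∀ i j, i ≤ j → j ≤ n → c i ≤ c j)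
    (H : ∀ i j l k, i ≤ j → j ≤ k → i ≤ l → l ≤ k → k ≤ n →
      |F j - F k| * |h l - h i| ≤ M * (c k - c i) ^ θ) :
    ∀ d i k, k = i + d → k ≤ n → |youngSum F h i k| ≤ K * M * (c k - c i) ^ θ := by
  intro d
  induction d using Nat.strong_induction_on with
  | _ d ih =>
    intro i k hk hkn
    rcases Nat.eq_zero_or_pos d with rfl | hd
    · have : 0 ≤ (c k - c i) ^ θ := Real.rpow_nonneg (sub_nonneg.2 (hc i k (by omega) hkn)) _
      simp only [youngSum, show k = i by omega, Finset.Ico_self, Finset.sum_empty, abs_zero]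
      subst hk
      positivity
    have hw : 0 ≤ c k - c i := sub_nonneg.2 (hc i k (by omega) hkn)
    set w := c k - c i
    -- If the second inequality failed whenever the first holds, the first would propagate from `j =
    -- i` up to `j = k - 1`, where the second is trivial.
    obtain ⟨j, hij, hjk, hj1, hj2⟩ : ∃ j, i ≤ j ∧ j < k ∧ c j - c i ≤ w / 2 ∧
        c k - c (j + 1) ≤ w / 2 := by
      by_contra! hcon
      have : ∀ e, i + e < k → c (i + e) - c i ≤ w / 2 := by
        intro e
        induction e with
        | zero => intro _; simpa using by positivity
        | succ e ihe =>
          intro he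
          have := hcon (i + e) (by omega) (by omega) (ihe (by omega))
          rw [← add_assoc]
          simp only [w] at *
          linarith
      have h1 := hcon (k - 1) (by omega) (by omega) (by
        have := this (k - 1 - i) (by omega)
        rwa [show i + (k - 1 - i) = k - 1 by omega] at this)
      rw [show k - 1 + 1 = k by omega, sub_self] at h1
      linarith
    have half : ∀ z, 0 ≤ z → z ≤ w / 2 → K * M * z ^ θ ≤ K * M * 2 ^ (-θ) * w ^ θ := by
      intro z hz hzw
      have h1 : z ^ θ ≤ (w / 2) ^ θ := Real.rpow_le_rpow hz hzw (by linarith)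
      rw [Real.div_rpow hw (by norm_num), div_eq_mul_inv, ← Real.rpow_neg (by norm_num)] at h1
      calc K * M * z ^ θ ≤ K * M * (w ^ θ * 2 ^ (-θ)) := by gcongr
        _ = _ := by ring
    have mono : ∀ z, 0 ≤ z → z ≤ w → M * z ^ θ ≤ M * w ^ θ := fun z hz hzw => by
      have := Real.rpow_le_rpow hz hzw (by linarith : 0 ≤ θ)
      gcongr
    have c1 := hc i j hij (by omega)
    have c2 := hc j (j + 1) (by omega) (by omega)
    have c3 := hc (j + 1) k (by omega) hkn
    have e1 := (ih (j - i) (by omega) i j (by omega) (by omega)).trans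
      (half _ (by linarith) hj1)
    have e2 := (ih (k - (j + 1)) (by omega) (j + 1) k (by omega) (by omega)).trans
      (half _ (by linarith) hj2)
    have e3 := H i j j k hij hjk.le hij hjk.le hkn
    have e4 := (H j (j + 1) (j + 1) k (by omega) (by omega) (by omega) (by omega) hkn).trans
      (mono _ (by linarith) (by simp only [w]; linarith))
    have e5 := (H j j (j + 1) (j + 1) le_rfl (by omega) (by omega) le_rfl (by omega)).trans
      (mono _ (by linarith) (by simp only [w]; linarith))
    have e6 : youngSum F h j (j + 1) = (F j - F (j + 1)) * (h (j + 1) - h j) := by simp [youngSum]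
    have e7 : (2 : ℝ) * 2 ^ (-θ) = 2 ^ (1 - θ) := by
      rw [sub_eq_add_neg, Real.rpow_add (by norm_num), Real.rpow_one]
    rw [youngSum_split F h hij hjk.le, youngSum_split F h (i := j) (j := j + 1) (k := k)
      (by omega) (by omega), e6]
    rw [← abs_mul] at e3 e4 e5
    have e8 : 0 ≤ M * w ^ θ := mul_nonneg hM (Real.rpow_nonneg hw _)
    have e9 := mul_le_mul_of_nonneg_right hK e8
    rw [← e7] at e9
    rw [abs_le] at *
    constructor <;> linarith [e1.1, e2.1, e3.1, e4.1, e5.1, e1.2, e2.2, e3.2, e4.2, e5.2]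

/-- The gain is the factor `x ^ (1 / p + 1 / q - 1)`: with x the increment of the control of F, it
tends to 0 with x even when y does not, leaving an error linear in the increment `x + y`. -/
theorem rpow_mul_rpow_le {p q x y : ℝ} (hp : 1 ≤ p) (hq : 0 < q) (hx : 0 ≤ x) (hy : 0 ≤ y) :
    x ^ (1 / q) * y ^ (1 / p) ≤ x ^ (1 / p + 1 / q - 1) * (x + y) := by
  have hp0 : 0 < p := by linarith
  rcases hx.eq_or_lt with rfl | hx
  · rw [Real.zero_rpow (by positivity), zero_mul]
    positivity
  have h1 : x ^ (1 / q) = x ^ (1 / p + 1 / q - 1) * x ^ (1 - 1 / p) := by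
    rw [← Real.rpow_add hx]; ring_nf
  have hp1 : 0 ≤ 1 - 1 / p := sub_nonneg.2 ((div_le_one hp0).2 hp)
  have h2 : x ^ (1 - 1 / p) ≤ (x + y) ^ (1 - 1 / p) :=
    Real.rpow_le_rpow hx.le (by linarith) hp1
  have h3 : y ^ (1 / p) ≤ (x + y) ^ (1 / p) :=
    Real.rpow_le_rpow hy (by linarith) (by positivity)
  rw [h1, mul_assoc]
  gcongr
  calc x ^ (1 - 1 / p) * y ^ (1 / p) ≤ (x + y) ^ (1 - 1 / p) * (x + y) ^ (1 / p) := by gcongr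
    _ = x + y := by rw [← Real.rpow_add (by linarith)]; simp

theorem le_rpow_inv {p x y : ℝ} (hp : 0 < p) (hx : 0 ≤ x) (h : x ^ p ≤ y) : x ≤ y ^ (1 / p) := by
  rw [one_div, Real.le_rpow_inv_iff_of_pos hx ((Real.rpow_nonneg hx p).trans h) hp]
  exact h

/-- The control of F and that of h are scaled separately to total increment at most 1, so the scales
appear as `x ^ (1 / q) * y ^ (1 / p)`. Using the plain sum of the controls would lose the smallness
in `x` alone. -/
theorem exists_abs_youngSum_le {p q : ℝ} (hp : 1 ≤ p) (hq : 0 < q) (hpq : 1 < 1 / p + 1 / q) :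
    ∃ K, 0 ≤ K ∧ ∀ (n : ℕ) (F h A B : ℕ → ℝ) (x y : ℝ),
      (∀ i j, i ≤ j → j ≤ n → |F j - F i| ^ q ≤ A j - A i) →
      (∀ i j, i ≤ j → j ≤ n → |h j - h i| ^ p ≤ B j - B i) →
      A n - A 0 ≤ x → B n - B 0 ≤ y →
      |youngSum F h 0 n| ≤ K * (x ^ (1 / p + 1 / q - 1) * (x + y)) := by
  have hp0 : 0 < p := by linarith
  set θ := 1 / p + 1 / q with hθ
  have h2 : (2 : ℝ) ^ (1 - θ) < 1 := Real.rpow_lt_one_of_one_lt_of_neg (by norm_num) (by linarith)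
  set K := 3 / (1 - (2 : ℝ) ^ (1 - θ)) with hK
  have hK0 : 0 ≤ K := div_nonneg (by norm_num) (by linarith)
  have hK3 : 3 + K * 2 ^ (1 - θ) ≤ K := by
    have : K * (1 - (2 : ℝ) ^ (1 - θ)) = 3 := div_mul_cancel₀ _ (by linarith)
    linarith
  refine ⟨K * 2 ^ θ, by positivity, fun n F h A B x y hF hh hx hy => ?_⟩
  have mA : ∀ i j, i ≤ j → j ≤ n → A i ≤ A j := fun i j hij hj =>
    sub_nonneg.1 ((Real.rpow_nonneg (abs_nonneg _) _).trans (hF i j hij hj))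
  have mB : ∀ i j, i ≤ j → j ≤ n → B i ≤ B j := fun i j hij hj =>
    sub_nonneg.1 ((Real.rpow_nonneg (abs_nonneg _) _).trans (hh i j hij hj))
  have hx0 : 0 ≤ x := (sub_nonneg.2 (mA 0 n (Nat.zero_le _) le_rfl)).trans hx
  have hy0 : 0 ≤ y := (sub_nonneg.2 (mB 0 n (Nat.zero_le _) le_rfl)).trans hy
  have dF : ∀ i j, i ≤ j → j ≤ n → |F i - F j| ≤ (A j - A i) ^ (1 / q) := fun i j hij hj => by
    rw [abs_sub_comm]
    exact le_rpow_inv hq (abs_nonneg _) (hF i j hij hj)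
  have dh : ∀ i j, i ≤ j → j ≤ n → |h j - h i| ≤ (B j - B i) ^ (1 / p) := fun i j hij hj =>
    le_rpow_inv hp0 (abs_nonneg _) (hh i j hij hj)
  have nonneg : 0 ≤ K * 2 ^ θ * (x ^ (θ - 1) * (x + y)) := by positivity
  -- The scaling divides by `x` and `y`. If either is zero, F or h is constant along the indices and
  -- the sum vanishes.
  rcases hx0.eq_or_lt with rfl | hxp
  · have : youngSum F h 0 n = 0 := Finset.sum_eq_zero fun m hm => by
      have hm := (Finset.mem_Ico.1 hm).2.le
      have h1 := dF m n hm le_rfl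
      have : A n - A m = 0 := by linarith [mA 0 m (Nat.zero_le _) hm, mA m n hm le_rfl]
      rw [this, Real.zero_rpow (by positivity)] at h1
      rw [abs_nonpos_iff.1 h1, zero_mul]
    rw [this, abs_zero]
    exact nonneg
  rcases hy0.eq_or_lt with rfl | hyp
  · have : youngSum F h 0 n = 0 := Finset.sum_eq_zero fun m hm => by
      have hm : m + 1 ≤ n := (Finset.mem_Ico.1 hm).2
      have h1 := dh m (m + 1) (by omega) hm
      have : B (m + 1) - B m = 0 := by
        linarith [mB 0 m (Nat.zero_le _) (by omega), mB m (m + 1) (by omega) hm,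
          mB (m + 1) n hm le_rfl]
      rw [this, Real.zero_rpow (by positivity)] at h1
      rw [abs_nonpos_iff.1 h1, mul_zero]
    rw [this, abs_zero]
    exact nonneg
  have key := abs_youngSum_le (F := F) (h := h) (c := fun i => A i / x + B i / y) (n := n)
    (θ := θ) (M := x ^ (1 / q) * y ^ (1 / p)) (K := K) hpq (by positivity) hK3 hK0
    (fun i j hij hj => by
      have := mA i j hij hj
      have := mB i j hij hj
      gcongr) (fun i j l k hij hjk hil hlk hk => by
      have a0 := mA i j hij (hjk.trans hk)
      have a1 := mA j k hjk hk
      have b0 := mB i l hil (hlk.trans hk)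
      have b1 := mB l k hlk hk
      set z := A k / x + B k / y - (A i / x + B i / y) with hz
      have hz' : z = (A k - A i) / x + (B k - B i) / y := by rw [hz]; ring
      have za : (A k - A j) / x ≤ z := by
        rw [hz']
        have : 0 ≤ (B k - B i) / y := div_nonneg (by linarith) hyp.le
        have : (A k - A j) / x ≤ (A k - A i) / x := by gcongr
        linarith
      have zb : (B l - B i) / y ≤ z := by
        rw [hz']
        have : 0 ≤ (A k - A i) / x := div_nonneg (by linarith) hxp.le
        have : (B l - B i) / y ≤ (B k - B i) / y := by gcongr
        linarith
      have ya : 0 ≤ (A k - A j) / x := div_nonneg (by linarith) hxp.le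
      have yb : 0 ≤ (B l - B i) / y := div_nonneg (by linarith) hyp.le
      have f1 : |F j - F k| ≤ x ^ (1 / q) * z ^ (1 / q) := by
        refine (dF j k hjk hk).trans ?_
        rw [← Real.mul_rpow hxp.le (ya.trans za)]
        exact Real.rpow_le_rpow (by linarith) (by rwa [div_le_iff₀' hxp] at za) (by positivity)
      have f2 : |h l - h i| ≤ y ^ (1 / p) * z ^ (1 / p) := by
        refine (dh i l hil (hlk.trans hk)).trans ?_
        rw [← Real.mul_rpow hyp.le (ya.trans za)]
        exact Real.rpow_le_rpow (by linarith) (by rwa [div_le_iff₀' hyp] at zb) (by positivity)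
      have hz0 : 0 ≤ z := ya.trans za
      calc |F j - F k| * |h l - h i|
          ≤ (x ^ (1 / q) * z ^ (1 / q)) * (y ^ (1 / p) * z ^ (1 / p)) := by gcongr
        _ = x ^ (1 / q) * y ^ (1 / p) * (z ^ (1 / p) * z ^ (1 / q)) := by ring
        _ = x ^ (1 / q) * y ^ (1 / p) * z ^ θ := by
          rw [hθ, Real.rpow_add_of_nonneg (ya.trans za) (by positivity) (by positivity)])
    n 0 n (by omega) le_rfl
  have hc2 : A n / x + B n / y - (A 0 / x + B 0 / y) ≤ 2 := by
    have : (A n - A 0) / x ≤ 1 := (div_le_one hxp).2 hx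
    have : (B n - B 0) / y ≤ 1 := (div_le_one hyp).2 hy
    have : A n / x + B n / y - (A 0 / x + B 0 / y) = (A n - A 0) / x + (B n - B 0) / y := by ring
    linarith
  have hc0 : 0 ≤ A n / x + B n / y - (A 0 / x + B 0 / y) := by
    have := div_nonneg (sub_nonneg.2 (mA 0 n (Nat.zero_le _) le_rfl)) hxp.le
    have := div_nonneg (sub_nonneg.2 (mB 0 n (Nat.zero_le _) le_rfl)) hyp.le
    have : A n / x + B n / y - (A 0 / x + B 0 / y) = (A n - A 0) / x + (B n - B 0) / y := by ring
    linarith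
  have hc3 := Real.rpow_le_rpow hc0 hc2 (show 0 ≤ θ by linarith)
  have hprod := rpow_mul_rpow_le hp hq hx0 hy0
  calc |youngSum F h 0 n| ≤ _ := key
    _ ≤ K * (x ^ (1 / p + 1 / q - 1) * (x + y)) * 2 ^ θ := by gcongr
    _ = _ := by ring

end Discrete

/-! ### Monotone controls of p-variation, and one-sided modifications -/

section Control

/-- The monotone function `W` controls the `p`-variation of `f` on `[a, b]`. -/
def Ctrl (a b p : ℝ) (f W : ℝ → ℝ) : Prop :=
  Monotone W ∧ ∀ s t, a ≤ s → s ≤ t → t ≤ b → |f t - f s| ^ p ≤ W t - W s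

variable {a b p q t : ℝ} {F f h W : ℝ → ℝ}

theorem clamp_mono (s t : ℝ) : Monotone (clamp s t) := fun _ _ hxy =>
  max_le_max le_rfl (min_le_min le_rfl hxy)

theorem clamp_mem {s t : ℝ} (hst : s ≤ t) (x : ℝ) : clamp s t x ∈ Icc s t :=
  ⟨le_max_left _ _, max_le hst (min_le_left _ _)⟩

theorem clamp_of_mem {s t x : ℝ} (hx : x ∈ Icc s t) : clamp s t x = x := by
  simp [clamp, hx.1, hx.2]

/-- The partition with one point added on the right. -/
def Part.snoc {s : ℝ} (κ : Part a s) (t : ℝ) (hst : s < t) : Part a t where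
  n := κ.n + 1
  x i := if i ≤ κ.n then κ.x i else t
  strictMono := by
    intro i hi j hj hij
    have hi' : i ≤ κ.n := by simp only [mem_Iic] at hj; omega
    have hle : κ.x i ≤ s := (κ.strictMono.monotoneOn hi' self_mem_Iic hi').trans κ.right.le
    by_cases hj' : j ≤ κ.n
    · simpa [hi', hj'] using κ.strictMono hi' hj' hij
    · simpa [hi', hj'] using hle.trans_lt hst
  left := by simp [κ.left]
  right := by simp

theorem varSum_snoc {s : ℝ} (κ : Part a s) (hst : s < t) :
    varSum p f (κ.snoc t hst) = varSum p f κ + |f t - f s| ^ p := by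
  unfold varSum
  rw [show (κ.snoc t hst).n = κ.n + 1 from rfl, Finset.sum_range_succ]
  congr 1
  · refine Finset.sum_congr rfl fun i hi => ?_
    have := Finset.mem_range.1 hi
    simp [Part.snoc, this.le, Nat.succ_le_of_lt this]
  · simp [Part.snoc, κ.right]

/-- The one-point partition. -/
def Part.point (a : ℝ) : Part a a where
  n := 0
  x _ := a
  strictMono := by
    intro i hi j hj hij
    simp only [mem_Iic] at hi hj
    omega
  left := rfl
  right := rfl

theorem part_nonempty (hab : a ≤ b) : Nonempty (Part a b) := by
  rcases hab.eq_or_lt with rfl | hab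
  · exact ⟨Part.point a⟩
  · exact ⟨(Part.point a).snoc b hab⟩

/-- The control is the variation function: the supremum of the sums over partitions of [a, t].
Appending one interval gives superadditivity; clamping the argument makes the function monotone on
the whole line. -/
theorem BddPVar.exists_ctrl (hab : a ≤ b) (hp : 0 < p) (hf : BddPVar a b p f) :
    ∃ W, Ctrl a b p f W := by
  obtain ⟨M, hM⟩ := hf
  have bdd : ∀ t, t ≤ b → BddAbove (range fun κ : Part a t => varSum p f κ) := by
    intro t htb
    refine ⟨M, ?_⟩
    rintro _ ⟨κ, rfl⟩
    rcases htb.eq_or_lt with rfl | htb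
    · exact hM κ
    · have := hM (κ.snoc b htb)
      rw [varSum_snoc] at this
      have h2 : 0 ≤ |f b - f t| ^ p := Real.rpow_nonneg (abs_nonneg _) _
      simp only
      linarith
  set V : ℝ → ℝ := fun t => sSup (range fun κ : Part a t => varSum p f κ)
  have key : ∀ s t, a ≤ s → s ≤ t → t ≤ b → |f t - f s| ^ p ≤ V t - V s := by
    intro s t hs hst ht
    rcases hst.eq_or_lt with rfl | hst
    · simp [Real.zero_rpow hp.ne']
    rw [le_sub_iff_add_le, add_comm, ← le_sub_iff_add_le]
    have := part_nonempty hs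
    refine csSup_le (range_nonempty _) ?_
    rintro _ ⟨κ, rfl⟩
    rw [le_sub_iff_add_le]
    exact le_csSup_of_le (bdd t ht) ⟨κ.snoc t hst, rfl⟩ (varSum_snoc κ hst).ge
  refine ⟨fun x => V (clamp a b x), fun x y hxy => ?_, fun s t hs hst ht => ?_⟩
  · have := key _ _ (clamp_mem hab x).1 (clamp_mono a b hxy) (clamp_mem hab y).2
    have h2 : 0 ≤ |f (clamp a b y) - f (clamp a b x)| ^ p := Real.rpow_nonneg (abs_nonneg _) _
    simp only
    linarith
  · simp only [clamp_of_mem (show s ∈ Icc a b from ⟨hs, hst.trans ht⟩),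
      clamp_of_mem (show t ∈ Icc a b from ⟨hs.trans hst, ht⟩)]
    exact key s t hs hst ht

theorem Ctrl.abs_sub_le (hf : Ctrl a b p f W) (hp : 0 < p) {s t : ℝ} (hs : a ≤ s) (hst : s ≤ t)
    (ht : t ≤ b) : |f t - f s| ≤ (W t - W s) ^ (1 / p) :=
  le_rpow_inv hp (abs_nonneg _) (hf.2 s t hs hst ht)

theorem Ctrl.mono {u v : ℝ} (hf : Ctrl a b p f W) (hu : a ≤ u) (hv : v ≤ b) : Ctrl u v p f W :=
  ⟨hf.1, fun s t hs hst ht => hf.2 s t (hu.trans hs) hst (ht.trans hv)⟩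

/-- An increment to the power `q - p` is bounded by a constant on [a, b], which is absorbed into the
control. -/
theorem Ctrl.exponent_mono (hf : Ctrl a b p f W) (hp : 0 < p) (hpq : p ≤ q) :
    ∃ W', Ctrl a b q f W' := by
  set C := (W b - W a) ^ ((q - p) / p)
  by_cases hab : a ≤ b
  swap
  · exact ⟨W, hf.1, fun s t hs hst ht => absurd (hs.trans (hst.trans ht)) hab⟩
  have hC : 0 ≤ C := Real.rpow_nonneg (sub_nonneg.2 (hf.1 hab)) _
  refine ⟨fun x => C * W x, fun x y hxy => mul_le_mul_of_nonneg_left (hf.1 hxy) hC,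
    fun s t hs hst ht => ?_⟩
  have h1 : |f t - f s| ^ (q - p) ≤ C := by
    calc |f t - f s| ^ (q - p) ≤ ((W t - W s) ^ (1 / p)) ^ (q - p) :=
          Real.rpow_le_rpow (abs_nonneg _) (hf.abs_sub_le hp hs hst ht) (by linarith)
      _ = (W t - W s) ^ ((q - p) / p) := by
          rw [← Real.rpow_mul (sub_nonneg.2 (hf.1 hst))]; ring_nf
      _ ≤ C := Real.rpow_le_rpow (sub_nonneg.2 (hf.1 hst))
          (by linarith [hf.1 ht, hf.1 hs]) (div_nonneg (by linarith) hp.le)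
  calc |f t - f s| ^ q = |f t - f s| ^ (q - p) * |f t - f s| ^ p := by
        rw [← Real.rpow_add_of_nonneg (abs_nonneg _) (by linarith) hp.le]; ring_nf
    _ ≤ C * (W t - W s) := mul_le_mul h1 (hf.2 s t hs hst ht)
        (Real.rpow_nonneg (abs_nonneg _) _) hC
    _ = C * W t - C * W s := by ring

theorem Ctrl.add {f' W' : ℝ → ℝ} (hf : Ctrl a b p f W) (hf' : Ctrl a b p f' W') (hp : 1 ≤ p) :
    Ctrl a b p (fun x => f x + f' x) (fun x => 2 ^ (p - 1) * (W x + W' x)) := by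
  have hC : (0 : ℝ) ≤ 2 ^ (p - 1) := by positivity
  refine ⟨fun x y hxy => mul_le_mul_of_nonneg_left (add_le_add (hf.1 hxy) (hf'.1 hxy)) hC,
    fun s t hs hst ht => ?_⟩
  have h1 : |f t + f' t - (f s + f' s)| ≤ |f t - f s| + |f' t - f' s| := by
    rw [show f t + f' t - (f s + f' s) = (f t - f s) + (f' t - f' s) by ring]
    exact abs_add_le _ _
  calc |f t + f' t - (f s + f' s)| ^ p ≤ (|f t - f s| + |f' t - f' s|) ^ p :=
        Real.rpow_le_rpow (abs_nonneg _) h1 (by linarith)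
    _ ≤ 2 ^ (p - 1) * (|f t - f s| ^ p + |f' t - f' s| ^ p) := by
        have := NNReal.rpow_add_le_mul_rpow_add_rpow ⟨|f t - f s|, abs_nonneg _⟩
          ⟨|f' t - f' s|, abs_nonneg _⟩ hp
        exact_mod_cast this
    _ ≤ 2 ^ (p - 1) * ((W t - W s) + (W' t - W' s)) := by
        gcongr
        · exact hf.2 s t hs hst ht
        · exact hf'.2 s t hs hst ht
    _ = _ := by ring

theorem Ctrl.comp_lipschitz {g : ℝ → ℝ} {K : ℝ} (hf : Ctrl a b p f W) (hp : 0 < p) (hK : 0 ≤ K)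
    (hg : ∀ s ∈ Icc a b, ∀ t ∈ Icc a b, |g t - g s| ≤ K * |f t - f s|) :
    Ctrl a b p g (fun x => K ^ p * W x) := by
  have hC : 0 ≤ K ^ p := by positivity
  refine ⟨fun x y hxy => mul_le_mul_of_nonneg_left (hf.1 hxy) hC, fun s t hs hst ht => ?_⟩
  calc |g t - g s| ^ p ≤ (K * |f t - f s|) ^ p := Real.rpow_le_rpow (abs_nonneg _)
        (hg s ⟨hs, hst.trans ht⟩ t ⟨hs.trans hst, ht⟩) hp.le
    _ = K ^ p * |f t - f s| ^ p := Real.mul_rpow hK (abs_nonneg _)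
    _ ≤ K ^ p * (W t - W s) := by gcongr; exact hf.2 s t hs hst ht
    _ = _ := by ring

theorem tendsto_abs_rpow {l : Filter ℝ} {u : ℝ → ℝ} {L : ℝ} (hp : 0 < p)
    (h : Tendsto u l (𝓝 L)) : Tendsto (fun x => |u x| ^ p) l (𝓝 (|L| ^ p)) :=
  h.abs.rpow_const (Or.inr hp.le)

/-- Passing to the limit also in `W`, instead of bounding by `W t`, discards the jump of the control
at `t`. This is what makes the increment small as `s` approaches `t`. -/
theorem Ctrl.le_leftLim (hf : Ctrl a b p f W) (hp : 0 < p) (hr : IsRegulated a b f) {s t : ℝ}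
    (hs : a ≤ s) (hst : s < t) (ht : t ≤ b) :
    |leftLim f t - f s| ^ p ≤ leftLim W t - W s := by
  have h1 := hr.tendsto_left ⟨hs.trans_lt hst, ht⟩
  refine le_of_tendsto_of_tendsto (tendsto_abs_rpow hp (h1.sub_const _))
    ((hf.1.tendsto_leftLim t).sub_const _) ?_
  filter_upwards [Ioo_mem_nhdsLT hst] with r hr using hf.2 s r hs hr.1.le (hr.2.le.trans ht)

theorem Ctrl.le_rightLim (hf : Ctrl a b p f W) (hp : 0 < p) (hr : IsRegulated a b f) {s t : ℝ}
    (hs : a ≤ s) (hst : s < t) (ht : t ≤ b) :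
    |f t - rightLim f s| ^ p ≤ W t - rightLim W s := by
  have h1 := hr.tendsto_right ⟨hs, hst.trans_le ht⟩
  refine le_of_tendsto_of_tendsto (tendsto_abs_rpow hp (h1.const_sub _))
    ((hf.1.tendsto_rightLim s).const_sub _) ?_
  filter_upwards [Ioo_mem_nhdsGT hst] with r hr using hf.2 r t (hs.trans hr.1.le) hr.2.le ht

theorem leftMod_of_lt {u x : ℝ} (h : u < x) : leftMod u f x = leftLim f x := if_neg h.ne'

theorem rightMod_of_lt {v x : ℝ} (h : x < v) : rightMod v f x = rightLim f x := if_neg h.ne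

theorem leftMod_self (u : ℝ) (f : ℝ → ℝ) : leftMod u f u = f u := if_pos rfl

theorem rightMod_self (v : ℝ) (f : ℝ → ℝ) : rightMod v f v = f v := if_pos rfl

theorem tendsto_leftMod_left (hf : IsRegulated a b f) {u : ℝ} (hu : a ≤ u) (ht : t ∈ Ioc u b) :
    Tendsto (leftMod u f) (𝓝[<] t) (𝓝 (leftLim f t)) := by
  have h1 := (continuousWithinAt_leftLim_Iic
    (hf.tendsto_left ⟨hu.trans_lt ht.1, ht.2⟩)).tendsto.mono_left
    (nhdsWithin_mono t Iio_subset_Iic_self)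
  refine h1.congr' ?_
  filter_upwards [Ioo_mem_nhdsLT ht.1] with x hx using (leftMod_of_lt hx.1).symm

theorem tendsto_leftMod_right (hf : IsRegulated a b f) {u : ℝ} (hu : a ≤ u) (ht : t ∈ Ico u b) :
    Tendsto (leftMod u f) (𝓝[>] t) (𝓝 (rightLim f t)) := by
  have h0 := hf.tendsto_right ⟨hu.trans ht.1, ht.2⟩
  -- Closed neighbourhoods: if f stays in a closed set just to the right of t, so do its left limits
  -- at points there.
  have h1 : Tendsto (leftLim f) (𝓝[>] t) (𝓝 (rightLim f t)) := by
    apply (closed_nhds_basis (rightLim f t)).tendsto_right_iff.2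
    rintro s ⟨s_mem, s_closed⟩
    obtain ⟨d, hd, h⟩ := mem_nhdsGT_iff_exists_Ioo_subset.1 (h0 s_mem)
    filter_upwards [Ioo_mem_nhdsGT hd, mem_Ioc_of_nhdsGT ht] with x hx hxb
    refine s_closed.mem_of_tendsto
      (hf.tendsto_left ⟨(hu.trans ht.1).trans_lt hx.1, hxb.2.le⟩) ?_
    filter_upwards [Ioo_mem_nhdsLT hx.1] with y hy using h ⟨hy.1, hy.2.trans hx.2⟩
  refine h1.congr' ?_
  filter_upwards [self_mem_nhdsWithin] with x hx
  exact (leftMod_of_lt (ht.1.trans_lt hx)).symm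

theorem tendsto_rightMod_right (hf : IsRegulated a b f) {v : ℝ} (hv : v ≤ b) (ht : t ∈ Ico a v) :
    Tendsto (rightMod v f) (𝓝[>] t) (𝓝 (rightLim f t)) := by
  have h1 := (continuousWithinAt_rightLim_Ici
    (hf.tendsto_right ⟨ht.1, ht.2.trans_le hv⟩)).tendsto.mono_left
    (nhdsWithin_mono t Ioi_subset_Ici_self)
  refine h1.congr' ?_
  filter_upwards [Ioo_mem_nhdsGT ht.2] with x hx using (rightMod_of_lt hx.2).symm

theorem tendsto_rightMod_left (hf : IsRegulated a b f) {v : ℝ} (hv : v ≤ b) (ht : t ∈ Ioc a v) :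
    Tendsto (rightMod v f) (𝓝[<] t) (𝓝 (leftLim f t)) := by
  have h0 := hf.tendsto_left ⟨ht.1, ht.2.trans hv⟩
  have h1 : Tendsto (rightLim f) (𝓝[<] t) (𝓝 (leftLim f t)) := by
    apply (closed_nhds_basis (leftLim f t)).tendsto_right_iff.2
    rintro s ⟨s_mem, s_closed⟩
    obtain ⟨d, hd, h⟩ := mem_nhdsLT_iff_exists_Ioo_subset.1 (h0 s_mem)
    filter_upwards [Ioo_mem_nhdsLT hd, mem_Ico_of_nhdsLT ht] with x hx hxb
    refine s_closed.mem_of_tendsto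
      (hf.tendsto_right ⟨hxb.1.le, hx.2.trans_le (ht.2.trans hv)⟩) ?_
    filter_upwards [Ioo_mem_nhdsGT hx.2] with y hy using h ⟨hx.1.trans hy.1, hy.2⟩
  refine h1.congr' ?_
  filter_upwards [self_mem_nhdsWithin] with x hx
  exact (rightMod_of_lt (lt_of_lt_of_le hx ht.2)).symm

theorem isRegulated_leftMod (hf : IsRegulated a b f) {u v : ℝ} (hu : a ≤ u) (hv : v ≤ b) :
    IsRegulated u v (leftMod u f) :=
  ⟨fun _ ht => ⟨_, tendsto_leftMod_left hf hu ⟨ht.1, ht.2.trans hv⟩⟩,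
    fun _ ht => ⟨_, tendsto_leftMod_right hf hu ⟨ht.1, ht.2.trans_le hv⟩⟩⟩

theorem isRegulated_rightMod (hf : IsRegulated a b f) {u v : ℝ} (hu : a ≤ u) (hv : v ≤ b) :
    IsRegulated u v (rightMod v f) :=
  ⟨fun _ ht => ⟨_, tendsto_rightMod_left hf hv ⟨hu.trans_lt ht.1, ht.2⟩⟩,
    fun _ ht => ⟨_, tendsto_rightMod_right hf hv ⟨hu.trans ht.1, ht.2⟩⟩⟩

theorem monotone_leftMod (hW : Monotone W) (u : ℝ) : Monotone (leftMod u W) := by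
  intro x y hxy
  unfold leftMod
  split_ifs with h1 h2 h2
  · exact le_rfl
  · subst h1; exact hW.le_leftLim (lt_of_le_of_ne hxy (Ne.symm h2))
  · subst h2; exact hW.leftLim_le hxy
  · exact hW.leftLim hxy

theorem monotone_rightMod (hW : Monotone W) (v : ℝ) : Monotone (rightMod v W) := by
  intro x y hxy
  unfold rightMod
  split_ifs with h1 h2 h2
  · exact le_rfl
  · subst h1; exact hW.le_rightLim hxy
  · subst h2; exact hW.rightLim_le (lt_of_le_of_ne hxy h1)
  · exact hW.rightLim hxy

/-- The same modification applied to the control works, as the defining inequality passes to left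
limits at both ends. -/
theorem Ctrl.leftMod (hf : Ctrl a b p f W) (hp : 0 < p) (hr : IsRegulated a b f) {u v : ℝ}
    (hu : a ≤ u) (hv : v ≤ b) : Ctrl u v p (leftMod u f) (leftMod u W) := by
  refine ⟨monotone_leftMod hf.1 u, fun s t hs hst ht => ?_⟩
  rcases hs.eq_or_lt with rfl | hs
  · rcases hst.eq_or_lt with rfl | hst
    · simp [Real.zero_rpow hp.ne']
    · rw [leftMod_of_lt hst, leftMod_of_lt hst, leftMod_self, leftMod_self]
      exact hf.le_leftLim hp hr hu hst (ht.trans hv)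
  · rcases hst.eq_or_lt with rfl | hst
    · simp [Real.zero_rpow hp.ne']
    rw [leftMod_of_lt hs, leftMod_of_lt hs, leftMod_of_lt (hs.trans hst),
      leftMod_of_lt (hs.trans hst)]
    have h1 := hr.tendsto_left (t := s) ⟨hu.trans_lt hs, hst.le.trans (ht.trans hv)⟩
    refine le_of_tendsto_of_tendsto (tendsto_abs_rpow hp (h1.const_sub _))
      ((hf.1.tendsto_leftLim s).const_sub _) ?_
    filter_upwards [Ioo_mem_nhdsLT hs] with r hr'
    exact hf.le_leftLim hp hr (hu.trans hr'.1.le) (hr'.2.trans hst) (ht.trans hv)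

theorem Ctrl.rightMod (hf : Ctrl a b p f W) (hp : 0 < p) (hr : IsRegulated a b f) {u v : ℝ}
    (hu : a ≤ u) (hv : v ≤ b) : Ctrl u v p (rightMod v f) (rightMod v W) := by
  refine ⟨monotone_rightMod hf.1 v, fun s t hs hst ht => ?_⟩
  rcases ht.eq_or_lt with rfl | ht
  · rcases hst.eq_or_lt with rfl | hst
    · simp [Real.zero_rpow hp.ne']
    · rw [rightMod_of_lt hst, rightMod_of_lt hst, rightMod_self, rightMod_self]
      exact hf.le_rightLim hp hr (hu.trans hs) hst hv
  · rcases hst.eq_or_lt with rfl | hst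
    · simp [Real.zero_rpow hp.ne']
    rw [rightMod_of_lt ht, rightMod_of_lt ht, rightMod_of_lt (hst.trans ht),
      rightMod_of_lt (hst.trans ht)]
    have h1 := hr.tendsto_right (t := t) ⟨hu.trans (hs.trans hst.le), ht.trans_le hv⟩
    refine le_of_tendsto_of_tendsto (tendsto_abs_rpow hp (h1.sub_const _))
      ((hf.1.tendsto_rightLim t).sub_const _) ?_
    filter_upwards [Ioo_mem_nhdsGT ht] with r hr'
    exact hf.le_rightLim hp hr (hu.trans hs) (hst.trans hr'.1) (hr'.2.le.trans hv)

/-- A pair to which Young's integration theory applies: `h` has bounded variation, or `F` and `h`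
have bounded `q`- and `p`-variation with `1/p + 1/q > 1`. The function `W` controls both. -/
def IsYoung (a b : ℝ) (F h W : ℝ → ℝ) : Prop :=
  IsRegulated a b F ∧ IsRegulated a b h ∧ (Ctrl a b 1 h W ∨
    ∃ p q WF Wh, 1 ≤ p ∧ 0 < q ∧ 1 < 1 / p + 1 / q ∧ Ctrl a b q F WF ∧ Ctrl a b p h Wh ∧
      W = fun x => WF x + Wh x)

theorem IsYoung.monotone (H : IsYoung a b F h W) : Monotone W := by
  obtain ⟨-, -, H | ⟨p, q, WF, Wh, -, -, -, hF, hh, rfl⟩⟩ := H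
  · exact H.1
  · exact hF.1.add hh.1

end Control

/-! ### One-sided local estimates for Young sums -/

section Young

variable {a b p q t : ℝ} {F h W : ℝ → ℝ}

/-- Placing the constant `c` at index `n`, after the last tag, makes it the value at which
`youngSum` is recentred. -/
theorem youngSum_eq_of_tags (F h : ℝ → ℝ) (c : ℝ) (n : ℕ) (x y : ℕ → ℝ) :
    youngSum (fun i => if i < n then F (y i) else c) (fun i => h (x i)) 0 n =
      ∑ i ∈ Finset.range n, (F (y i) - c) * (h (x (i + 1)) - h (x i)) := by
  unfold youngSum
  rw [← Finset.range_eq_Ico]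
  refine Finset.sum_congr rfl fun i hi => ?_
  simp [Finset.mem_range.1 hi]

theorem abs_sum_tags_le_of_bddVar (hh : Ctrl a b 1 h W) {ε c s t : ℝ} {n : ℕ} {x y : ℕ → ℝ}
    (hε : 0 ≤ ε) (hs : a ≤ s) (ht : t ≤ b)
    (hx : MonotoneOn x (Iic n)) (hx' : ∀ i ≤ n, x i ∈ Icc s t)
    (hy : ∀ i < n, |F (y i) - c| ≤ ε) :
    |∑ i ∈ Finset.range n, (F (y i) - c) * (h (x (i + 1)) - h (x i))| ≤ ε * (W t - W s) := by
  calc |∑ i ∈ Finset.range n, (F (y i) - c) * (h (x (i + 1)) - h (x i))|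
      ≤ ∑ i ∈ Finset.range n, |(F (y i) - c) * (h (x (i + 1)) - h (x i))| :=
        Finset.abs_sum_le_sum_abs _ _
    _ ≤ ∑ i ∈ Finset.range n, ε * (W (x (i + 1)) - W (x i)) := by
        refine Finset.sum_le_sum fun i hi => ?_
        have hi := Finset.mem_range.1 hi
        rw [abs_mul]
        have := hh.2 (x i) (x (i + 1)) (hs.trans (hx' i hi.le).1)
          (hx hi.le (show i + 1 ≤ n from hi) (by omega)) ((hx' (i + 1) hi).2.trans ht)
        rw [Real.rpow_one] at this
        exact mul_le_mul (hy i hi) this (abs_nonneg _) hε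
    _ = ε * (W (x n) - W (x 0)) := by
        rw [← Finset.mul_sum, Finset.sum_range_sub (fun i => W (x i))]
    _ ≤ ε * (W t - W s) := by
        have := hh.1 (hx' n le_rfl).2
        have := hh.1 (hx' 0 (Nat.zero_le _)).1
        gcongr

theorem eventually_rpow_lt {l : Filter ℝ} {u : ℝ → ℝ} {θ K ε : ℝ} (hθ : 0 < θ) (hε : 0 < ε)
    (h : Tendsto u l (𝓝 0)) : ∀ᶠ s in l, K * u s ^ θ ≤ ε := by
  have : Tendsto (fun s => K * u s ^ θ) l (𝓝 (K * 0 ^ θ)) :=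
    (h.rpow_const (Or.inr hθ.le)).const_mul K
  rw [Real.zero_rpow hθ.ne', mul_zero] at this
  exact this.eventually (Iic_mem_nhds hε)

/-- The tags avoid `t`, so only values of F near its left limit occur, and F may be frozen at that
limit. The points `x i` may reach `t`: a jump of h there is harmless, being multiplied by a small
oscillation of F. -/
theorem IsYoung.left (H : IsYoung a b F h W) (ht : t ∈ Ioc a b) {ε : ℝ} (hε : 0 < ε) :
    ∀ᶠ s in 𝓝[<] t, ∀ (n : ℕ) (x y : ℕ → ℝ), MonotoneOn x (Iic n) → MonotoneOn y (Iio n) →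
      (∀ i ≤ n, x i ∈ Icc s t) → (∀ i < n, y i ∈ Ico s t) →
      |∑ i ∈ Finset.range n, (F (y i) - leftLim F t) * (h (x (i + 1)) - h (x i))| ≤
        ε * (W t - W s) := by
  obtain ⟨hF, hh, H | ⟨p, q, WF, Wh, hp, hq, hpq, HF, Hh, rfl⟩⟩ := H
  · have h1 := (hF.tendsto_left ht).eventually (Metric.closedBall_mem_nhds _ hε)
    filter_upwards [eventually_Ico_of_nhdsLT h1, mem_Ico_of_nhdsLT ht]
      with s hs hst n x y hx _ hx' hy
    exact abs_sum_tags_le_of_bddVar H hε.le hst.1.le ht.2 hx hx' fun i hi => hs _ (hy i hi)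
  · obtain ⟨K, hK0, hK⟩ := exists_abs_youngSum_le hp hq hpq
    have h1 : Tendsto (fun s => leftLim WF t - WF s) (𝓝[<] t) (𝓝 0) := by
      simpa using (HF.1.tendsto_leftLim t).const_sub (leftLim WF t)
    filter_upwards [eventually_rpow_lt (K := K) (sub_pos.2 hpq) hε h1, mem_Ico_of_nhdsLT ht]
      with s hs hst n x y hx hy hx' hy'
    rw [← youngSum_eq_of_tags]
    -- The left limits of F and of its control are appended as a final tag. The increment of this
    -- control then tends to 0, whereas that of the control of h need not.
    have key := hK n (fun i => if i < n then F (y i) else leftLim F t) (fun i => h (x i))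
      (fun i => if i < n then WF (y i) else leftLim WF t) (fun i => Wh (x i))
      (leftLim WF t - WF s) (Wh t - Wh s) ?_ ?_ ?_ ?_
    · refine key.trans ?_
      have h2 := HF.1.leftLim_le (le_refl t)
      have h3 := HF.1.le_leftLim hst.2
      have h4 := Hh.1 hst.2.le
      rw [← mul_assoc]
      refine mul_le_mul hs ?_ ?_ hε.le
      · linarith
      · linarith
    · intro i j hij hj
      rcases hj.lt_or_eq with hj | rfl
      · simp only [hj, hij.trans_lt hj, if_true]
        exact HF.2 _ _ (hst.1.le.trans (hy' i (hij.trans_lt hj)).1) (hy (hij.trans_lt hj) hj hij)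
          ((hy' j hj).2.le.trans ht.2)
      · rcases hij.lt_or_eq with hi | rfl
        · simp only [hi, if_true, lt_irrefl, if_false]
          exact HF.le_leftLim hq hF (hst.1.le.trans (hy' i hi).1) (hy' i hi).2 ht.2
        · simp [Real.zero_rpow hq.ne']
    · intro i j hij hj
      exact Hh.2 _ _ (hst.1.le.trans (hx' i (hij.trans hj)).1) (hx (hij.trans hj) hj hij)
        ((hx' j hj).2.trans ht.2)
    · simp only [lt_irrefl, if_false]
      split_ifs with h0
      · have := HF.1 (hy' 0 h0).1; linarith
      · have := HF.1.le_leftLim hst.2; linarith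
    · have := Hh.1 (hx' n le_rfl).2
      have := Hh.1 (hx' 0 (Nat.zero_le _)).1
      linarith

theorem IsYoung.right (H : IsYoung a b F h W) (ht : t ∈ Ico a b) {ε : ℝ} (hε : 0 < ε) :
    ∀ᶠ s in 𝓝[>] t, ∀ (n : ℕ) (x y : ℕ → ℝ), MonotoneOn x (Iic n) → MonotoneOn y (Iio n) →
      (∀ i ≤ n, x i ∈ Icc t s) → (∀ i < n, y i ∈ Ioc t s) →
      |∑ i ∈ Finset.range n, (F (y i) - rightLim F t) * (h (x (i + 1)) - h (x i))| ≤
        ε * (W s - W t) := by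
  obtain ⟨hF, hh, H | ⟨p, q, WF, Wh, hp, hq, hpq, HF, Hh, rfl⟩⟩ := H
  · have h1 := (hF.tendsto_right ht).eventually (Metric.closedBall_mem_nhds _ hε)
    filter_upwards [eventually_Ioc_of_nhdsGT h1, mem_Ioc_of_nhdsGT ht]
      with s hs hst n x y hx _ hx' hy
    exact abs_sum_tags_le_of_bddVar H hε.le ht.1 hst.2.le hx hx' fun i hi => hs _ (hy i hi)
  · obtain ⟨K, hK0, hK⟩ := exists_abs_youngSum_le hp hq hpq
    have h1 : Tendsto (fun s => WF s - rightLim WF t) (𝓝[>] t) (𝓝 0) := by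
      simpa using (HF.1.tendsto_rightLim t).sub_const (rightLim WF t)
    -- The constant is `K + 1` because `youngSum` is recentred at the last tag, while here the limit
    -- sits at the first end. Moving the centre from `F s` to the right limit costs one more
    -- product, bounded by `rpow_mul_rpow_le`.
    filter_upwards [eventually_rpow_lt (K := K + 1) (sub_pos.2 hpq) hε h1, mem_Ioc_of_nhdsGT ht]
      with s hs hst n x y hx hy hx' hy'
    have split : ∑ i ∈ Finset.range n, (F (y i) - rightLim F t) * (h (x (i + 1)) - h (x i)) =
        youngSum (fun i => if i < n then F (y i) else F s) (fun i => h (x i)) 0 n +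
          (F s - rightLim F t) * (h (x n) - h (x 0)) := by
      rw [youngSum_eq_of_tags, ← Finset.sum_range_sub (fun i => h (x i)), Finset.mul_sum,
        ← Finset.sum_add_distrib]
      exact Finset.sum_congr rfl fun i _ => by ring
    have key := hK n (fun i => if i < n then F (y i) else F s) (fun i => h (x i))
      (fun i => if i < n then WF (y i) else WF s) (fun i => Wh (x i))
      (WF s - rightLim WF t) (Wh s - Wh t) ?_ ?_ ?_ ?_
    · have h2 := HF.1.le_rightLim (le_refl t)
      have h3 := HF.1.rightLim_le hst.1
      have h4 := Hh.1 hst.1.le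
      have h5 : |F s - rightLim F t| ≤ (WF s - rightLim WF t) ^ (1 / q) :=
        le_rpow_inv hq (abs_nonneg _) (HF.le_rightLim hq hF ht.1 hst.1 hst.2.le)
      have h6 : |h (x n) - h (x 0)| ≤ (Wh s - Wh t) ^ (1 / p) := by
        refine le_rpow_inv (by linarith) (abs_nonneg _) ((Hh.2 _ _ ?_ ?_ ?_).trans ?_)
        · exact ht.1.trans (hx' 0 (Nat.zero_le _)).1
        · exact hx (Nat.zero_le n) (le_refl n) (Nat.zero_le n)
        · exact (hx' n le_rfl).2.trans hst.2.le
        · have := Hh.1 (hx' n le_rfl).2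
          have := Hh.1 (hx' 0 (Nat.zero_le _)).1
          linarith
      have h7 : |(F s - rightLim F t) * (h (x n) - h (x 0))| ≤
          (WF s - rightLim WF t) ^ (1 / p + 1 / q - 1) *
            ((WF s - rightLim WF t) + (Wh s - Wh t)) := by
        rw [abs_mul]
        exact (mul_le_mul h5 h6 (abs_nonneg _) (Real.rpow_nonneg (by linarith) _)).trans
          (rpow_mul_rpow_le hp hq (by linarith) (by linarith))
      rw [split]
      refine (abs_add_le _ _).trans ((add_le_add key h7).trans ?_)
      rw [← add_one_mul K, ← mul_assoc]
      refine mul_le_mul hs ?_ ?_ hε.le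
      · linarith
      · linarith
    · intro i j hij hj
      rcases hj.lt_or_eq with hj | rfl
      · simp only [hj, hij.trans_lt hj, if_true]
        exact HF.2 _ _ (ht.1.trans (hy' i (hij.trans_lt hj)).1.le) (hy (hij.trans_lt hj) hj hij)
          ((hy' j hj).2.trans hst.2.le)
      · rcases hij.lt_or_eq with hi | rfl
        · simp only [hi, if_true, lt_irrefl, if_false]
          exact HF.2 _ _ (ht.1.trans (hy' i hi).1.le) (hy' i hi).2 hst.2.le
        · simp [Real.zero_rpow hq.ne']
    · intro i j hij hj
      exact Hh.2 _ _ (ht.1.trans (hx' i (hij.trans hj)).1) (hx (hij.trans hj) hj hij)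
        ((hx' j hj).2.trans hst.2.le)
    · simp only [lt_irrefl, if_false]
      split_ifs with h0
      · have := HF.1.rightLim_le (hy' 0 h0).1; linarith
      · have := HF.1.rightLim_le hst.1; linarith
    · have := Hh.1 (hx' n le_rfl).2
      have := Hh.1 (hx' 0 (Nat.zero_le _)).1
      linarith

end Young

/-! ### Interval sums over partitions clamped to a subinterval -/

theorem exists_cut (p : ℕ → Prop) (n : ℕ) (h : ∀ i j, i ≤ j → j < n → p j → p i) :
    ∃ j ≤ n, (∀ i < j, p i) ∧ ∀ i, j ≤ i → i < n → ¬ p i := by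
  induction n with
  | zero => exact ⟨0, le_rfl, by simp, by simp⟩
  | succ n ih =>
    obtain ⟨j, hj, h1, h2⟩ := ih fun i j hij hj => h i j hij (by omega)
    by_cases hp : p n
    · refine ⟨n + 1, le_rfl, fun i hi => h i n (by omega) (by omega) hp, fun i _ _ => by omega⟩
    · refine ⟨j, by omega, h1, fun i hi hin => ?_⟩
      rcases (Nat.lt_succ_iff.1 hin).lt_or_eq with hin | rfl
      · exact h2 i hi hin
      · exact hp

section Clamp

variable {s t v x y : ℝ}

theorem clamp_lower (htv : t ≤ v) (hx : x ≤ t) :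
    clamp s v x = clamp s t x ∧ clamp t v x = t := by
  unfold clamp
  rw [min_eq_right (hx.trans htv), min_eq_right hx, max_eq_left hx]
  exact ⟨rfl, rfl⟩

theorem clamp_upper (hst : s ≤ t) (htv : t ≤ v) (hx : t ≤ x) :
    clamp s v x = clamp t v x ∧ clamp s t x = t := by
  unfold clamp
  rw [min_eq_left hx, max_eq_right hst, max_eq_right (le_min htv hx),
    max_eq_right (hst.trans (le_min htv hx))]
  exact ⟨rfl, rfl⟩

theorem clamp_of_le (hx : x ≤ s) : clamp s t x = s := max_eq_left ((min_le_right _ _).trans hx)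

theorem clamp_of_ge (hst : s ≤ t) (hx : t ≤ x) : clamp s t x = t := by
  rw [clamp, min_eq_left hx, max_eq_right hst]

theorem le_clamp_of_le (hyt : y ≤ t) (h : y ≤ x) : y ≤ clamp s t x :=
  le_max_of_le_right (le_min hyt h)

theorem clamp_le_of_le (hsy : s ≤ y) (h : x ≤ y) : clamp s t x ≤ y :=
  max_le hsy ((min_le_right _ _).trans h)

end Clamp

section Straddle

variable {n : ℕ} {x : ℕ → ℝ} {t : ℝ}

/-- A sum over the intervals of a chain whose terms vanish for all intervals that do not contain
`t` in their interior has at most one nonzero term. -/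
theorem sum_eq_zero_or_straddle (hx : MonotoneOn x (Iic n)) {D : ℕ → ℝ}
    (hD : ∀ i < n, x (i + 1) ≤ t ∨ t ≤ x i → D i = 0) :
    ∑ i ∈ Finset.range n, D i = 0 ∨
      ∃ i < n, x i < t ∧ t < x (i + 1) ∧ ∑ i ∈ Finset.range n, D i = D i := by
  by_cases h : ∃ i < n, x i < t ∧ t < x (i + 1)
  · obtain ⟨i, hi, h1, h2⟩ := h
    refine Or.inr ⟨i, hi, h1, h2, Finset.sum_eq_single_of_mem i (Finset.mem_range.2 hi) ?_⟩
    intro j hj hji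
    have hj := Finset.mem_range.1 hj
    refine hD j hj ?_
    rcases lt_or_gt_of_ne hji with hji | hji
    · exact Or.inl ((hx (show j + 1 ≤ n by omega) (show i ≤ n by omega) (by omega)).trans h1.le)
    · exact Or.inr (h2.le.trans (hx (show i + 1 ≤ n by omega) (show j ≤ n by omega) (by omega)))
  · push Not at h
    refine Or.inl (Finset.sum_eq_zero fun i hi => hD i (Finset.mem_range.1 hi) ?_)
    by_cases h1 : x i < t
    · exact Or.inl (h i (Finset.mem_range.1 hi) h1)
    · exact Or.inr (not_lt.1 h1)

theorem not_straddle (hx : MonotoneOn x (Iic n)) {i k : ℕ} (hi : i < n) (hk : k ≤ n) :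
    ¬ (x i < x k ∧ x k < x (i + 1)) := by
  rintro ⟨h1, h2⟩
  rcases le_or_gt k i with h | h
  · exact absurd (hx hk (show i ≤ n by omega) h) (not_le.2 h1)
  · exact absurd (hx (show i + 1 ≤ n by omega) hk (by omega)) (not_le.2 h2)

end Straddle

section IntervalSum

variable {a b : ℝ} {lam : ℕ → Part a b} {t : ℝ}

/-- The sum of an interval function over the partition of `[s, t]` induced by `κ`. -/
def intervalSum {a b : ℝ} (Ψ : ℝ → ℝ → ℝ) (κ : Part a b) (s t : ℝ) : ℝ :=
  ∑ i ∈ Finset.range κ.n, Ψ (clamp s t (κ.x i)) (clamp s t (κ.x (i + 1)))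

theorem IsDenseNested.pts_mono (hlam : IsDenseNested lam) : Monotone fun m => (lam m).pts :=
  monotone_nat_of_le_succ hlam.nested

theorem IsDenseNested.eventually_mem (hlam : IsDenseNested lam) (ht : t ∈ ⋃ m, (lam m).pts) :
    ∀ᶠ m in atTop, t ∈ (lam m).pts := by
  obtain ⟨m, hm⟩ := mem_iUnion.1 ht
  filter_upwards [eventually_ge_atTop m] with k hk using hlam.pts_mono hk hm

theorem IsDenseNested.eventually_meets (hlam : IsDenseNested lam) {c d : ℝ} (hc : a ≤ c)
    (hcd : c < d) (hd : d ≤ b) : ∀ᶠ m in atTop, ∃ k ≤ (lam m).n, (lam m).x k ∈ Ioo c d := by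
  have h1 : (c + d) / 2 ∈ closure (⋃ m, (lam m).pts) :=
    hlam.dense ⟨by linarith, by linarith⟩
  obtain ⟨z, hz, hz'⟩ := mem_closure_iff.1 h1 (Ioo c d) isOpen_Ioo
    ⟨by linarith, by linarith⟩
  filter_upwards [hlam.eventually_mem hz'] with m hm
  obtain ⟨k, hk, rfl⟩ := hm
  exact ⟨k, hk, hz⟩

theorem Part.monotoneOn {a b : ℝ} (κ : Part a b) : MonotoneOn κ.x (Iic κ.n) :=
  κ.strictMono.monotoneOn

theorem clamp_monotoneOn {x : ℕ → ℝ} {n : ℕ} (hx : MonotoneOn x (Iic n)) (s t : ℝ) :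
    MonotoneOn (fun i => clamp s t (x i)) (Iic n) :=
  (clamp_mono s t).comp_monotoneOn hx

/-- Splitting at `t` alters only the partition interval having `t` in its interior. If `t` is
accessible, nestedness eventually makes it a partition point and the defect is zero. Otherwise
density squeezes both ends of that interval towards `t`, and the defect is governed by the local
condition on `Ψ`. -/
theorem asympAdditive_intervalSum (hlam : IsDenseNested lam) {Ψ : ℝ → ℝ → ℝ}
    (h0 : ∀ x, Ψ x x = 0)
    (hΨ : ∀ t ∈ Ioo a b, t ∉ ⋃ m, (lam m).pts →
      Tendsto (fun q : ℝ × ℝ => Ψ q.1 q.2 - Ψ q.1 t - Ψ t q.2) (𝓝[<] t ×ˢ 𝓝[>] t) (𝓝 0)) :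
    AsympAdditive atTop (fun m => intervalSum Ψ (lam m)) a b := by
  intro u t v hu hut htv hv
  have hsum : ∀ m, intervalSum Ψ (lam m) u v - intervalSum Ψ (lam m) u t -
      intervalSum Ψ (lam m) t v = ∑ i ∈ Finset.range (lam m).n,
        (Ψ (clamp u v ((lam m).x i)) (clamp u v ((lam m).x (i + 1))) -
          Ψ (clamp u t ((lam m).x i)) (clamp u t ((lam m).x (i + 1))) -
          Ψ (clamp t v ((lam m).x i)) (clamp t v ((lam m).x (i + 1)))) := fun m => by
    simp only [intervalSum, Finset.sum_sub_distrib]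
  have hD : ∀ m, ∀ i < (lam m).n, (lam m).x (i + 1) ≤ t ∨ t ≤ (lam m).x i →
        Ψ (clamp u v ((lam m).x i)) (clamp u v ((lam m).x (i + 1))) -
          Ψ (clamp u t ((lam m).x i)) (clamp u t ((lam m).x (i + 1))) -
          Ψ (clamp t v ((lam m).x i)) (clamp t v ((lam m).x (i + 1))) = 0 := by
    intro m i hi h
    have hmono : (lam m).x i ≤ (lam m).x (i + 1) :=
      (lam m).monotoneOn (show i ≤ (lam m).n by omega) (show i + 1 ≤ (lam m).n by omega)
        (Nat.le_succ i)
    rcases h with h | h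
    · obtain ⟨e1, e2⟩ := clamp_lower htv.le h
      obtain ⟨e3, e4⟩ := clamp_lower htv.le (hmono.trans h)
      rw [e1, e2, e3, e4, h0]; ring
    · obtain ⟨e1, e2⟩ := clamp_upper hut.le htv.le h
      obtain ⟨e3, e4⟩ := clamp_upper hut.le htv.le (h.trans hmono)
      rw [e1, e2, e3, e4, h0]; ring
  by_cases hacc : t ∈ ⋃ m, (lam m).pts
  · refine tendsto_const_nhds.congr' ?_
    filter_upwards [hlam.eventually_mem hacc] with m hm
    rw [hsum]
    rcases sum_eq_zero_or_straddle (lam m).monotoneOn (hD m) with h | ⟨i, hi, h1, h2, -⟩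
    · exact h.symm
    · obtain ⟨k, hk, rfl⟩ := hm
      exact absurd ⟨h1, h2⟩ (not_straddle (lam m).monotoneOn hi hk)
  · rw [Metric.tendsto_nhds]
    intro ε hε
    have h1 := Metric.tendsto_nhds.1 (hΨ t ⟨hu.trans_lt hut, htv.trans_le hv⟩ hacc) ε hε
    obtain ⟨p, hp, q, hq, hpq⟩ := eventually_prod_iff.1 h1
    obtain ⟨c, hc, hp⟩ := mem_nhdsLT_iff_exists_Ioo_subset.1 hp
    obtain ⟨d, hd, hq⟩ := mem_nhdsGT_iff_exists_Ioo_subset.1 hq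
    -- A partition point in each of two short intervals on either side of `t` traps the interval
    -- containing `t` between `c` and `d`.
    filter_upwards [hlam.eventually_meets (le_max_right c a) (max_lt hc (hu.trans_lt hut))
        (htv.le.trans hv),
      hlam.eventually_meets (hu.trans hut.le) (lt_min hd (htv.trans_le hv)) (min_le_right d b)]
      with m hm hm'
    rw [hsum]
    rcases sum_eq_zero_or_straddle (lam m).monotoneOn (hD m) with h | ⟨i, hi, h1, h2, h⟩
    · rw [h]; simpa using hε
    · obtain ⟨k, hk, hk'⟩ := hm
      obtain ⟨l, hl, hl'⟩ := hm'
      have g1 : c < (lam m).x i := by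
        have : k ≤ i := by
          by_contra hki
          have := (lam m).monotoneOn (show i + 1 ≤ (lam m).n by omega) hk (by omega)
          linarith [hk'.2]
        exact ((le_max_left _ _).trans_lt hk'.1).trans_le
          ((lam m).monotoneOn hk (show i ≤ (lam m).n by omega) this)
      have g2 : (lam m).x (i + 1) < d := by
        have : i + 1 ≤ l := by
          by_contra hki
          have := (lam m).monotoneOn hl (show i ≤ (lam m).n by omega) (by omega)
          linarith [hl'.1]
        exact ((lam m).monotoneOn (show i + 1 ≤ (lam m).n by omega) hl this).trans_lt
          (hl'.2.trans_le (min_le_left _ _))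
      obtain ⟨e1, e2⟩ := clamp_lower htv.le h1.le
      obtain ⟨e3, e4⟩ := clamp_upper hut.le htv.le h2.le
      rw [h, e1, e2, e3, e4]
      refine hpq (hp ⟨?_, ?_⟩) (hq ⟨?_, ?_⟩)
      · exact g1.trans_le (le_clamp_of_le h1.le le_rfl)
      · exact max_lt hut ((min_le_right _ _).trans_lt h1)
      · exact lt_max_of_lt_right (lt_min htv h2)
      · exact (clamp_le_of_le h2.le le_rfl).trans_lt g2

/-- Separates the one term that sees a jump at `t` from a chain staying strictly to its left. One
partition serves all `Ψ`, so sums of different interval functions can be compared term by term. -/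
theorem intervalSum_left_split (hlam : IsDenseNested lam) {s t : ℝ} (hs : a ≤ s) (hst : s < t)
    (ht : t ≤ b) {p : ℝ → Prop} (hp : ∀ᶠ r in 𝓝[<] t, p r) :
    ∀ᶠ m in atTop, ∃ (k : ℕ) (w : ℕ → ℝ), MonotoneOn w (Iic k) ∧ (∀ i ≤ k, w i ∈ Ico s t) ∧
      p (w k) ∧ ∀ Ψ : ℝ → ℝ → ℝ, Ψ t t = 0 → intervalSum Ψ (lam m) s t =
        ∑ i ∈ Finset.range k, Ψ (w i) (w (i + 1)) + Ψ (w k) t := by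
  obtain ⟨c, hc, hp⟩ := mem_nhdsLT_iff_exists_Ioo_subset.1 hp
  filter_upwards [hlam.eventually_meets (hs.trans (le_max_right c s)) (max_lt hc hst) ht] with m hm
  obtain ⟨l, hl, hl'⟩ := hm
  set z : ℕ → ℝ := fun i => clamp s t ((lam m).x i) with hz
  have hzm : MonotoneOn z (Iic (lam m).n) := clamp_monotoneOn (lam m).monotoneOn s t
  -- The bound is the number of points, one more than the number of intervals; `j` is the first
  -- index clamped to `t`, and later intervals are degenerate.
  obtain ⟨j, hj, h1, h2⟩ := exists_cut (fun i => z i < t) ((lam m).n + 1)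
    fun i j hij hj h => (hzm (show i ≤ _ by omega) (show j ≤ _ by omega) hij).trans_lt h
  have hzl : z l < t := max_lt hst ((min_le_right _ _).trans_lt hl'.2)
  have hlj : l < j := by
    by_contra hlj
    exact h2 l (not_lt.1 hlj) (by omega) hzl
  have hn : z (lam m).n = t := clamp_of_ge hst.le (ht.trans (lam m).right.ge)
  have hjn : j ≤ (lam m).n := by
    by_contra hjn
    exact absurd hn (h1 _ (by omega)).ne
  have hzt : ∀ i, j ≤ i → i ≤ (lam m).n → z i = t := fun i hi hin =>
    le_antisymm (clamp_mem hst.le _).2 (not_lt.1 (h2 i hi (by omega)))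
  refine ⟨j - 1, z, hzm.mono fun i (hi : i ≤ _) => show i ≤ _ by omega, fun i hi =>
    ⟨(clamp_mem hst.le _).1, h1 i (by omega)⟩, hp ⟨?_, h1 _ (by omega)⟩, fun Ψ hΨ => ?_⟩
  · refine lt_of_lt_of_le ?_ (hzm hl (show j - 1 ≤ _ by omega) (by omega))
    exact ((le_max_left c s).trans_lt hl'.1).trans_le (le_clamp_of_le hl'.2.le le_rfl)
  · unfold intervalSum
    obtain ⟨k, rfl⟩ : ∃ k, j = k + 1 := ⟨j - 1, by omega⟩
    obtain ⟨d, hd⟩ := Nat.exists_eq_add_of_le hjn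
    rw [hd, Finset.sum_range_add, Finset.sum_range_succ, add_assoc]
    congr 1
    rw [Finset.sum_eq_zero, add_zero]
    · change Ψ (z k) (z (k + 1)) = _
      rw [hzt (k + 1) le_rfl hjn]; rfl
    · intro i hi
      have := Finset.mem_range.1 hi
      change Ψ (z (k + 1 + i)) (z (k + 1 + i + 1)) = 0
      rw [hzt _ (by omega) (by omega), hzt _ (by omega) (by omega), hΨ]

theorem intervalSum_right_split (hlam : IsDenseNested lam) {s t : ℝ} (ht : a ≤ t) (hst : t < s)
    (hs : s ≤ b) {p : ℝ → Prop} (hp : ∀ᶠ r in 𝓝[>] t, p r) :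
    ∀ᶠ m in atTop, ∃ (k : ℕ) (w : ℕ → ℝ), MonotoneOn w (Iic k) ∧ (∀ i ≤ k, w i ∈ Ioc t s) ∧
      p (w 0) ∧ ∀ Ψ : ℝ → ℝ → ℝ, Ψ t t = 0 → intervalSum Ψ (lam m) t s =
        Ψ t (w 0) + ∑ i ∈ Finset.range k, Ψ (w i) (w (i + 1)) := by
  obtain ⟨c, hc, hp⟩ := mem_nhdsGT_iff_exists_Ioo_subset.1 hp
  filter_upwards [hlam.eventually_meets ht (lt_min hc hst) ((min_le_right c s).trans hs)] with m hm
  obtain ⟨l, hl, hl'⟩ := hm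
  set z : ℕ → ℝ := fun i => clamp t s ((lam m).x i) with hz
  have hzm : MonotoneOn z (Iic (lam m).n) := clamp_monotoneOn (lam m).monotoneOn t s
  have hz0 : z 0 = t := clamp_of_le ((lam m).left.le.trans ht)
  have hzt : ∀ i, z i ≤ t → z i = t := fun i h => le_antisymm h (clamp_mem hst.le _).1
  obtain ⟨j, hj, h1, h2⟩ := exists_cut (fun i => z i ≤ t) ((lam m).n + 1)
    fun i j hij hj h => (hzm (show i ≤ _ by omega) (show j ≤ _ by omega) hij).trans h
  have hzl : t < z l := hl'.1.trans_le (le_clamp_of_le (hl'.2.le.trans (min_le_right _ _)) le_rfl)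
  have hjl : j ≤ l := by
    by_contra hlj
    exact absurd (h1 l (by omega)) (not_le.2 hzl)
  have hj0 : 0 < j := by
    by_contra hj0
    exact h2 0 (by omega) (by omega) hz0.le
  refine ⟨(lam m).n - j, fun i => z (j + i), fun i hi i' hi' hii => ?_, fun i hi =>
    ⟨not_le.1 (h2 _ (by omega) (by omega)), (clamp_mem hst.le _).2⟩,
    hp ⟨not_le.1 (h2 _ (by omega) (by omega)), ?_⟩, fun Ψ hΨ => ?_⟩
  · simp only [mem_Iic] at hi hi'
    exact hzm (show j + i ≤ _ by omega) (show j + i' ≤ _ by omega) (by omega)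
  · refine lt_of_le_of_lt (hzm (show j + 0 ≤ _ by omega) hl (by omega)) ?_
    exact (clamp_le_of_le hl'.1.le le_rfl).trans_lt (hl'.2.trans_le (min_le_left _ _))
  · unfold intervalSum
    obtain ⟨k, rfl⟩ : ∃ k, j = k + 1 := ⟨j - 1, by omega⟩
    obtain ⟨d, hd⟩ := Nat.exists_eq_add_of_le (hjl.trans hl)
    have hd' : (lam m).n - (k + 1) = d := by omega
    rw [hd', hd, Finset.sum_range_add, Finset.sum_range_succ]
    congr 1
    rw [Finset.sum_eq_zero, zero_add]
    · change Ψ (z k) (z (k + 1)) = _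
      rw [hzt k (h1 k (by omega))]
    · intro i hi
      have := Finset.mem_range.1 hi
      change Ψ (z i) (z (i + 1)) = 0
      rw [hzt _ (h1 _ (by omega)), hzt _ (h1 _ (by omega)), hΨ]

end IntervalSum

/-! ### Tagged chains near a point -/

section TaggedChain

/-- A chain of points from `u` to `v` with tags. -/
structure TChain (u v : ℝ) where
  n : ℕ
  x : ℕ → ℝ
  y : ℕ → ℝ
  mono : MonotoneOn x (Iic n)
  left : x 0 = u
  right : x n = v
  tag : ∀ i < n, y i ∈ Icc (x i) (x (i + 1))

/-- The Riemann-Stieltjes sum over the chain of `[s, t]` induced by a tagged chain. -/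
def TChain.sum {u v : ℝ} (κ : TChain u v) (F h : ℝ → ℝ) (s t : ℝ) : ℝ :=
  ∑ i ∈ Finset.range κ.n,
    F (clamp s t (κ.y i)) * (h (clamp s t (κ.x (i + 1))) - h (clamp s t (κ.x i)))

theorem TChain.tag_mono {u v : ℝ} (κ : TChain u v) : MonotoneOn κ.y (Iio κ.n) := by
  intro i hi j hj hij
  simp only [mem_Iio] at hi hj
  rcases hij.eq_or_lt with rfl | hij
  · exact le_rfl
  · exact (κ.tag i hi).2.trans ((κ.mono (show i + 1 ≤ κ.n by omega) (show j ≤ κ.n by omega)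
      (by omega)).trans (κ.tag j hj).1)

variable {a b t : ℝ} {F h W : ℝ → ℝ}

/-- Tags clamped to `t` form a final block, on which F takes the value `F t` and the sum telescopes
to `F t * (h t - h (x j))`. The earlier tags lie before `t`, where F may be replaced by its left
limit. How the tags are chosen enters only through the position of `x j`. -/
theorem IsYoung.chain_left (H : IsYoung a b F h W) (ht : t ∈ Ioc a b) {ε : ℝ} (hε : 0 < ε) :
    ∀ᶠ s in 𝓝[<] t, ∀ (u v : ℝ) (κ : TChain u v), u ≤ s → t ≤ v → ∃ j ≤ κ.n,
      (∀ i < j, clamp s t (κ.y i) < t) ∧ (∀ i, j ≤ i → i < κ.n → clamp s t (κ.y i) = t) ∧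
      |κ.sum F h s t - (leftLim F t * (h t - h s) +
        (F t - leftLim F t) * (h t - h (clamp s t (κ.x j))))| ≤ ε * (W t - W s) := by
  filter_upwards [H.left ht hε, mem_Ico_of_nhdsLT ht] with s hs hst u v κ hu hv
  obtain ⟨j, hj, h1, h2⟩ := exists_cut (fun i => clamp s t (κ.y i) < t) κ.n
    fun i j hij hj h => (clamp_mono s t (κ.tag_mono (show i < _ by omega) hj hij)).trans_lt h
  have h2' : ∀ i, j ≤ i → i < κ.n → clamp s t (κ.y i) = t := fun i hi hin =>
    le_antisymm (clamp_mem hst.2.le _).2 (not_lt.1 (h2 i hi hin))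
  refine ⟨j, hj, h1, h2', ?_⟩
  have key := hs j (fun i => clamp s t (κ.x i)) (fun i => clamp s t (κ.y i))
    ((clamp_monotoneOn κ.mono s t).mono fun i (hi : i ≤ _) => show i ≤ _ by omega)
    (((clamp_mono s t).comp_monotoneOn κ.tag_mono).mono fun i (hi : i < _) => show i < _ by omega)
    (fun i _ => clamp_mem hst.2.le _) (fun i hi => ⟨(clamp_mem hst.2.le _).1, h1 i hi⟩)
  convert key using 2
  obtain ⟨d, hd⟩ := Nat.exists_eq_add_of_le hj
  have e1 : ∑ i ∈ Finset.range d, F (clamp s t (κ.y (j + i))) *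
      (h (clamp s t (κ.x (j + i + 1))) - h (clamp s t (κ.x (j + i)))) =
      F t * (h t - h (clamp s t (κ.x j))) := by
    have : h t = h (clamp s t (κ.x (j + d))) := by
      rw [← hd, κ.right, clamp_of_ge hst.2.le hv]
    rw [this]
    have e := Finset.sum_range_sub (fun i => h (clamp s t (κ.x (j + i)))) d
    rw [add_zero] at e
    rw [← e, Finset.mul_sum]
    refine Finset.sum_congr rfl fun i hi => ?_
    have := Finset.mem_range.1 hi
    rw [h2' _ (by omega) (by omega)]
    rfl
  have e2 := Finset.sum_range_sub (fun i => h (clamp s t (κ.x i))) j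
  rw [κ.left, clamp_of_le hu] at e2
  rw [TChain.sum, hd, Finset.sum_range_add, e1]
  simp only [sub_mul, Finset.sum_sub_distrib]
  rw [← Finset.mul_sum, e2]
  ring

/-- Now the tags clamped to `t` form the initial block, and the correction measures how far beyond
`t` that block reaches. -/
theorem IsYoung.chain_right (H : IsYoung a b F h W) (ht : t ∈ Ico a b) {ε : ℝ} (hε : 0 < ε) :
    ∀ᶠ s in 𝓝[>] t, ∀ (u v : ℝ) (κ : TChain u v), u ≤ t → s ≤ v → ∃ j ≤ κ.n,
      (∀ i < j, clamp t s (κ.y i) = t) ∧ (∀ i, j ≤ i → i < κ.n → t < clamp t s (κ.y i)) ∧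
      |κ.sum F h t s - (rightLim F t * (h s - h t) +
        (F t - rightLim F t) * (h (clamp t s (κ.x j)) - h t))| ≤ ε * (W s - W t) := by
  filter_upwards [H.right ht hε, mem_Ioc_of_nhdsGT ht] with s hs hst u v κ hu hv
  obtain ⟨j, hj, h1, h2⟩ := exists_cut (fun i => clamp t s (κ.y i) ≤ t) κ.n
    fun i j hij hj h => (clamp_mono t s (κ.tag_mono (show i < _ by omega) hj hij)).trans h
  have h1' : ∀ i < j, clamp t s (κ.y i) = t := fun i hi =>
    le_antisymm (h1 i hi) (clamp_mem hst.1.le _).1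
  have h2' : ∀ i, j ≤ i → i < κ.n → t < clamp t s (κ.y i) := fun i hi hin =>
    not_le.1 (h2 i hi hin)
  refine ⟨j, hj, h1', h2', ?_⟩
  obtain ⟨d, hd⟩ := Nat.exists_eq_add_of_le hj
  have key := hs d (fun i => clamp t s (κ.x (j + i))) (fun i => clamp t s (κ.y (j + i)))
    (fun i hi i' hi' hii => by
      simp only [mem_Iic] at hi hi'
      exact clamp_monotoneOn κ.mono t s (show j + i ≤ _ by omega) (show j + i' ≤ _ by omega)
        (by omega))
    (fun i hi i' hi' hii => by
      simp only [mem_Iio] at hi hi'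
      exact clamp_mono t s (κ.tag_mono (show j + i < _ by omega) (show j + i' < _ by omega)
        (by omega)))
    (fun i _ => clamp_mem hst.1.le _)
    (fun i hi => ⟨h2' _ (by omega) (by omega), (clamp_mem hst.1.le _).2⟩)
  convert key using 2
  have e1 : ∑ i ∈ Finset.range j, F (clamp t s (κ.y i)) *
      (h (clamp t s (κ.x (i + 1))) - h (clamp t s (κ.x i))) =
      F t * (h (clamp t s (κ.x j)) - h t) := by
    have : h t = h (clamp t s (κ.x 0)) := by rw [κ.left, clamp_of_le hu]
    rw [this]
    have e := Finset.sum_range_sub (fun i => h (clamp t s (κ.x i))) j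
    rw [← e, Finset.mul_sum]
    refine Finset.sum_congr rfl fun i hi => ?_
    rw [h1' _ (Finset.mem_range.1 hi)]
  have e2 := Finset.sum_range_sub (fun i => h (clamp t s (κ.x (j + i)))) d
  rw [← hd, κ.right, clamp_of_ge hst.1.le hv, add_zero] at e2
  rw [TChain.sum, hd, Finset.sum_range_add, e1]
  simp only [sub_mul, Finset.sum_sub_distrib]
  rw [← Finset.mul_sum]
  simp only [add_assoc] at e2 ⊢
  rw [e2]
  ring

end TaggedChain

/-! ### Summation of jumps dominated by those of a monotone function -/

section Jumps

variable {a b s t C ε : ℝ} {W cl cr dl dr : ℝ → ℝ}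

theorem _root_.Monotone.jumpL_nonneg (hW : Monotone W) (t : ℝ) : 0 ≤ jumpL W t :=
  sub_nonneg.2 (hW.leftLim_le le_rfl)

theorem _root_.Monotone.jumpR_nonneg (hW : Monotone W) (t : ℝ) : 0 ≤ jumpR W t :=
  sub_nonneg.2 (hW.le_rightLim le_rfl)

/-- Induction on the largest point: its jump fits between the left limit of `W` there and the left
limit at `t`. -/
theorem sum_jumps_le (hW : Monotone W) (K : Finset ℝ) :
    ∀ t, s < t → (∀ x ∈ K, x ∈ Ioo s t) →
      ∑ x ∈ K, (jumpL W x + jumpR W x) ≤ leftLim W t - rightLim W s := by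
  induction K using Finset.induction_on_max with
  | empty =>
    intro t hst _
    simpa using hW.rightLim_le_leftLim hst
  | insert m K hm ih =>
    intro t hst hK
    have hmem := hK m (Finset.mem_insert_self _ _)
    rw [Finset.sum_insert fun h => lt_irrefl _ (hm m h)]
    have h1 := ih m hmem.1 fun x hx =>
      ⟨(hK x (Finset.mem_insert_of_mem hx)).1, hm x hx⟩
    have h2 := hW.rightLim_le_leftLim hmem.2
    simp only [jumpL, jumpR] at *
    linarith

/-- The jumps `cl`, `cr` are dominated at `r` by those of the monotone function `W`. -/
def DomJump (C : ℝ) (cl cr W : ℝ → ℝ) (r : ℝ) : Prop :=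
  |cl r| ≤ C * jumpL W r ∧ |cr r| ≤ C * jumpR W r

theorem sum_abs_indicator_le (hW : Monotone W) (hst : s < t)
    (h : ∀ r ∈ Ioo s t, |cl r| ≤ C * (jumpL W r + jumpR W r)) (hC : 0 ≤ C) (K : Finset ℝ) :
    ∑ x ∈ K, |(Ioo s t).indicator cl x| ≤ C * (leftLim W t - rightLim W s) := by
  classical
  calc ∑ x ∈ K, |(Ioo s t).indicator cl x|
      = ∑ x ∈ K with x ∈ Ioo s t, |cl x| := by
        rw [Finset.sum_filter]
        refine Finset.sum_congr rfl fun x _ => ?_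
        by_cases hx : x ∈ Ioo s t <;> simp [hx]
    _ ≤ ∑ x ∈ K with x ∈ Ioo s t, C * (jumpL W x + jumpR W x) :=
        Finset.sum_le_sum fun x hx => h x (Finset.mem_filter.1 hx).2
    _ ≤ C * (leftLim W t - rightLim W s) := by
        rw [← Finset.mul_sum]
        exact mul_le_mul_of_nonneg_left
          (sum_jumps_le hW _ t hst fun x hx => (Finset.mem_filter.1 hx).2) hC

theorem summable_indicator_Ioo (hW : Monotone W) (hst : s < t)
    (h : ∀ r ∈ Ioo s t, |cl r| ≤ C * (jumpL W r + jumpR W r)) :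
    Summable ((Ioo s t).indicator cl) := by
  have h' : ∀ r ∈ Ioo s t, |cl r| ≤ |C| * (jumpL W r + jumpR W r) := fun r hr =>
    (h r hr).trans (mul_le_mul_of_nonneg_right (le_abs_self C)
      (add_nonneg (hW.jumpL_nonneg r) (hW.jumpR_nonneg r)))
  exact Summable.of_abs (summable_of_sum_le (fun _ => abs_nonneg _)
    (sum_abs_indicator_le hW hst h' (abs_nonneg C)))

theorem abs_tsum_indicator_le (hW : Monotone W) (hst : s < t) (hC : 0 ≤ C)
    (h : ∀ r ∈ Ioo s t, |cl r| ≤ C * (jumpL W r + jumpR W r)) :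
    |∑' x, (Ioo s t).indicator cl x| ≤ C * (leftLim W t - rightLim W s) := by
  have hs : Summable fun x => |(Ioo s t).indicator cl x| := (summable_indicator_Ioo hW hst h).abs
  have h1 : |∑' x, (Ioo s t).indicator cl x| ≤ ∑' x, |(Ioo s t).indicator cl x| :=
    norm_tsum_le_tsum_norm (f := fun x => (Ioo s t).indicator cl x) hs
  exact h1.trans (hs.tsum_le_of_sum_le (sum_abs_indicator_le hW hst h hC))

theorem summable_indicator_singleton (cl : ℝ → ℝ) (t : ℝ) :
    Summable (({t} : Set ℝ).indicator cl) :=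
  summable_of_ne_finset_zero (s := {t}) fun x hx => by
    rw [indicator_of_notMem]; simpa using hx

theorem tsum_indicator_singleton (cl : ℝ → ℝ) (t : ℝ) :
    ∑' x, ({t} : Set ℝ).indicator cl x = cl t := by
  rw [tsum_eq_single t fun x hx => indicator_of_notMem (by simpa using hx) _]
  simp

theorem indicator_Ioc_eq (hst : s < t) (cl : ℝ → ℝ) :
    (Ioc s t).indicator cl = (Ioo s t).indicator cl + ({t} : Set ℝ).indicator cl := by
  rw [← Ioo_union_right hst, indicator_union_of_disjoint (by simp)]
  rfl

theorem indicator_Ico_eq (hst : s < t) (cl : ℝ → ℝ) :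
    (Ico s t).indicator cl = (Ioo s t).indicator cl + ({s} : Set ℝ).indicator cl := by
  rw [← Ioo_union_left hst, indicator_union_of_disjoint (by simp)]
  rfl

theorem indicator_Ioc_add {u v : ℝ} (h1 : u ≤ t) (h2 : t ≤ v) (cl : ℝ → ℝ) :
    (Ioc u v).indicator cl = (Ioc u t).indicator cl + (Ioc t v).indicator cl := by
  rw [← Ioc_union_Ioc_eq_Ioc h1 h2, indicator_union_of_disjoint (Ioc_disjoint_Ioc_of_le le_rfl)]
  rfl

theorem indicator_Ico_add {u v : ℝ} (h1 : u ≤ t) (h2 : t ≤ v) (cl : ℝ → ℝ) :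
    (Ico u v).indicator cl = (Ico u t).indicator cl + (Ico t v).indicator cl := by
  rw [← Ico_union_Ico_eq_Ico h1 h2, indicator_union_of_disjoint]
  · rfl
  · exact disjoint_left.2 fun x hx hx' => absurd hx.2 (not_lt.2 hx'.1)

/-- Near each point of `[a, b]`, the jumps `cl`, `cr` are dominated by those of `W`. -/
def LocDomJump (a b : ℝ) (cl cr W : ℝ → ℝ) : Prop :=
  (∀ t ∈ Ioc a b, ∃ C, ∀ᶠ r in 𝓝[<] t, DomJump C cl cr W r) ∧
  (∀ t ∈ Ico a b, ∃ C, ∀ᶠ r in 𝓝[>] t, DomJump C cl cr W r)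

theorem LocDomJump.of_forall (h : ∀ r ∈ Ioo a b, DomJump C cl cr W r) :
    LocDomJump a b cl cr W := by
  refine ⟨fun t ht => ⟨C, ?_⟩, fun t ht => ⟨C, ?_⟩⟩
  · filter_upwards [mem_Ico_of_nhdsLT ht] with r hr using h r ⟨hr.1, hr.2.trans_le ht.2⟩
  · filter_upwards [mem_Ioc_of_nhdsGT ht] with r hr using h r ⟨ht.1.trans_lt hr.1, hr.2⟩

theorem DomJump.bound (hW : Monotone W) {r : ℝ} (h : DomJump C cl cr W r) :
    |cl r| ≤ |C| * (jumpL W r + jumpR W r) ∧ |cr r| ≤ |C| * (jumpL W r + jumpR W r) := by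
  have h1 := hW.jumpL_nonneg r
  have h2 := hW.jumpR_nonneg r
  have h3 := le_abs_self C
  have h4 := abs_nonneg C
  exact ⟨h.1.trans (by nlinarith), h.2.trans (by nlinarith)⟩

/-- The constant of domination may depend on the point, so summability is obtained on one-sided
neighbourhoods and glued by `interval_induction`. The end points add a single term each and need no
domination. -/
theorem LocDomJump.summable (hW : Monotone W) (H : LocDomJump a b cl cr W) {u v : ℝ}
    (hu : a ≤ u) (huv : u ≤ v) (hv : v ≤ b) :
    Summable ((Ioc u v).indicator cl) ∧ Summable ((Ico u v).indicator cr) := by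
  rcases huv.eq_or_lt with rfl | huv
  · simp
  have base : ∀ {s t}, s < t → (∃ C, ∀ r ∈ Ioo s t, DomJump C cl cr W r) →
      Summable ((Ioc s t).indicator cl) ∧ Summable ((Ico s t).indicator cr) := by
    rintro s t hst ⟨C, h⟩
    rw [indicator_Ioc_eq hst, indicator_Ico_eq hst]
    exact ⟨(summable_indicator_Ioo hW hst fun r hr => ((h r hr).bound hW).1).add
      (summable_indicator_singleton _ _),
      (summable_indicator_Ioo hW hst fun r hr => ((h r hr).bound hW).2).add
      (summable_indicator_singleton _ _)⟩
  refine interval_induction (P := fun u v => Summable ((Ioc u v).indicator cl) ∧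
    Summable ((Ico u v).indicator cr)) ?_ ?_ ?_ hu huv hv
  · intro u t v _ hut htv _ h1 h2
    rw [indicator_Ioc_add hut.le htv.le, indicator_Ico_add hut.le htv.le]
    exact ⟨h1.1.add h2.1, h1.2.add h2.2⟩
  · intro t ht
    obtain ⟨C, hC⟩ := H.1 t ht
    filter_upwards [eventually_Ico_of_nhdsLT hC, self_mem_nhdsWithin] with s hs hst
    exact base hst ⟨C, fun r hr => hs r ⟨hr.1.le, hr.2⟩⟩
  · intro t ht
    obtain ⟨C, hC⟩ := H.2 t ht
    filter_upwards [eventually_Ioc_of_nhdsGT hC, self_mem_nhdsWithin] with s hs hst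
    exact base hst ⟨C, fun r hr => hs r ⟨hr.1, hr.2.le⟩⟩

/-- The pure jump function on `[a, ∞)` with left jumps `cl` and right jumps `cr`. -/
noncomputable def jumpSum (a : ℝ) (cl cr : ℝ → ℝ) (t : ℝ) : ℝ :=
  ∑' x : Ioc a t, cl x + ∑' x : Ico a t, cr x

theorem jumpSum_self (a : ℝ) (cl cr : ℝ → ℝ) : jumpSum a cl cr a = 0 := by
  simp [jumpSum]

theorem jumpSum_sub_eq_tsum (hW : Monotone W) (H : LocDomJump a b cl cr W) (hs : a ≤ s)
    (hst : s ≤ t) (ht : t ≤ b) :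
    jumpSum a cl cr t - jumpSum a cl cr s = ∑' x : Ioc s t, cl x + ∑' x : Ico s t, cr x := by
  have h1 := H.summable hW le_rfl hs (hst.trans ht)
  have h2 := H.summable hW hs hst ht
  simp only [jumpSum, tsum_subtype]
  rw [indicator_Ioc_add hs hst, indicator_Ico_add hs hst]
  simp only [Pi.add_apply]
  rw [h1.1.tsum_add h2.1, h1.2.tsum_add h2.2]
  ring

theorem jumpSum_sub_eq (hW : Monotone W) (H : LocDomJump a b cl cr W) (hs : a ≤ s)
    (hst : s < t) (ht : t ≤ b) :
    jumpSum a cl cr t - jumpSum a cl cr s =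
      cr s + ∑' x, (Ioo s t).indicator (fun r => cl r + cr r) x + cl t := by
  have h2 := H.summable hW hs hst.le ht
  rw [jumpSum_sub_eq_tsum hW H hs hst.le ht, tsum_subtype, tsum_subtype]
  have h3 : Summable ((Ioo s t).indicator cl) := by
    have := h2.1.sub (summable_indicator_singleton cl t)
    rwa [indicator_Ioc_eq hst, show ∀ f g : ℝ → ℝ, (fun x => (f + g) x - g x) = f from
      fun f g => by ext; simp] at this
  have h4 : Summable ((Ioo s t).indicator cr) := by
    have := h2.2.sub (summable_indicator_singleton cr s)
    rwa [indicator_Ico_eq hst, show ∀ f g : ℝ → ℝ, (fun x => (f + g) x - g x) = f from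
      fun f g => by ext; simp] at this
  rw [indicator_Ioc_eq hst, indicator_Ico_eq hst]
  simp only [Pi.add_apply]
  rw [h3.tsum_add (summable_indicator_singleton _ _),
    h4.tsum_add (summable_indicator_singleton _ _), tsum_indicator_singleton,
    tsum_indicator_singleton]
  have : (Ioo s t).indicator (fun r => cl r + cr r) =
      fun x => (Ioo s t).indicator cl x + (Ioo s t).indicator cr x := indicator_add' _ cl cr
  rw [this, h3.tsum_add h4]
  ring

theorem abs_tsum_Ioo_le (hW : Monotone W) (hst : s < t) (hε : 0 ≤ ε)
    (h : ∀ r ∈ Ioo s t, DomJump ε cl cr W r) :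
    |∑' x, (Ioo s t).indicator (fun r => cl r + cr r) x| ≤
      ε * (leftLim W t - rightLim W s) :=
  abs_tsum_indicator_le hW hst hε fun r hr => (abs_add_le _ _).trans (by
    rw [mul_add]; exact add_le_add (h r hr).1 (h r hr).2)

/-- Only the left jump at `t` is removed; the right jump at `s` and both jumps in between are
charged to the increment of `W` up to its left limit at `t`. -/
theorem abs_jumpSum_sub_le_left (hW : Monotone W) (H : LocDomJump a b cl cr W) (hs : a ≤ s)
    (hst : s < t) (ht : t ≤ b) (hε : 0 ≤ ε) (h : ∀ r ∈ Ico s t, DomJump ε cl cr W r) :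
    |jumpSum a cl cr t - jumpSum a cl cr s - cl t| ≤ ε * (leftLim W t - W s) := by
  rw [jumpSum_sub_eq hW H hs hst ht, add_sub_cancel_right]
  refine (abs_add_le _ _).trans ((add_le_add (h s ⟨le_rfl, hst⟩).2 (abs_tsum_Ioo_le hW hst hε
    fun r hr => h r ⟨hr.1.le, hr.2⟩)).trans (le_of_eq ?_))
  simp only [jumpR]
  ring

theorem abs_jumpSum_sub_le_right (hW : Monotone W) (H : LocDomJump a b cl cr W) (ht : a ≤ t)
    (hts : t < s) (hs : s ≤ b) (hε : 0 ≤ ε) (h : ∀ r ∈ Ioc t s, DomJump ε cl cr W r) :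
    |jumpSum a cl cr s - jumpSum a cl cr t - cr t| ≤ ε * (W s - rightLim W t) := by
  rw [jumpSum_sub_eq hW H ht hts hs, add_assoc, add_sub_cancel_left]
  refine (abs_add_le _ _).trans ((add_le_add (abs_tsum_Ioo_le hW hts hε
    fun r hr => h r ⟨hr.1, hr.2.le⟩) (h s ⟨hts, le_rfl⟩).1).trans (le_of_eq ?_))
  simp only [jumpL]
  ring

theorem DomJump.abs {r : ℝ} (hW : Monotone W) (h : DomJump C cl cr W r) :
    DomJump |C| cl cr W r :=
  ⟨h.1.trans (mul_le_mul_of_nonneg_right (le_abs_self C) (hW.jumpL_nonneg r)),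
    h.2.trans (mul_le_mul_of_nonneg_right (le_abs_self C) (hW.jumpR_nonneg r))⟩

theorem tendsto_jumpSum_left (hW : Monotone W) (H : LocDomJump a b cl cr W) (ht : t ∈ Ioc a b) :
    Tendsto (fun s => jumpSum a cl cr t - jumpSum a cl cr s) (𝓝[<] t) (𝓝 (cl t)) := by
  obtain ⟨C, hC⟩ := H.1 t ht
  have h1 : Tendsto (fun s => |C| * (leftLim W t - W s)) (𝓝[<] t) (𝓝 0) := by
    simpa using ((hW.tendsto_leftLim t).const_sub (leftLim W t)).const_mul |C|
  refine tendsto_iff_dist_tendsto_zero.2 (squeeze_zero' (.of_forall fun _ => dist_nonneg) ?_ h1)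
  filter_upwards [eventually_Ico_of_nhdsLT hC, mem_Ico_of_nhdsLT ht] with s hs hst
  exact abs_jumpSum_sub_le_left hW H hst.1.le hst.2 ht.2 (abs_nonneg C)
    fun r hr => (hs r hr).abs hW

theorem tendsto_jumpSum_right (hW : Monotone W) (H : LocDomJump a b cl cr W)
    (ht : t ∈ Ico a b) :
    Tendsto (fun s => jumpSum a cl cr s - jumpSum a cl cr t) (𝓝[>] t) (𝓝 (cr t)) := by
  obtain ⟨C, hC⟩ := H.2 t ht
  have h1 : Tendsto (fun s => |C| * (W s - rightLim W t)) (𝓝[>] t) (𝓝 0) := by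
    simpa using ((hW.tendsto_rightLim t).sub_const (rightLim W t)).const_mul |C|
  refine tendsto_iff_dist_tendsto_zero.2 (squeeze_zero' (.of_forall fun _ => dist_nonneg) ?_ h1)
  filter_upwards [eventually_Ioc_of_nhdsGT hC, mem_Ioc_of_nhdsGT ht] with s hs hst
  exact abs_jumpSum_sub_le_right hW H ht.1 hst.1 hst.2.le (abs_nonneg C)
    fun r hr => (hs r hr).abs hW

theorem jumpSum_sub_const_mul {W' : ℝ → ℝ} (hW : Monotone W) (H : LocDomJump a b cl cr W)
    (hW' : Monotone W') (H' : LocDomJump a b dl dr W') (k : ℝ) (ht : a ≤ t) (htb : t ≤ b) :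
    jumpSum a (fun r => cl r - k * dl r) (fun r => cr r - k * dr r) t =
      jumpSum a cl cr t - k * jumpSum a dl dr t := by
  have h1 := H.summable hW le_rfl ht htb
  have h2 := H'.summable hW' le_rfl ht htb
  simp only [← summable_subtype_iff_indicator] at h1 h2
  unfold jumpSum
  rw [(show Summable fun x : Ioc a t => cl x from h1.1).tsum_sub
    (Summable.mul_left k (show Summable fun x : Ioc a t => dl x from h2.1)), tsum_mul_left,
    (show Summable fun x : Ico a t => cr x from h1.2).tsum_sub
    (Summable.mul_left k (show Summable fun x : Ico a t => dr x from h2.2)), tsum_mul_left]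
  ring

end Jumps

/-! ### Products of jumps of a Young pair -/

section YoungJumps

variable {a b p t : ℝ} {F f h W : ℝ → ℝ}

theorem IsRegulated.tendsto_jumps_left (hf : IsRegulated a b f) (ht : t ∈ Ioc a b) :
    Tendsto (jumpL f) (𝓝[<] t) (𝓝 0) ∧ Tendsto (jumpR f) (𝓝[<] t) (𝓝 0) := by
  have h0 := hf.tendsto_left ht
  have h1 := tendsto_leftMod_left hf le_rfl ht
  have h2 := tendsto_rightMod_left hf le_rfl ht
  constructor
  · refine (by simpa using h0.sub h1 : Tendsto (fun x => f x - leftMod a f x) _ (𝓝 0)).congr' ?_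
    filter_upwards [mem_Ico_of_nhdsLT ht] with r hr
    rw [jumpL, leftMod_of_lt hr.1]
  · refine (by simpa using h2.sub h0 : Tendsto (fun x => rightMod b f x - f x) _ (𝓝 0)).congr' ?_
    filter_upwards [mem_Ico_of_nhdsLT ht] with r hr
    rw [jumpR, rightMod_of_lt (hr.2.trans_le ht.2)]

theorem IsRegulated.tendsto_jumps_right (hf : IsRegulated a b f) (ht : t ∈ Ico a b) :
    Tendsto (jumpL f) (𝓝[>] t) (𝓝 0) ∧ Tendsto (jumpR f) (𝓝[>] t) (𝓝 0) := by
  have h0 := hf.tendsto_right ht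
  have h1 := tendsto_leftMod_right hf le_rfl ht
  have h2 := tendsto_rightMod_right hf le_rfl ht
  constructor
  · refine (by simpa using h0.sub h1 : Tendsto (fun x => f x - leftMod a f x) _ (𝓝 0)).congr' ?_
    filter_upwards [mem_Ioc_of_nhdsGT ht] with r hr
    rw [jumpL, leftMod_of_lt (ht.1.trans_lt hr.1)]
  · refine (by simpa using h2.sub h0 : Tendsto (fun x => rightMod b f x - f x) _ (𝓝 0)).congr' ?_
    filter_upwards [mem_Ioc_of_nhdsGT ht] with r hr
    rw [jumpR, rightMod_of_lt hr.2]

theorem Ctrl.jumpL_le (hf : Ctrl a b p f W) (hp : 0 < p) (hr : IsRegulated a b f)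
    (ht : t ∈ Ioc a b) : |jumpL f t| ^ p ≤ jumpL W t := by
  have h1 := tendsto_sub_left (hr.tendsto_left ht)
  refine le_of_tendsto_of_tendsto (tendsto_abs_rpow hp h1)
    (tendsto_sub_left (hf.1.tendsto_leftLim t)) ?_
  filter_upwards [mem_Ico_of_nhdsLT ht] with r hr using hf.2 r t hr.1.le hr.2.le ht.2

theorem Ctrl.jumpR_le (hf : Ctrl a b p f W) (hp : 0 < p) (hr : IsRegulated a b f)
    (ht : t ∈ Ico a b) : |jumpR f t| ^ p ≤ jumpR W t := by
  have h1 := tendsto_sub_right (hr.tendsto_right ht)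
  refine le_of_tendsto_of_tendsto (tendsto_abs_rpow hp h1)
    (tendsto_sub_right (hf.1.tendsto_rightLim t)) ?_
  filter_upwards [mem_Ioc_of_nhdsGT ht] with r hr using hf.2 t r ht.1 hr.1.le hr.2.le

/-- A left jump of one function is multiplied by a right jump of the other, so only the two-sided
jump of `W` can dominate. The small factor is the jump of F when h has bounded variation, and
otherwise a positive power of the jump of its control. -/
theorem IsYoung.jumps_of_tendsto (H : IsYoung a b F h W) {l : Filter ℝ}
    (hl : ∀ᶠ r in l, r ∈ Ioo a b)
    (hj : ∀ f, IsRegulated a b f → Tendsto (jumpL f) l (𝓝 0) ∧ Tendsto (jumpR f) l (𝓝 0))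
    {ε : ℝ} (hε : 0 < ε) :
    ∀ᶠ r in l, |jumpL F r * jumpR h r| ≤ ε * (jumpL W r + jumpR W r) ∧
      |jumpR F r * jumpL h r| ≤ ε * (jumpL W r + jumpR W r) := by
  obtain ⟨hF, hh, H | ⟨p, q, WF, Wh, hp, hq, hpq, HF, Hh, rfl⟩⟩ := H
  · obtain ⟨h1, h2⟩ := hj F hF
    have h1' := h1.eventually (Metric.closedBall_mem_nhds _ hε)
    have h2' := h2.eventually (Metric.closedBall_mem_nhds _ hε)
    filter_upwards [hl, h1', h2'] with r hr g1 g2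
    have e1 := H.jumpL_le one_pos hh ⟨hr.1, hr.2.le⟩
    have e2 := H.jumpR_le one_pos hh ⟨hr.1.le, hr.2⟩
    rw [Real.rpow_one] at e1 e2
    simp only [dist_zero_right, Real.norm_eq_abs] at g1 g2
    have n1 := H.1.jumpL_nonneg r
    have n2 := H.1.jumpR_nonneg r
    rw [abs_mul, abs_mul]
    exact ⟨(mul_le_mul g1 e2 (abs_nonneg _) hε.le).trans (by nlinarith),
      (mul_le_mul g2 e1 (abs_nonneg _) hε.le).trans (by nlinarith)⟩
  · obtain ⟨h1, h2⟩ := hj WF HF.1.isRegulated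
    have h3 : Tendsto (fun r => jumpL WF r + jumpR WF r) l (𝓝 0) := by simpa using h1.add h2
    have e3 : ∀ r, jumpL (fun x => WF x + Wh x) r = jumpL WF r + jumpL Wh r := fun r =>
      jumpL_eq (by
        simpa [add_sub_add_comm] using (tendsto_sub_left (HF.1.tendsto_leftLim r)).add
          (tendsto_sub_left (Hh.1.tendsto_leftLim r)))
    have e4 : ∀ r, jumpR (fun x => WF x + Wh x) r = jumpR WF r + jumpR Wh r := fun r =>
      jumpR_eq (by
        simpa [add_sub_add_comm] using (tendsto_sub_right (HF.1.tendsto_rightLim r)).add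
          (tendsto_sub_right (Hh.1.tendsto_rightLim r)))
    filter_upwards [hl, eventually_rpow_lt (K := 1) (sub_pos.2 hpq) hε h3] with r hr hsmall
    rw [one_mul] at hsmall
    have a1 := HF.jumpL_le hq hF ⟨hr.1, hr.2.le⟩
    have a2 := HF.jumpR_le hq hF ⟨hr.1.le, hr.2⟩
    have b1 := Hh.jumpL_le (by linarith) hh ⟨hr.1, hr.2.le⟩
    have b2 := Hh.jumpR_le (by linarith) hh ⟨hr.1.le, hr.2⟩
    have m1 := HF.1.jumpL_nonneg r
    have m2 := HF.1.jumpR_nonneg r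
    have n1 := Hh.1.jumpL_nonneg r
    have n2 := Hh.1.jumpR_nonneg r
    have key : ∀ A B : ℝ, |A| ^ q ≤ jumpL WF r + jumpR WF r →
        |B| ^ p ≤ jumpL Wh r + jumpR Wh r → |A * B| ≤
          ε * (jumpL (fun x => WF x + Wh x) r + jumpR (fun x => WF x + Wh x) r) := by
      intro A B hA hB
      have hA' := le_rpow_inv hq (abs_nonneg _) hA
      have hB' := le_rpow_inv (by linarith) (abs_nonneg _) hB
      rw [abs_mul, e3, e4]
      calc |A| * |B| ≤ _ := mul_le_mul hA' hB' (abs_nonneg _) (Real.rpow_nonneg (by linarith) _)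
        _ ≤ _ := rpow_mul_rpow_le hp hq (by linarith) (by linarith)
        _ ≤ ε * ((jumpL WF r + jumpR WF r) + (jumpL Wh r + jumpR Wh r)) := by gcongr
        _ = _ := by ring
    exact ⟨key _ _ (by linarith) (by linarith), key _ _ (by linarith) (by linarith)⟩

theorem IsYoung.jumps_left (H : IsYoung a b F h W) (ht : t ∈ Ioc a b) {ε : ℝ} (hε : 0 < ε) :
    ∀ᶠ r in 𝓝[<] t, |jumpL F r * jumpR h r| ≤ ε * (jumpL W r + jumpR W r) ∧
      |jumpR F r * jumpL h r| ≤ ε * (jumpL W r + jumpR W r) :=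
  H.jumps_of_tendsto ((mem_Ico_of_nhdsLT ht).mono fun _ hr => ⟨hr.1, hr.2.trans_le ht.2⟩)
    (fun _ hf => hf.tendsto_jumps_left ht) hε

theorem IsYoung.jumps_right (H : IsYoung a b F h W) (ht : t ∈ Ico a b) {ε : ℝ} (hε : 0 < ε) :
    ∀ᶠ r in 𝓝[>] t, |jumpL F r * jumpR h r| ≤ ε * (jumpL W r + jumpR W r) ∧
      |jumpR F r * jumpL h r| ≤ ε * (jumpL W r + jumpR W r) :=
  H.jumps_of_tendsto ((mem_Ioc_of_nhdsGT ht).mono fun _ hr => ⟨ht.1.trans_lt hr.1, hr.2⟩)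
    (fun _ hf => hf.tendsto_jumps_right ht) hε

/-- One-sided modifications of the two members of a Young pair. -/
theorem IsYoung.modify (H : IsYoung a b F h W) {u v : ℝ}
    {F' h' : ℝ → ℝ} (hF' : IsRegulated u v F') (hh' : IsRegulated u v h')
    (mF : ∀ q WF, 0 < q → IsRegulated a b F → Ctrl a b q F WF → ∃ WF', Ctrl u v q F' WF')
    (mh : ∀ p Wh, 0 < p → IsRegulated a b h → Ctrl a b p h Wh → ∃ Wh', Ctrl u v p h' Wh') :
    ∃ W', IsYoung u v F' h' W' := by
  obtain ⟨hF, hh, H | ⟨p, q, WF, Wh, hp, hq, hpq, HF, Hh, rfl⟩⟩ := H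
  · obtain ⟨W', hW'⟩ := mh 1 W one_pos hh H
    exact ⟨W', hF', hh', Or.inl hW'⟩
  · obtain ⟨WF', hWF'⟩ := mF q WF hq hF HF
    obtain ⟨Wh', hWh'⟩ := mh p Wh (by linarith) hh Hh
    exact ⟨_, hF', hh', Or.inr ⟨p, q, WF', Wh', hp, hq, hpq, hWF', hWh', rfl⟩⟩

end YoungJumps

/-! ### Limits of Cauchy sums for Young pairs -/

section Primitives

variable {a b t : ℝ} {F h W T : ℝ → ℝ} {lam : ℕ → Part a b}

/-- `T` is an indefinite integral of `F` against `h` with the jumps of the left integral. -/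
def IsLeftPrim (a b : ℝ) (F h W T : ℝ → ℝ) : Prop :=
  (∀ ε > 0, ∀ t ∈ Ioc a b, ∀ᶠ s in 𝓝[<] t,
    |T t - T s - leftLim F t * (h t - h s)| ≤ ε * (W t - W s)) ∧
  (∀ ε > 0, ∀ t ∈ Ico a b, ∀ᶠ s in 𝓝[>] t,
    |T s - T t - (F t * jumpR h t + rightLim F t * (h s - rightLim h t))| ≤ ε * (W s - W t))

/-- `T` is an indefinite integral of `F` against `h` with the jumps of the right integral. -/
def IsRightPrim (a b : ℝ) (F h W T : ℝ → ℝ) : Prop :=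
  (∀ ε > 0, ∀ t ∈ Ioc a b, ∀ᶠ s in 𝓝[<] t,
    |T t - T s - (F t * jumpL h t + leftLim F t * (leftLim h t - h s))| ≤ ε * (W t - W s)) ∧
  (∀ ε > 0, ∀ t ∈ Ico a b, ∀ᶠ s in 𝓝[>] t,
    |T s - T t - rightLim F t * (h s - h t)| ≤ ε * (W s - W t))

theorem _root_.Monotone.eventually_sub_le_left (hW : Monotone W) (ht : t ∈ Ioc a b) :
    ∀ᶠ s in 𝓝[<] t, W t - W s ≤ W b - W a := by
  filter_upwards [mem_Ico_of_nhdsLT ht] with s hs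
  exact sub_le_sub (hW ht.2) (hW hs.1.le)

theorem _root_.Monotone.eventually_sub_le_right (hW : Monotone W) (ht : t ∈ Ico a b) :
    ∀ᶠ s in 𝓝[>] t, W s - W t ≤ W b - W a := by
  filter_upwards [mem_Ioc_of_nhdsGT ht] with s hs
  exact sub_le_sub (hW hs.2.le) (hW ht.1)

theorem IsLeftPrim.tendsto_left (H : IsLeftPrim a b F h W T) (hW : Monotone W)
    (hh : IsRegulated a b h) (ht : t ∈ Ioc a b) :
    Tendsto (fun s => T t - T s) (𝓝[<] t) (𝓝 (leftLim F t * jumpL h t)) :=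
  tendsto_of_forall_abs_sub_le (hW.eventually_sub_le_left ht) (fun ε hε => H.1 ε hε t ht)
    ((tendsto_sub_left (hh.tendsto_left ht)).const_mul _)

theorem IsLeftPrim.tendsto_right (H : IsLeftPrim a b F h W T) (hW : Monotone W)
    (hh : IsRegulated a b h) (ht : t ∈ Ico a b) :
    Tendsto (fun s => T s - T t) (𝓝[>] t) (𝓝 (F t * jumpR h t)) := by
  refine tendsto_of_forall_abs_sub_le (hW.eventually_sub_le_right ht)
    (fun ε hε => H.2 ε hε t ht) ?_
  simpa using (((hh.tendsto_right ht).sub_const (rightLim h t)).const_mul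
    (rightLim F t)).const_add (F t * jumpR h t)

theorem IsRightPrim.tendsto_left (H : IsRightPrim a b F h W T) (hW : Monotone W)
    (hh : IsRegulated a b h) (ht : t ∈ Ioc a b) :
    Tendsto (fun s => T t - T s) (𝓝[<] t) (𝓝 (F t * jumpL h t)) := by
  refine tendsto_of_forall_abs_sub_le (hW.eventually_sub_le_left ht)
    (fun ε hε => H.1 ε hε t ht) ?_
  simpa using (((hh.tendsto_left ht).const_sub (leftLim h t)).const_mul
    (leftLim F t)).const_add (F t * jumpL h t)

theorem IsRightPrim.tendsto_right (H : IsRightPrim a b F h W T) (hW : Monotone W)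
    (hh : IsRegulated a b h) (ht : t ∈ Ico a b) :
    Tendsto (fun s => T s - T t) (𝓝[>] t) (𝓝 (rightLim F t * jumpR h t)) :=
  tendsto_of_forall_abs_sub_le (hW.eventually_sub_le_right ht) (fun ε hε => H.2 ε hε t ht)
    ((tendsto_sub_right (hh.tendsto_right ht)).const_mul _)

/-- A partition, tagged by the left end points. -/
def Part.chainL {u v : ℝ} (κ : Part u v) : TChain u v where
  n := κ.n
  x := κ.x
  y := κ.x
  mono := κ.monotoneOn
  left := κ.left
  right := κ.right
  tag i hi := ⟨le_rfl, κ.monotoneOn (show i ≤ κ.n by omega) (show i + 1 ≤ κ.n by omega)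
    (Nat.le_succ i)⟩

/-- A partition, tagged by the right end points. -/
def Part.chainR {u v : ℝ} (κ : Part u v) : TChain u v where
  n := κ.n
  x := κ.x
  y i := κ.x (i + 1)
  mono := κ.monotoneOn
  left := κ.left
  right := κ.right
  tag i hi := ⟨κ.monotoneOn (show i ≤ κ.n by omega) (show i + 1 ≤ κ.n by omega)
    (Nat.le_succ i), le_rfl⟩

theorem tendsto_mul_sub_zero {l : Filter ℝ} {c L η : ℝ} (h : Tendsto F l (𝓝 L)) (hη : 0 < η) :
    ∀ᶠ s in l, |c * (F s - L)| ≤ η := by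
  have : Tendsto (fun s => |c * (F s - L)|) l (𝓝 0) := by
    simpa using ((h.sub_const L).const_mul c).abs
  exact this.eventually (Iic_mem_nhds hη)

/-- For the left sums the additivity defect at `t` is `(F x - F t) * (h y - h t)` with x, y
approaching `t` from the left and the right. It vanishes in the limit when h has no right jump at
`t`, which is required only at inaccessible points. -/
theorem IsYoung.exists_leftPrim (H : IsYoung a b F h W) (hlam : IsDenseNested lam)
    (hacc : ∀ t ∈ Ioo a b, t ∉ ⋃ m, (lam m).pts → jumpR h t = 0) :
    ∃ T : ℝ → ℝ, (∀ u v, a ≤ u → u < v → v ≤ b →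
      Tendsto (fun m => sumLC F h (lam m) u v) atTop (𝓝 (T v - T u))) ∧
      IsLeftPrim a b F h W T := by
  obtain ⟨hF, hh⟩ := And.intro H.1 H.2.1
  have hadd : AsympAdditive atTop (fun m => sumLC F h (lam m)) a b := by
    refine asympAdditive_intervalSum hlam (Ψ := fun x y => F x * (h y - h x)) (by simp) ?_
    intro t ht hnot
    have h1 := hF.tendsto_left ⟨ht.1, ht.2.le⟩
    have h2 := tendsto_sub_right (hh.tendsto_right ⟨ht.1.le, ht.2⟩)
    rw [hacc t ht hnot] at h2
    have := ((h1.sub_const (F t)).comp tendsto_fst).mul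
      (h2.comp (tendsto_snd (f := 𝓝[<] t) (g := 𝓝[>] t)))
    rw [mul_zero] at this
    refine this.congr fun q => ?_
    simp only [comp_apply]
    ring
  have hl : ∀ ε > 0, ∀ t ∈ Ioc a b, ∀ᶠ s in 𝓝[<] t,
      AsympWithin atTop (fun m => sumLC F h (lam m)) s t (leftLim F t * (h t - h s))
        (ε * (W t - W s)) := by
    intro ε hε t ht
    filter_upwards [H.chain_left ht hε, mem_Ico_of_nhdsLT ht] with s hs hst η hη
    refine .of_forall fun m => ?_
    obtain ⟨j, hj, h1, h2, h3⟩ := hs _ _ (lam m).chainL hst.1.le ht.2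
    -- With left tags, a tag at `t` means that its interval is already degenerate after clamping, so
    -- the correction term is zero.
    have e : clamp s t ((lam m).chainL.x j) = t := by
      rcases hj.lt_or_eq with hj | rfl
      · exact h2 j le_rfl hj
      · rw [(lam m).chainL.right, clamp_of_ge hst.2.le ht.2]
    rw [e, sub_self, mul_zero, add_zero] at h3
    exact h3.trans (by linarith)
  have hr : ∀ ε > 0, ∀ t ∈ Ico a b, ∀ᶠ s in 𝓝[>] t,
      AsympWithin atTop (fun m => sumLC F h (lam m)) t s
        (F t * jumpR h t + rightLim F t * (h s - rightLim h t)) (ε * (W s - W t)) := by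
    intro ε hε t ht
    filter_upwards [H.chain_right ht hε, mem_Ioc_of_nhdsGT ht] with s hs hst η hη
    -- At the right of `t` the block of tags equal to `t` ends at the first point beyond `t`. By
    -- density this point tends to `t`, and the correction produces the full right jump of h with
    -- coefficient `F t`.
    have h0 := tendsto_mul_sub_zero (c := F t - rightLim F t) (hh.tendsto_right ht) hη
    obtain ⟨d, hd, h0⟩ := mem_nhdsGT_iff_exists_Ioo_subset.1 h0
    filter_upwards [hlam.eventually_meets ht.1 (lt_min hd hst.1)
      ((min_le_right d s).trans hst.2.le)] with m hm
    obtain ⟨k, hk, hk'⟩ := hm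
    obtain ⟨j, hj, h1, h2, h3⟩ := hs _ _ (lam m).chainL ht.1 hst.2.le
    have hxk : t < clamp t s ((lam m).x k) :=
      hk'.1.trans_le (le_clamp_of_le (hk'.2.le.trans (min_le_right _ _)) le_rfl)
    have hjk : j ≤ k := by
      by_contra hjk
      exact hxk.ne' (h1 k (by omega))
    have e1 : t < clamp t s ((lam m).chainL.x j) := by
      rcases hj.lt_or_eq with hj | rfl
      · exact h2 j le_rfl hj
      · rw [(lam m).chainL.right, clamp_of_ge hst.1.le hst.2.le]; exact hst.1
    have e2 : clamp t s ((lam m).chainL.x j) < d :=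
      (clamp_le_of_le hk'.1.le ((lam m).monotoneOn hj hk hjk)).trans_lt
        (hk'.2.trans_le (min_le_left _ _))
    have h4 := h0 ⟨e1, e2⟩
    simp only [mem_ofPred_eq] at h4
    have e3 : sumLC F h (lam m) t s = (lam m).chainL.sum F h t s := rfl
    simp only [e3, jumpR]
    rw [abs_le] at h3 h4 ⊢
    constructor <;> linarith
  obtain ⟨T, hT⟩ := exists_tendsto_of_local H.monotone hadd
    (fun ε hε t ht => (hl ε hε t ht).mono fun s hs => ⟨_, hs⟩)
    (fun ε hε t ht => (hr ε hε t ht).mono fun s hs => ⟨_, hs⟩)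
  refine ⟨T, hT, fun ε hε t ht => ?_, fun ε hε t ht => ?_⟩
  · filter_upwards [hl ε hε t ht, mem_Ico_of_nhdsLT ht] with s hs hst
    exact abs_sub_le_of_asympWithin hs (hT s t hst.1.le hst.2 ht.2)
  · filter_upwards [hr ε hε t ht, mem_Ioc_of_nhdsGT ht] with s hs hst
    exact abs_sub_le_of_asympWithin hs (hT t s ht.1 hst.1 hst.2.le)

theorem IsYoung.exists_rightPrim (H : IsYoung a b F h W) (hlam : IsDenseNested lam)
    (hacc : ∀ t ∈ Ioo a b, t ∉ ⋃ m, (lam m).pts → jumpL h t = 0) :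
    ∃ T : ℝ → ℝ, (∀ u v, a ≤ u → u < v → v ≤ b →
      Tendsto (fun m => sumRC F h (lam m) u v) atTop (𝓝 (T v - T u))) ∧
      IsRightPrim a b F h W T := by
  obtain ⟨hF, hh⟩ := And.intro H.1 H.2.1
  have hadd : AsympAdditive atTop (fun m => sumRC F h (lam m)) a b := by
    refine asympAdditive_intervalSum hlam (Ψ := fun x y => F y * (h y - h x)) (by simp) ?_
    intro t ht hnot
    have h1 := hF.tendsto_right ⟨ht.1.le, ht.2⟩
    have h2 := tendsto_sub_left (hh.tendsto_left ⟨ht.1, ht.2.le⟩)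
    rw [hacc t ht hnot] at h2
    have := ((h1.sub_const (F t)).comp (tendsto_snd (f := 𝓝[<] t) (g := 𝓝[>] t))).mul
      (h2.comp tendsto_fst)
    rw [mul_zero] at this
    refine this.congr fun q => ?_
    simp only [comp_apply]
    ring
  have hl : ∀ ε > 0, ∀ t ∈ Ioc a b, ∀ᶠ s in 𝓝[<] t,
      AsympWithin atTop (fun m => sumRC F h (lam m)) s t
        (F t * jumpL h t + leftLim F t * (leftLim h t - h s)) (ε * (W t - W s)) := by
    intro ε hε t ht
    filter_upwards [H.chain_left ht hε, mem_Ico_of_nhdsLT ht] with s hs hst η hη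
    have h0 := tendsto_mul_sub_zero (c := F t - leftLim F t) (hh.tendsto_left ht) hη
    obtain ⟨d, hd, h0⟩ := mem_nhdsLT_iff_exists_Ioo_subset.1 h0
    filter_upwards [hlam.eventually_meets (hst.1.le.trans (le_max_right d s)) (max_lt hd hst.2)
      ht.2] with m hm
    obtain ⟨k, hk, hk'⟩ := hm
    obtain ⟨j, hj, h1, h2, h3⟩ := hs _ _ (lam m).chainR hst.1.le ht.2
    have hxk : clamp s t ((lam m).x k) < t :=
      (clamp_le_of_le ((le_max_right _ _).trans hk'.1.le) le_rfl).trans_lt hk'.2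
    have hjk : k ≤ j := by
      by_contra hjk
      have := h2 (k - 1) (by omega) (show k - 1 < (lam m).n by omega)
      simp only [Part.chainR, show k - 1 + 1 = k by omega] at this
      exact hxk.ne this
    -- With right tags, `x j` is itself the tag of the preceding interval, hence strictly before
    -- `t`; for `j = 0` it is the left end.
    have e1 : clamp s t ((lam m).chainR.x j) < t := by
      rcases Nat.eq_zero_or_pos j with rfl | hj0
      · rw [(lam m).chainR.left, clamp_of_le hst.1.le]; exact hst.2
      · have := h1 (j - 1) (by omega)
        simp only [Part.chainR, show j - 1 + 1 = j by omega] at this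
        exact this
    have e2 : d < clamp s t ((lam m).chainR.x j) :=
      ((le_max_left _ _).trans_lt hk'.1).trans_le
        (le_clamp_of_le hk'.2.le ((lam m).monotoneOn hk hj hjk))
    have h4 := h0 ⟨e2, e1⟩
    simp only [mem_ofPred_eq] at h4
    have e3 : sumRC F h (lam m) s t = (lam m).chainR.sum F h s t := rfl
    simp only [e3, jumpL]
    rw [abs_le] at h3 h4 ⊢
    constructor <;> linarith
  have hr : ∀ ε > 0, ∀ t ∈ Ico a b, ∀ᶠ s in 𝓝[>] t,
      AsympWithin atTop (fun m => sumRC F h (lam m)) t s (rightLim F t * (h s - h t))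
        (ε * (W s - W t)) := by
    intro ε hε t ht
    filter_upwards [H.chain_right ht hε, mem_Ioc_of_nhdsGT ht] with s hs hst η hη
    refine .of_forall fun m => ?_
    obtain ⟨j, hj, h1, h2, h3⟩ := hs _ _ (lam m).chainR ht.1 hst.2.le
    have e : clamp t s ((lam m).chainR.x j) = t := by
      rcases Nat.eq_zero_or_pos j with rfl | hj0
      · rw [(lam m).chainR.left, clamp_of_le ht.1]
      · have := h1 (j - 1) (by omega)
        simp only [Part.chainR, show j - 1 + 1 = j by omega] at this
        exact this
    rw [e, sub_self, mul_zero, add_zero] at h3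
    exact h3.trans (by linarith)
  obtain ⟨T, hT⟩ := exists_tendsto_of_local H.monotone hadd
    (fun ε hε t ht => (hl ε hε t ht).mono fun s hs => ⟨_, hs⟩)
    (fun ε hε t ht => (hr ε hε t ht).mono fun s hs => ⟨_, hs⟩)
  refine ⟨T, hT, fun ε hε t ht => ?_, fun ε hε t ht => ?_⟩
  · filter_upwards [hl ε hε t ht, mem_Ico_of_nhdsLT ht] with s hs hst
    exact abs_sub_le_of_asympWithin hs (hT s t hst.1.le hst.2 ht.2)
  · filter_upwards [hr ε hε t ht, mem_Ioc_of_nhdsGT ht] with s hs hst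
    exact abs_sub_le_of_asympWithin hs (hT t s ht.1 hst.1 hst.2.le)

end Primitives

/-! ### Refinement and mesh limits as filters on tagged chains -/

section ChainFilters

variable {u v : ℝ} {F h : ℝ → ℝ}

/-- Tagged chains under refinement. -/
def refineFilter (u v : ℝ) : Filter (TChain u v) where
  sets := {S | ∃ K : Finset ℝ, ∀ κ : TChain u v,
    (∀ z ∈ K, z ∈ Icc u v → ∃ k ≤ κ.n, κ.x k = z) → κ ∈ S}
  univ_sets := ⟨∅, fun _ _ => mem_univ _⟩
  sets_of_superset := fun ⟨K, hK⟩ h => ⟨K, fun κ hκ => h (hK κ hκ)⟩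
  inter_sets := by
    classical
    rintro S S' ⟨K, hK⟩ ⟨K', hK'⟩
    exact ⟨K ∪ K', fun κ hκ => ⟨hK κ fun z hz => hκ z (Finset.mem_union_left _ hz),
      hK' κ fun z hz => hκ z (Finset.mem_union_right _ hz)⟩⟩

/-- Tagged chains with mesh tending to zero. -/
def meshFilter (u v : ℝ) : Filter (TChain u v) where
  sets := {S | ∃ δ > 0, ∀ κ : TChain u v, (∀ i < κ.n, κ.x (i + 1) - κ.x i < δ) → κ ∈ S}
  univ_sets := ⟨1, one_pos, fun _ _ => mem_univ _⟩
  sets_of_superset := fun ⟨δ, hδ, hS⟩ h => ⟨δ, hδ, fun κ hκ => h (hS κ hκ)⟩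
  inter_sets := by
    rintro S S' ⟨δ, hδ, hS⟩ ⟨δ', hδ', hS'⟩
    exact ⟨min δ δ', lt_min hδ hδ', fun κ hκ =>
      ⟨hS κ fun i hi => (hκ i hi).trans_le (min_le_left _ _),
      hS' κ fun i hi => (hκ i hi).trans_le (min_le_right _ _)⟩⟩

theorem eventually_refineFilter {z : ℝ} (hz : z ∈ Icc u v) :
    ∀ᶠ κ : TChain u v in refineFilter u v, ∃ k ≤ κ.n, κ.x k = z :=
  ⟨{z}, fun _ hκ => hκ z (Finset.mem_singleton_self z) hz⟩

theorem eventually_meshFilter {δ : ℝ} (hδ : 0 < δ) :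
    ∀ᶠ κ : TChain u v in meshFilter u v, ∀ i < κ.n, κ.x (i + 1) - κ.x i < δ :=
  ⟨δ, hδ, fun _ hκ => hκ⟩

theorem TChain.sum_sub_sub (κ : TChain u v) (F h : ℝ → ℝ) {s t r : ℝ} (hst : s ≤ t)
    (htr : t ≤ r) :
    κ.sum F h s r - κ.sum F h s t - κ.sum F h t r = 0 ∨
      ∃ i < κ.n, κ.x i < t ∧ t < κ.x (i + 1) ∧
        κ.sum F h s r - κ.sum F h s t - κ.sum F h t r =
          F (clamp s r (κ.y i)) * (h (clamp t r (κ.x (i + 1))) - h (clamp s t (κ.x i))) -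
          F (clamp s t (κ.y i)) * (h t - h (clamp s t (κ.x i))) -
          F (clamp t r (κ.y i)) * (h (clamp t r (κ.x (i + 1))) - h t) := by
  have hsum : κ.sum F h s r - κ.sum F h s t - κ.sum F h t r = ∑ i ∈ Finset.range κ.n,
      (F (clamp s r (κ.y i)) * (h (clamp s r (κ.x (i + 1))) - h (clamp s r (κ.x i))) -
        F (clamp s t (κ.y i)) * (h (clamp s t (κ.x (i + 1))) - h (clamp s t (κ.x i))) -
        F (clamp t r (κ.y i)) * (h (clamp t r (κ.x (i + 1))) - h (clamp t r (κ.x i)))) := by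
    simp only [TChain.sum, Finset.sum_sub_distrib]
  rw [hsum]
  refine (sum_eq_zero_or_straddle (t := t) κ.mono fun i hi hx => ?_).imp id ?_
  · obtain ⟨g1, g2⟩ := κ.tag i hi
    rcases hx with hx | hx
    · obtain ⟨e1, e2⟩ := clamp_lower (s := s) htr hx
      obtain ⟨e3, e4⟩ := clamp_lower (s := s) htr (g2.trans hx)
      obtain ⟨e5, e6⟩ := clamp_lower (s := s) htr (g1.trans (g2.trans hx))
      rw [e1, e2, e3, e4, e5, e6]; ring
    · obtain ⟨e1, e2⟩ := clamp_upper hst htr hx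
      obtain ⟨e3, e4⟩ := clamp_upper hst htr (hx.trans g1)
      obtain ⟨e5, e6⟩ := clamp_upper hst htr (hx.trans (g1.trans g2))
      rw [e1, e2, e3, e4, e5, e6]; ring
  · rintro ⟨i, hi, h1, h2, h3⟩
    obtain ⟨e1, e2⟩ := clamp_lower (s := s) htr h1.le
    obtain ⟨e3, e4⟩ := clamp_upper hst htr h2.le
    exact ⟨i, hi, h1, h2, by rw [h3, e1, e2, e3, e4]⟩

/-- Once `t` belongs to the chain no interval straddles it, so the sums are exactly additive; no
continuity is needed. -/
theorem asympAdditive_refine (F h : ℝ → ℝ) :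
    AsympAdditive (refineFilter u v) (fun κ => κ.sum F h) u v := by
  intro s t r hs hst htr hr
  refine tendsto_const_nhds.congr' ?_
  filter_upwards [eventually_refineFilter (u := u) (v := v)
    ⟨hs.trans hst.le, htr.le.trans hr⟩] with κ hκ
  obtain ⟨k, hk, rfl⟩ := hκ
  rcases κ.sum_sub_sub F h hst.le htr.le with h | ⟨i, hi, h1, h2, -⟩
  · exact h.symm
  · exact absurd ⟨h1, h2⟩ (not_straddle κ.mono hi hk)

theorem exists_part_of_finset (huv : u < v) (K : Finset ℝ) :
    ∃ κ : Part u v, ∀ z ∈ K, z ∈ Icc u v → z ∈ κ.pts := by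
  classical
  set K' : Finset ℝ := insert u (insert v (K.filter fun z => z ∈ Icc u v)) with hK'
  have hu : u ∈ K' := by simp [hK']
  have hv : v ∈ K' := by simp [hK']
  have hmem : ∀ z ∈ K', z ∈ Icc u v := by
    intro z hz
    simp only [hK', Finset.mem_insert, Finset.mem_filter] at hz
    rcases hz with rfl | rfl | hz
    · exact ⟨le_rfl, huv.le⟩
    · exact ⟨huv.le, le_rfl⟩
    · exact hz.2
  have hpos : 0 < K'.card := Finset.card_pos.2 ⟨u, hu⟩
  set e := K'.orderEmbOfFin rfl with he
  have surj : ∀ z ∈ K', ∃ i : Fin K'.card, e i = z := fun z hz => by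
    have : z ∈ Set.range e := by rw [Finset.range_orderEmbOfFin]; exact hz
    exact this
  set x : ℕ → ℝ := fun i => if hi : i < K'.card then e ⟨i, hi⟩ else v with hx
  have hxi : ∀ i (hi : i < K'.card), x i = e ⟨i, hi⟩ := fun i hi => dif_pos hi
  refine ⟨⟨K'.card - 1, x, ?_, ?_, ?_⟩, ?_⟩
  · intro i hi j hj hij
    simp only [mem_Iic] at hi hj
    rw [hxi i (by omega), hxi j (by omega)]
    exact e.strictMono hij
  · rw [hxi 0 hpos]
    obtain ⟨i, hi⟩ := surj u hu
    refine le_antisymm ?_ (hmem _ (Finset.orderEmbOfFin_mem _ _ _)).1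
    rw [← hi]
    exact e.monotone (Fin.mk_le_of_le_val (Nat.zero_le _))
  · rw [hxi _ (by omega)]
    obtain ⟨i, hi⟩ := surj v hv
    refine le_antisymm (hmem _ (Finset.orderEmbOfFin_mem _ _ _)).2 ?_
    nth_rewrite 1 [← hi]
    refine e.monotone (Fin.le_def.2 ?_)
    have := i.2
    simp only
    omega
  · intro z hz hz'
    obtain ⟨i, rfl⟩ := surj z (by simp only [hK', Finset.mem_insert, Finset.mem_filter]; tauto)
    refine ⟨i, ?_, hxi i i.2⟩
    have := i.2
    simp only [mem_Iic]
    omega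

/-- A tagged partition as a tagged chain. -/
def Part.chain (κ : Part u v) {y : ℕ → ℝ} (hy : IsTagging κ y) : TChain u v where
  n := κ.n
  x := κ.x
  y := y
  mono := κ.monotoneOn
  left := κ.left
  right := κ.right
  tag := hy

theorem Part.mem_Icc (κ : Part u v) {i : ℕ} (hi : i ≤ κ.n) : κ.x i ∈ Icc u v :=
  ⟨κ.left.ge.trans (κ.monotoneOn (Nat.zero_le κ.n) hi (Nat.zero_le i)),
    (κ.monotoneOn hi (le_refl κ.n) hi).trans κ.right.le⟩

theorem Part.chain_sum (κ : Part u v) {y : ℕ → ℝ} (hy : IsTagging κ y) :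
    (κ.chain hy).sum F h u v = sumRS F h κ y := by
  refine Finset.sum_congr rfl fun i hi => ?_
  have hi : i < κ.n := Finset.mem_range.1 hi
  have h1 := κ.mem_Icc hi.le
  have h2 := κ.mem_Icc (i := i + 1) hi
  have h3 := hy i hi
  simp only [Part.chain]
  rw [clamp_of_mem h1, clamp_of_mem h2, clamp_of_mem ⟨h1.1.trans h3.1, h3.2.trans h2.2⟩]

theorem hasRRS_of_tendsto (huv : u < v) {I : ℝ}
    (H : Tendsto (fun κ : TChain u v => κ.sum F h u v) (refineFilter u v) (𝓝 I)) :
    HasRRS F h u v I := by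
  intro ε hε
  obtain ⟨K, hK⟩ := Metric.tendsto_nhds.1 H ε hε
  obtain ⟨κ₀, hκ₀⟩ := exists_part_of_finset huv K
  refine ⟨κ₀, fun κ y hy hκ => ?_⟩
  have := hK (κ.chain hy) fun z hz hz' => by
    obtain ⟨k, hk, hk'⟩ := hκ (hκ₀ z hz hz')
    exact ⟨k, hk, hk'⟩
  rw [← κ.chain_sum hy]
  exact this

theorem hasRS_of_tendsto {I : ℝ}
    (H : Tendsto (fun κ : TChain u v => κ.sum F h u v) (meshFilter u v) (𝓝 I)) :
    HasRS F h u v I := by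
  intro ε hε
  obtain ⟨δ, hδ, hS⟩ := Metric.tendsto_nhds.1 H ε hε
  refine ⟨δ, hδ, fun κ y hy hκ => ?_⟩
  rw [← κ.chain_sum hy]
  exact hS (κ.chain hy) hκ

end ChainFilters

/-! ### Riemann-Stieltjes integrals against continuous integrators -/

section RiemannStieltjes

variable {a b : ℝ} {F h W T : ℝ → ℝ}

theorem abs_le_of_isRegulated (hab : a ≤ b) (hF : IsRegulated a b F) :
    ∃ M, ∀ x ∈ Icc a b, |F x| ≤ M := by
  rcases hab.eq_or_lt with rfl | hab
  · exact ⟨|F a|, fun x hx => by rw [le_antisymm hx.2 hx.1]⟩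
  refine interval_induction (P := fun u v => ∃ M, ∀ x ∈ Icc u v, |F x| ≤ M) ?_ ?_ ?_ le_rfl hab
    le_rfl
  · rintro u t v _ _ _ _ ⟨M, hM⟩ ⟨N, hN⟩
    refine ⟨max M N, fun x hx => ?_⟩
    rcases le_total x t with h | h
    · exact (hM x ⟨hx.1, h⟩).trans (le_max_left _ _)
    · exact (hN x ⟨h, hx.2⟩).trans (le_max_right _ _)
  · intro t ht
    have := (hF.tendsto_left ht).abs.eventually (Iic_mem_nhds (lt_add_one _))
    filter_upwards [eventually_Ico_of_nhdsLT this] with s hs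
    refine ⟨max (|leftLim F t| + 1) |F t|, fun x hx => ?_⟩
    rcases hx.2.lt_or_eq with h | rfl
    · exact (hs x ⟨hx.1, h⟩).trans (le_max_left _ _)
    · exact le_max_right _ _
  · intro t ht
    have := (hF.tendsto_right ht).abs.eventually (Iic_mem_nhds (lt_add_one _))
    filter_upwards [eventually_Ioc_of_nhdsGT this] with s hs
    refine ⟨max (|rightLim F t| + 1) |F t|, fun x hx => ?_⟩
    rcases hx.1.lt_or_eq with h | rfl
    · exact (hs x ⟨h, hx.2⟩).trans (le_max_left _ _)
    · exact le_max_right _ _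

theorem clamp_dist_le {s t x y : ℝ} (hxy : x ≤ y) : clamp s t y - clamp s t x ≤ y - x := by
  unfold clamp
  rcases le_total s (min t x) with h1 | h1 <;> rcases le_total s (min t y) with h2 | h2 <;>
    rcases le_total t x with h3 | h3 <;> rcases le_total t y with h4 | h4 <;>
    simp_all <;> linarith

/-- The Riemann-Stieltjes integral against a continuous function exists. -/
theorem IsLeftPrim.hasRS (H : IsLeftPrim a b F h W T) (HY : IsYoung a b F h W)
    (hc : ContinuousOn h (Icc a b)) {u v : ℝ} (hu : a ≤ u) (huv : u < v) (hv : v ≤ b) :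
    HasRS F h u v (T v - T u) := by
  obtain ⟨M, hM⟩ := abs_le_of_isRegulated (hu.trans (huv.le.trans hv)) HY.1
  have hM0 : 0 ≤ M := (abs_nonneg _).trans (hM a ⟨le_rfl, hu.trans (huv.le.trans hv)⟩)
  have huc := (isCompact_Icc.uniformContinuousOn_of_continuous hc)
  rw [Metric.uniformContinuousOn_iff] at huc
  have cl : ∀ t ∈ Ioc a b, leftLim h t = h t := fun t ht => leftLim_eq
    ((hc t ⟨ht.1.le, ht.2⟩).mono_of_mem_nhdsWithin (mem_of_superset (Ioo_mem_nhdsLT ht.1)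
      fun x hx => ⟨hx.1.le, hx.2.le.trans ht.2⟩))
  have cr : ∀ t ∈ Ico a b, rightLim h t = h t := fun t ht => rightLim_eq
    ((hc t ⟨ht.1, ht.2.le⟩).mono_of_mem_nhdsWithin (mem_of_superset (Ioo_mem_nhdsGT ht.2)
      fun x hx => ⟨ht.1.trans hx.1.le, hx.2.le⟩))
  refine hasRS_of_tendsto (tendsto_of_local (a := u) (b := v) (W := fun x => W x)
    (S := fun κ : TChain u v => κ.sum F h) HY.monotone ?_ T ?_ ?_ le_rfl huv le_rfl)
  · intro s t r hs hst htr hr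
    rw [Metric.tendsto_nhds]
    intro ε hε
    -- Under the mesh limit an interval may contain `t` in its interior, but uniform continuity
    -- makes the increments of h over it small while F is bounded by `M`; the 4 accounts for two
    -- products with oscillation at most `2 * M`.
    obtain ⟨δ, hδ, hδ'⟩ := huc (ε / (4 * (M + 1))) (by positivity)
    filter_upwards [eventually_meshFilter hδ] with κ hκ
    rw [Real.dist_eq, sub_zero]
    rcases κ.sum_sub_sub F h hst.le htr.le with h0 | ⟨i, hi, h1, h2, h3⟩
    · rw [h0, abs_zero]; exact hε
    · have b1 := clamp_mem (s := s) hst.le (κ.x i)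
      have b2 := clamp_mem (s := t) htr.le (κ.x (i + 1))
      have d1 : |h t - h (clamp s t (κ.x i))| < ε / (4 * (M + 1)) := by
        refine hδ' t ⟨by linarith, by linarith⟩ _ ⟨by linarith [b1.1], by linarith [b1.2]⟩ ?_
        rw [Real.dist_eq, abs_of_nonneg (by linarith [b1.2])]
        have := le_clamp_of_le (s := s) (t := t) h1.le (le_refl (κ.x i))
        linarith [hκ i hi]
      have d2 : |h (clamp t r (κ.x (i + 1))) - h t| < ε / (4 * (M + 1)) := by
        refine hδ' _ ⟨by linarith [b2.1], by linarith [b2.2]⟩ t ⟨by linarith, by linarith⟩ ?_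
        rw [Real.dist_eq, abs_of_nonneg (by linarith [b2.1])]
        have := clamp_le_of_le (s := t) (t := r) h2.le (le_refl (κ.x (i + 1)))
        linarith [hκ i hi]
      have m1 := hM (clamp s r (κ.y i)) (Icc_subset_Icc (hu.trans hs) (hr.trans hv)
        (clamp_mem (hst.le.trans htr.le) _))
      have m2 := hM (clamp s t (κ.y i)) (Icc_subset_Icc (hu.trans hs) (by linarith)
        (clamp_mem hst.le _))
      have m3 := hM (clamp t r (κ.y i)) (Icc_subset_Icc (by linarith) (hr.trans hv)
        (clamp_mem htr.le _))
      rw [h3]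
      set A := h t - h (clamp s t (κ.x i))
      set B := h (clamp t r (κ.x (i + 1))) - h t
      set c := ε / (4 * (M + 1)) with hc'
      have hcM : (M + 1) * c = ε / 4 := by rw [hc']; field_simp
      have e1 : |(F (clamp s r (κ.y i)) - F (clamp s t (κ.y i))) * A| ≤ 2 * M * c := by
        rw [abs_mul]
        exact mul_le_mul ((abs_sub _ _).trans (by linarith)) d1.le (abs_nonneg _) (by positivity)
      have e2 : |(F (clamp s r (κ.y i)) - F (clamp t r (κ.y i))) * B| ≤ 2 * M * c := by
        rw [abs_mul]
        exact mul_le_mul ((abs_sub _ _).trans (by linarith)) d2.le (abs_nonneg _) (by positivity)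
      have hc0 : 0 < c := by positivity
      have : F (clamp s r (κ.y i)) * (h (clamp t r (κ.x (i + 1))) - h (clamp s t (κ.x i))) -
          F (clamp s t (κ.y i)) * A - F (clamp t r (κ.y i)) * B =
          (F (clamp s r (κ.y i)) - F (clamp s t (κ.y i))) * A +
          (F (clamp s r (κ.y i)) - F (clamp t r (κ.y i))) * B := by simp only [A, B]; ring
      rw [this]
      refine (abs_add_le _ _).trans_lt ?_
      nlinarith
  · intro ε hε t ht
    have ht' : t ∈ Ioc a b := ⟨hu.trans_lt ht.1, ht.2.trans hv⟩
    filter_upwards [HY.chain_left ht' (half_pos hε), H.1 (ε / 2) (half_pos hε) t ht',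
      mem_Ico_of_nhdsLT ht] with s hs hT hst η hη
    obtain ⟨δ, hδ, hδ'⟩ := huc (η / (2 * M + 1)) (by positivity)
    filter_upwards [eventually_meshFilter hδ] with κ hκ
    obtain ⟨j, hj, h1, h2, h3⟩ := hs _ _ κ hst.1.le ht.2
    have b1 := clamp_mem (s := s) hst.2.le (κ.x j)
    have d1 : |h t - h (clamp s t (κ.x j))| ≤ η / (2 * M + 1) := by
      refine (hδ' t ⟨ht'.1.le, ht'.2⟩ _ ⟨by linarith [b1.1, hst.1], by linarith [b1.2, ht'.2]⟩ ?_).le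
      rw [Real.dist_eq, abs_of_nonneg (by linarith [b1.2])]
      rcases hj.lt_or_eq with hj | rfl
      · have g1 := h2 j le_rfl hj
        have g2 := κ.tag j hj
        have g3 : clamp s t (κ.x (j + 1)) = t := le_antisymm (clamp_mem hst.2.le _).2
          (g1.ge.trans (clamp_mono s t g2.2))
        have := clamp_dist_le (s := s) (t := t) (g2.1.trans g2.2)
        linarith [hκ j hj]
      · rw [κ.right, clamp_of_ge hst.2.le ht.2]; linarith
    have m1 : |F t - leftLim F t| ≤ 2 * M := by
      have : |leftLim F t| ≤ M := le_of_tendsto (HY.1.tendsto_left ht').abs (by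
        filter_upwards [mem_Ico_of_nhdsLT ht'] with x hx using hM x ⟨hx.1.le, hx.2.le.trans ht'.2⟩)
      exact (abs_sub _ _).trans (by linarith [hM t ⟨ht'.1.le, ht'.2⟩])
    -- Tags falling at `t` cannot matter: their block starts within one mesh of `t`, where h has
    -- moved little.
    have e1 : |(F t - leftLim F t) * (h t - h (clamp s t (κ.x j)))| ≤ η := by
      rw [abs_mul]
      have hpos : 0 < 2 * M + 1 := by positivity
      calc _ ≤ 2 * M * (η / (2 * M + 1)) := mul_le_mul m1 d1 (abs_nonneg _) (by positivity)
        _ ≤ (2 * M + 1) * (η / (2 * M + 1)) := by gcongr; linarith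
        _ = η := by field_simp
    rw [abs_le] at *
    constructor <;> linarith
  · intro ε hε t ht
    have ht' : t ∈ Ico a b := ⟨hu.trans ht.1, ht.2.trans_le hv⟩
    filter_upwards [HY.chain_right ht' (half_pos hε), H.2 (ε / 2) (half_pos hε) t ht',
      mem_Ioc_of_nhdsGT ht] with s hs hT hst η hη
    obtain ⟨δ, hδ, hδ'⟩ := huc (η / (2 * M + 1)) (by positivity)
    filter_upwards [eventually_meshFilter hδ] with κ hκ
    obtain ⟨j, hj, h1, h2, h3⟩ := hs _ _ κ ht.1 hst.2.le
    have b1 := clamp_mem (s := t) hst.1.le (κ.x j)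
    have d1 : |h (clamp t s (κ.x j)) - h t| ≤ η / (2 * M + 1) := by
      refine (hδ' _ ⟨by linarith [b1.1, ht'.1], by linarith [b1.2, hst.2]⟩ t
        ⟨ht'.1, ht'.2.le⟩ ?_).le
      rw [Real.dist_eq, abs_of_nonneg (by linarith [b1.1])]
      rcases Nat.eq_zero_or_pos j with rfl | hj0
      · rw [κ.left, clamp_of_le ht.1]; linarith
      · have g1 := h1 (j - 1) (by omega)
        have g2 := κ.tag (j - 1) (by omega)
        have g3 : clamp t s (κ.x (j - 1)) = t := le_antisymm
          ((clamp_mono t s g2.1).trans g1.le) (clamp_mem hst.1.le _).1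
        have := clamp_dist_le (s := t) (t := s) (g2.1.trans g2.2)
        have g4 := hκ (j - 1) (by omega)
        rw [show j - 1 + 1 = j by omega] at this g4
        linarith
    have m1 : |F t - rightLim F t| ≤ 2 * M := by
      have : |rightLim F t| ≤ M := le_of_tendsto (HY.1.tendsto_right ht').abs (by
        filter_upwards [mem_Ioc_of_nhdsGT ht'] with x hx using hM x ⟨ht'.1.trans hx.1.le, hx.2.le⟩)
      exact (abs_sub _ _).trans (by linarith [hM t ⟨ht'.1, ht'.2.le⟩])
    have e1 : |(F t - rightLim F t) * (h (clamp t s (κ.x j)) - h t)| ≤ η := by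
      rw [abs_mul]
      have hpos : 0 < 2 * M + 1 := by positivity
      calc _ ≤ 2 * M * (η / (2 * M + 1)) := mul_le_mul m1 d1 (abs_nonneg _) (by positivity)
        _ ≤ (2 * M + 1) * (η / (2 * M + 1)) := by gcongr; linarith
        _ = η := by field_simp
    rw [jumpR, cr t ht', sub_self, mul_zero, zero_add] at hT
    rw [abs_le] at *
    constructor <;> linarith

end RiemannStieltjes

/-! ### Identification with the Left and Right Young integrals -/

section YoungIntegral

variable {a b : ℝ} {F h W T : ℝ → ℝ}

theorem tendsto_rightLim_of_le {P : ℝ → ℝ} {A c d s ε : ℝ} (hW : Monotone W)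
    (hP : Tendsto P (𝓝[>] s) (𝓝 A))
    (h : ∀ᶠ r in 𝓝[>] s, |c * P r| ≤ ε * (W r - d)) : |c * A| ≤ ε * (rightLim W s - d) :=
  le_of_tendsto_of_tendsto (hP.const_mul c).abs
    (((hW.tendsto_rightLim s).sub_const d).const_mul ε) h

/-- Passing to left limits collects both jumps of `W` into a right jump. Mixed products of a left
and a right jump can thus be treated as right jumps dominated by `leftLim W`. -/
theorem jumpR_leftLim (hW : Monotone W) (r : ℝ) :
    jumpR (leftLim W) r = jumpL W r + jumpR W r := by
  have : rightLim (leftLim W) r = rightLim W r := rightLim_leftLim (hW.tendsto_rightLim r)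
  simp only [jumpR, jumpL, this]
  ring

theorem jumpL_rightLim (hW : Monotone W) (r : ℝ) :
    jumpL (rightLim W) r = jumpL W r + jumpR W r := by
  have : leftLim (rightLim W) r = leftLim W r := leftLim_rightLim (hW.tendsto_leftLim r)
  simp only [jumpR, jumpL, this]
  ring

/-- The refinement sums for the modified pair `(G, Hh)` have as indefinite integral the given one
plus explicit corrections. Here `G` is left-continuous beyond `u` and `Hh` right-continuous before
`v`, so F and h never jump on the same side and tags at `t` have no effect in the limit. -/
theorem IsLeftPrim.hasLY (H : IsLeftPrim a b F h W T) (HY : IsYoung a b F h W) {u v : ℝ}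
    (hu : a ≤ u) (huv : u < v) (hv : v ≤ b) : HasLY F h u v (T v - T u) := by
  have hF := HY.1
  have hh := HY.2.1
  have hW := HY.monotone
  set G := leftMod u F with hG
  set Hh := rightMod v h with hHh
  have hGr : IsRegulated u v G := isRegulated_leftMod hF hu hv
  have hHr : IsRegulated u v Hh := isRegulated_rightMod hh hu hv
  obtain ⟨W1, Y1⟩ := HY.modify hGr hHr
    (fun q WF hq hF HF => ⟨_, HF.leftMod hq hF hu hv⟩)
    (fun p Wh hp hh Hh => ⟨_, Hh.rightMod hp hh hu hv⟩)
  obtain ⟨W3, Y3⟩ := HY.modify hGr (hh.mono hu hv)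
    (fun q WF hq hF HF => ⟨_, HF.leftMod hq hF hu hv⟩)
    (fun p Wh hp hh Hh => ⟨_, Hh.mono hu hv⟩)
  have hW1 := Y1.monotone
  have hW3 := Y3.monotone
  have hWl : Monotone (leftLim W) := hW.leftLim
  have hWr : Monotone (rightMod v W3) := monotone_rightMod hW3 v
  set D : ℝ → ℝ := fun x => Hh x - h x with hD
  have D_lt : ∀ x, x < v → D x = jumpR h x := fun x hx => by
    simp only [hD, hHh, rightMod_of_lt hx, jumpR]
  have D_v : D v = 0 := by simp only [hD, hHh, rightMod_self, sub_self]
  have G_lt : ∀ x, u < x → G x = leftLim F x := fun x hx => leftMod_of_lt hx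
  have G_u : G u = F u := leftMod_self u F
  set c : ℝ → ℝ := fun r => (F r - G r) * D r with hc
  have c_eq : ∀ r ∈ Ioo u v, c r = jumpL F r * jumpR h r := fun r hr => by
    simp only [hc, G_lt r hr.1, D_lt r hr.2, jumpL]
  have dom : ∀ ε r, r ∈ Ioo u v → 0 < ε →
      |jumpL F r * jumpR h r| ≤ ε * (jumpL W r + jumpR W r) →
      DomJump ε (fun _ => 0) c (leftLim W) r := fun ε r hr hε h1 =>
    ⟨by simpa using mul_nonneg hε.le (hWl.jumpL_nonneg r),
      by rw [c_eq r hr, jumpR_leftLim hW]; exact h1⟩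
  have memL : ∀ t ∈ Ioc u v, t ∈ Ioc a b := fun t ht => ⟨hu.trans_lt ht.1, ht.2.trans hv⟩
  have memR : ∀ t ∈ Ico u v, t ∈ Ico a b := fun t ht => ⟨hu.trans ht.1, ht.2.trans_le hv⟩
  have domL : ∀ ε > 0, ∀ t ∈ Ioc u v, ∀ᶠ r in 𝓝[<] t, DomJump ε (fun _ => 0) c (leftLim W) r := by
    intro ε hε t ht
    filter_upwards [HY.jumps_left (memL t ht) hε, mem_Ico_of_nhdsLT ht] with r hr hrt
    exact dom ε r ⟨hrt.1, hrt.2.trans_le ht.2⟩ hε hr.1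
  have domR : ∀ ε > 0, ∀ t ∈ Ico u v, ∀ᶠ r in 𝓝[>] t, DomJump ε (fun _ => 0) c (leftLim W) r := by
    intro ε hε t ht
    filter_upwards [HY.jumps_right (memR t ht) hε, mem_Ioc_of_nhdsGT ht] with r hr hrt
    exact dom ε r ⟨ht.1.trans_lt hrt.1, hrt.2⟩ hε hr.1
  have loc : LocDomJump u v (fun _ => 0) c (leftLim W) :=
    ⟨fun t ht => ⟨1, domL 1 one_pos t ht⟩, fun t ht => ⟨1, domR 1 one_pos t ht⟩⟩
  set J := jumpSum u (fun _ => 0) c with hJ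
  -- `D` vanishes except at right jumps of h and at `v`, where it is zero. The product `G * D`
  -- accounts for changing the integrator, and `J` collects the products of the left jumps of F with
  -- the right jumps of h. At the ends `D v = 0` and `G u * D u = F u * jumpR h u`, the boundary
  -- term of the Young integral.
  set Q : ℝ → ℝ := fun x => T x + G x * D x - J x with hQ
  -- One control per source of error: `W1` for `(G, Hh)`, `W` for `(F, h)`, its left limits for the
  -- jump sum, and `W3` with its right limits for `(G, h)`.
  set W2 : ℝ → ℝ := fun x => W1 x + W x + leftLim W x + W3 x + rightMod v W3 x with hW2
  have hW2m : Monotone W2 := (((hW1.add hW).add hWl).add hW3).add hWr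
  have key : Tendsto (fun κ : TChain u v => κ.sum G Hh u v) (refineFilter u v)
      (𝓝 (Q v - Q u)) := by
    refine tendsto_of_local (S := fun κ : TChain u v => κ.sum G Hh) hW2m
      (asympAdditive_refine G Hh) Q ?_ ?_ le_rfl huv le_rfl
    · intro ε hε t ht
      have ht' := memL t ht
      filter_upwards [Y1.chain_left ht hε, Y3.left ht hε, H.1 ε hε t ht',
        eventually_Ico_of_nhdsLT (domL ε hε t ht), mem_Ico_of_nhdsLT ht]
        with s h1 h3 hT hd hst η hη
      refine .of_forall fun κ => ?_
      obtain ⟨j, -, -, -, h1⟩ := h1 _ _ κ hst.1.le ht.2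
      have eG : leftLim G t = leftLim F t := leftLim_eq (tendsto_leftMod_left hF hu ⟨ht.1, ht'.2⟩)
      rw [eG, G_lt t ht.1, sub_self, zero_mul, add_zero] at h1
      have hsv : s < v := hst.2.trans_le ht.2
      -- The local Young estimate for the chain with the single interval [s, r] and tag `s`, with
      -- `r` decreasing to `s`, so that the increment of h becomes its right jump.
      have h4 : |(G s - leftLim F t) * D s| ≤ ε * (W3 t - W3 s) := by
        rw [D_lt s hsv]
        refine le_of_tendsto ((tendsto_sub_right (hh.tendsto_right (t := s)
          ⟨hu.trans hst.1.le, hsv.trans_le hv⟩)).const_mul (G s - leftLim F t)).abs ?_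
        filter_upwards [Ioo_mem_nhdsGT hst.2] with r hr
        have := h3 1 (fun i => if i = 0 then s else r) (fun _ => s) ?_ ?_ ?_ ?_
        · simpa [eG] using this
        · intro i _ j _ hij
          simp only
          split_ifs with e1 e2 e2
          · exact le_rfl
          · exact hr.1.le
          · omega
          · exact le_rfl
        · exact monotoneOn_const
        · intro i _
          split_ifs
          · exact ⟨le_rfl, hst.2.le⟩
          · exact ⟨hr.1.le, hr.2.le⟩
        · intro i _
          exact ⟨le_rfl, hst.2⟩
      have h5 := abs_jumpSum_sub_le_left hWl loc hst.1.le hst.2 ht.2 hε.le hd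
      have h6 : leftLim (leftLim W) t ≤ leftLim W t := hWl.leftLim_le le_rfl
      have h7 := mul_le_mul_of_nonneg_left (sub_le_sub_right h6 (leftLim W s)) hε.le
      have h8 := mul_nonneg hε.le (sub_nonneg.2 (hWr hst.2.le))
      have eq : κ.sum G Hh s t - (Q t - Q s) =
          (κ.sum G Hh s t - leftLim F t * (Hh t - Hh s)) -
          (T t - T s - leftLim F t * (h t - h s)) + (J t - J s - 0) +
          (G s - leftLim F t) * D s := by
        simp only [hQ, hD, G_lt t ht.1]
        ring
      simp only
      rw [eq]
      simp only [hW2]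
      rw [abs_le] at h1 hT h4 h5 ⊢
      constructor <;> linarith
    · intro ε hε t ht
      have ht' := memR t ht
      have h3 := Y3.right ht hε
      obtain ⟨e, he, h3⟩ := mem_nhdsGT_iff_exists_Ioo_subset.1 h3
      filter_upwards [Y1.chain_right ht hε, Ioo_mem_nhdsGT he, H.2 ε hε t ht',
        eventually_Ioc_of_nhdsGT (domR ε hε t ht), mem_Ioc_of_nhdsGT ht]
        with s h1 hse hT hd hst η hη
      have hcont : ContinuousWithinAt Hh (Ioi t) t := by
        have := tendsto_rightMod_right hh hv ⟨ht'.1, ht.2⟩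
        rwa [← rightMod_of_lt ht.2] at this
      have hsm := tendsto_mul_sub_zero (c := G t - rightLim F t) hcont hη
      obtain ⟨d, hdt, hsm⟩ := mem_nhdsGT_iff_exists_Ioo_subset.1 hsm
      -- Requiring the point `z` in the chain keeps the block of tags at `t` inside (t, d), where
      -- `Hh` is close to `Hh t` by right continuity.
      set z := (t + min d s) / 2 with hz
      have hmin : t < min d s := lt_min hdt hst.1
      have hz1 : t < z := by rw [hz]; linarith
      have hz2 : z < d := by rw [hz]; linarith [min_le_left d s]
      have hz3 : z < s := by rw [hz]; linarith [min_le_right d s]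
      filter_upwards [eventually_refineFilter (u := u) (v := v)
        ⟨ht.1.trans hz1.le, hz3.le.trans hst.2.le⟩] with κ hκ
      obtain ⟨k, hk, hkz⟩ := hκ
      obtain ⟨j, hj, h1a, -, h1⟩ := h1 _ _ κ ht.1 hst.2.le
      have eG : rightLim G t = rightLim F t :=
        rightLim_eq (tendsto_leftMod_right hF hu ⟨ht.1, ht'.2⟩)
      rw [eG] at h1
      have hjk : j ≤ k := by
        by_contra hjk
        have g1 := h1a k (by omega)
        have g2 := (κ.tag k (by omega)).1
        rw [hkz] at g2
        have := le_clamp_of_le (s := t) hz3.le g2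
        linarith
      have hb : clamp t s (κ.x j) < d := by
        refine (clamp_le_of_le hz1.le ?_).trans_lt hz2
        rw [← hkz]
        exact κ.mono hj hk hjk
      have hsm' : |(G t - rightLim F t) * (Hh (clamp t s (κ.x j)) - Hh t)| ≤ η := by
        rcases (clamp_mem (s := t) hst.1.le (κ.x j)).1.eq_or_lt with e0 | e0
        · rw [← e0, sub_self, mul_zero, abs_zero]; exact hη.le
        · exact hsm ⟨e0, hb⟩
      have h4 : |(G s - rightLim F t) * D s| ≤ ε * (rightMod v W3 s - W3 t) := by
        rw [D_lt s hst.2, rightMod_of_lt hst.2]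
        refine tendsto_rightLim_of_le hW3 (tendsto_sub_right (hh.tendsto_right (t := s)
          ⟨ht'.1.trans hst.1.le, hst.2.trans_le hv⟩)) ?_
        -- The auxiliary interval [s, r] leaves [t, s], so the estimate is used at `r`. Its limit
        -- involves the right limit of `W3` at `s`, which is why that function is part of `W2`.
        filter_upwards [Ioo_mem_nhdsGT hse.2] with r hr
        have := h3 ⟨hst.1.trans hr.1, hr.2⟩ 1 (fun i => if i = 0 then s else r) (fun _ => s)
          ?_ ?_ ?_ ?_
        · simpa [eG] using this
        · intro i _ j _ hij
          simp only
          split_ifs with e1 e2 e2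
          · exact le_rfl
          · exact hr.1.le
          · omega
          · exact le_rfl
        · exact monotoneOn_const
        · intro i _
          split_ifs
          · exact ⟨hst.1.le, hr.1.le⟩
          · exact ⟨(hst.1.trans hr.1).le, le_rfl⟩
        · intro i _
          exact ⟨hst.1, hr.1.le⟩
      have h5 := abs_jumpSum_sub_le_right hWl loc ht.1 hst.1 hst.2.le hε.le hd
      have h6 : leftLim W t ≤ rightLim (leftLim W) t := hWl.le_rightLim le_rfl
      have h7 := mul_le_mul_of_nonneg_left (sub_le_sub_left h6 (leftLim W s)) hε.le
      have h8 : rightMod v W3 t ≤ W3 s := by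
        rw [rightMod_of_lt ht.2]; exact hW3.rightLim_le hst.1
      have h9 := mul_le_mul_of_nonneg_left (sub_le_sub_left h8 (rightMod v W3 s)) hε.le
      have eq : κ.sum G Hh t s - (Q s - Q t) =
          (κ.sum G Hh t s - (rightLim F t * (Hh s - Hh t) +
            (G t - rightLim F t) * (Hh (clamp t s (κ.x j)) - Hh t))) +
          (G t - rightLim F t) * (Hh (clamp t s (κ.x j)) - Hh t) -
          (T s - T t - (F t * jumpR h t + rightLim F t * (h s - rightLim h t))) +
          (J s - J t - c t) - (G s - rightLim F t) * D s := by
        have e1 := D_lt t ht.2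
        have e2 : rightLim h t = h t + D t := by rw [e1, jumpR]; ring
        have e3 : ∀ x, Hh x = h x + D x := fun x => by simp only [hD]; ring
        simp only [hQ, hc, ← e1, e2, e3]
        ring
      rw [eq]
      simp only [hW2]
      rw [abs_le] at h1 hT h4 h5 hsm' ⊢
      constructor <;> linarith
  have hJv : HasSum (fun x : Ioo u v => jumpL F x * jumpR h x) (J v) := by
    have h1 := (loc.summable hWl le_rfl huv.le le_rfl).2
    have e1 : (Ico u v).indicator c = (Ioo u v).indicator fun x => jumpL F x * jumpR h x := by
      ext x
      by_cases hx : x ∈ Ioo u v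
      · rw [indicator_of_mem hx, indicator_of_mem (Ioo_subset_Ico_self hx), c_eq x hx]
      · rw [indicator_of_notMem hx]
        by_cases hx' : x ∈ Ico u v
        · have : x = u := by
            by_contra hne
            exact hx ⟨lt_of_le_of_ne hx'.1 (Ne.symm hne), hx'.2⟩
          rw [indicator_of_mem hx', this]
          simp [hc, G_u]
        · rw [indicator_of_notMem hx']
    have e2 : J v = ∑' x, (Ioo u v).indicator (fun x => jumpL F x * jumpR h x) x := by
      rw [hJ, jumpSum, tsum_zero, zero_add, tsum_subtype, e1]
    rw [e2]
    rw [e1] at h1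
    exact (hasSum_subtype_iff_indicator (f := fun x => jumpL F x * jumpR h x)).2 h1.hasSum
  refine Or.inr ⟨huv, Q v - Q u, J v, hasRRS_of_tendsto huv key, hJv, ?_⟩
  have e1 : J u = 0 := jumpSum_self _ _ _
  simp only [hQ, D_v, D_lt u huv, G_u, e1]
  ring

theorem tendsto_leftLim_of_le {P : ℝ → ℝ} {A c d s ε : ℝ} (hW : Monotone W)
    (hP : Tendsto P (𝓝[<] s) (𝓝 A))
    (h : ∀ᶠ r in 𝓝[<] s, |c * P r| ≤ ε * (d - W r)) : |c * A| ≤ ε * (d - leftLim W s) :=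
  le_of_tendsto_of_tendsto (hP.const_mul c).abs
    (((hW.tendsto_leftLim s).const_sub d).const_mul ε) h

/-- Mirror image of the left case: `G` is right-continuous before `v`, `Hh` left-continuous beyond
`u`, and `D` is minus the left jump of h there, so the jump sum enters with the opposite sign. -/
theorem IsRightPrim.hasRY (H : IsRightPrim a b F h W T) (HY : IsYoung a b F h W) {u v : ℝ}
    (hu : a ≤ u) (huv : u < v) (hv : v ≤ b) : HasRY F h u v (T v - T u) := by
  have hF := HY.1
  have hh := HY.2.1
  have hW := HY.monotone
  set G := rightMod v F with hG
  set Hh := leftMod u h with hHh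
  have hGr : IsRegulated u v G := isRegulated_rightMod hF hu hv
  have hHr : IsRegulated u v Hh := isRegulated_leftMod hh hu hv
  obtain ⟨W1, Y1⟩ := HY.modify hGr hHr
    (fun q WF hq hF HF => ⟨_, HF.rightMod hq hF hu hv⟩)
    (fun p Wh hp hh Hh => ⟨_, Hh.leftMod hp hh hu hv⟩)
  obtain ⟨W3, Y3⟩ := HY.modify hGr (hh.mono hu hv)
    (fun q WF hq hF HF => ⟨_, HF.rightMod hq hF hu hv⟩)
    (fun p Wh hp hh Hh => ⟨_, Hh.mono hu hv⟩)
  have hW1 := Y1.monotone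
  have hW3 := Y3.monotone
  have hWl : Monotone (rightLim W) := hW.rightLim
  have hWr : Monotone (leftMod u W3) := monotone_leftMod hW3 u
  set D : ℝ → ℝ := fun x => Hh x - h x with hD
  have D_lt : ∀ x, u < x → D x = -jumpL h x := fun x hx => by
    simp only [hD, hHh, leftMod_of_lt hx, jumpL, neg_sub]
  have D_u : D u = 0 := by simp only [hD, hHh, leftMod_self, sub_self]
  have G_lt : ∀ x, x < v → G x = rightLim F x := fun x hx => rightMod_of_lt hx
  have G_v : G v = F v := rightMod_self v F
  set c : ℝ → ℝ := fun r => (F r - G r) * D r with hc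
  have c_eq : ∀ r ∈ Ioo u v, c r = jumpR F r * jumpL h r := fun r hr => by
    simp only [hc, G_lt r hr.2, D_lt r hr.1, jumpR]
    ring
  have dom : ∀ ε r, r ∈ Ioo u v → 0 < ε →
      |jumpR F r * jumpL h r| ≤ ε * (jumpL W r + jumpR W r) →
      DomJump ε c (fun _ => 0) (rightLim W) r := fun ε r hr hε h1 =>
    ⟨by rw [c_eq r hr, jumpL_rightLim hW]; exact h1,
      by simpa using mul_nonneg hε.le (hWl.jumpR_nonneg r)⟩
  have memL : ∀ t ∈ Ioc u v, t ∈ Ioc a b := fun t ht => ⟨hu.trans_lt ht.1, ht.2.trans hv⟩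
  have memR : ∀ t ∈ Ico u v, t ∈ Ico a b := fun t ht => ⟨hu.trans ht.1, ht.2.trans_le hv⟩
  have domL : ∀ ε > 0, ∀ t ∈ Ioc u v, ∀ᶠ r in 𝓝[<] t, DomJump ε c (fun _ => 0) (rightLim W) r := by
    intro ε hε t ht
    filter_upwards [HY.jumps_left (memL t ht) hε, mem_Ico_of_nhdsLT ht] with r hr hrt
    exact dom ε r ⟨hrt.1, hrt.2.trans_le ht.2⟩ hε hr.2
  have domR : ∀ ε > 0, ∀ t ∈ Ico u v, ∀ᶠ r in 𝓝[>] t, DomJump ε c (fun _ => 0) (rightLim W) r := by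
    intro ε hε t ht
    filter_upwards [HY.jumps_right (memR t ht) hε, Ioo_mem_nhdsGT ht.2] with r hr hrt
    exact dom ε r ⟨ht.1.trans_lt hrt.1, hrt.2⟩ hε hr.2
  have loc : LocDomJump u v c (fun _ => 0) (rightLim W) :=
    ⟨fun t ht => ⟨1, domL 1 one_pos t ht⟩, fun t ht => ⟨1, domR 1 one_pos t ht⟩⟩
  set J := jumpSum u c (fun _ => 0) with hJ
  set Q : ℝ → ℝ := fun x => T x + G x * D x + J x with hQ
  set W2 : ℝ → ℝ := fun x => W1 x + W x + rightLim W x + W3 x + leftMod u W3 x with hW2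
  have hW2m : Monotone W2 := (((hW1.add hW).add hWl).add hW3).add hWr
  have key : Tendsto (fun κ : TChain u v => κ.sum G Hh u v) (refineFilter u v)
      (𝓝 (Q v - Q u)) := by
    refine tendsto_of_local (S := fun κ : TChain u v => κ.sum G Hh) hW2m
      (asympAdditive_refine G Hh) Q ?_ ?_ le_rfl huv le_rfl
    · intro ε hε t ht
      have ht' := memL t ht
      have h3 := Y3.left ht hε
      obtain ⟨e, he, h3⟩ := mem_nhdsLT_iff_exists_Ioo_subset.1 h3
      filter_upwards [Y1.chain_left ht hε, Ioo_mem_nhdsLT he, H.1 ε hε t ht',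
        eventually_Ico_of_nhdsLT (domL ε hε t ht), mem_Ico_of_nhdsLT ht]
        with s h1 hse hT hd hst η hη
      have hcont : ContinuousWithinAt Hh (Iio t) t := by
        have := tendsto_leftMod_left hh hu ⟨ht.1, ht'.2⟩
        rwa [← leftMod_of_lt ht.1] at this
      have hsm := tendsto_mul_sub_zero (c := G t - leftLim F t) hcont hη
      obtain ⟨d, hdt, hsm⟩ := mem_nhdsLT_iff_exists_Ioo_subset.1 hsm
      set z := (t + max d s) / 2 with hz
      have hmax : max d s < t := max_lt hdt hst.2
      have hz1 : z < t := by rw [hz]; linarith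
      have hz2 : d < z := by rw [hz]; linarith [le_max_left d s]
      have hz3 : s < z := by rw [hz]; linarith [le_max_right d s]
      filter_upwards [eventually_refineFilter (u := u) (v := v)
        ⟨hst.1.le.trans hz3.le, hz1.le.trans ht.2⟩] with κ hκ
      obtain ⟨k, hk, hkz⟩ := hκ
      obtain ⟨j, hj, -, h1a, h1⟩ := h1 _ _ κ hst.1.le ht.2
      have eG : leftLim G t = leftLim F t := leftLim_eq (tendsto_rightMod_left hF hv ⟨ht'.1, ht.2⟩)
      rw [eG] at h1
      have hjk : k ≤ j := by
        by_contra hjk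
        have g1 := h1a j le_rfl (by omega)
        have g2 := (κ.tag j (by omega)).2.trans
          (κ.mono (show j + 1 ≤ _ by omega) hk (show j + 1 ≤ k by omega))
        rw [hkz] at g2
        have := clamp_le_of_le (t := t) hz3.le g2
        linarith
      have hb : d < clamp s t (κ.x j) := by
        refine hz2.trans_le (le_clamp_of_le hz1.le ?_)
        rw [← hkz]
        exact κ.mono hk hj hjk
      have hsm' : |(G t - leftLim F t) * (Hh t - Hh (clamp s t (κ.x j)))| ≤ η := by
        rcases (clamp_mem (s := s) hst.2.le (κ.x j)).2.eq_or_lt with e0 | e0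
        · rw [e0, sub_self, mul_zero, abs_zero]; exact hη.le
        · rw [abs_mul, abs_sub_comm (Hh t), ← abs_mul]
          exact hsm ⟨hb, e0⟩
      have hsv : s < v := hst.2.trans_le ht.2
      have h4 : |(G s - leftLim F t) * D s| ≤ ε * (W3 t - leftMod u W3 s) := by
        rw [D_lt s hst.1, leftMod_of_lt hst.1, mul_neg, abs_neg]
        refine tendsto_leftLim_of_le hW3 (tendsto_sub_left (hh.tendsto_left (t := s)
          ⟨hu.trans_lt hst.1, hsv.le.trans hv⟩)) ?_
        filter_upwards [Ioo_mem_nhdsLT hse.1] with r hr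
        have := h3 ⟨hr.1, hr.2.trans hst.2⟩ 1 (fun i => if i = 0 then r else s) (fun _ => s)
          ?_ ?_ ?_ ?_
        · simpa [eG] using this
        · intro i _ j _ hij
          simp only
          split_ifs with e1 e2 e2
          · exact le_rfl
          · exact hr.2.le
          · omega
          · exact le_rfl
        · exact monotoneOn_const
        · intro i _
          split_ifs
          · exact ⟨le_rfl, (hr.2.trans hst.2).le⟩
          · exact ⟨hr.2.le, hst.2.le⟩
        · intro i _
          exact ⟨hr.2.le, hst.2⟩
      have h5 := abs_jumpSum_sub_le_left hWl loc hst.1.le hst.2 ht.2 hε.le hd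
      have h6 : leftLim (rightLim W) t ≤ rightLim W t := hWl.leftLim_le le_rfl
      have h7 := mul_le_mul_of_nonneg_left (sub_le_sub_right h6 (rightLim W s)) hε.le
      have h8 : W3 s ≤ leftMod u W3 t := by
        rw [leftMod_of_lt ht.1]; exact hW3.le_leftLim hst.2
      have h9 := mul_le_mul_of_nonneg_left (sub_le_sub_right h8 (leftMod u W3 s)) hε.le
      have eq : κ.sum G Hh s t - (Q t - Q s) =
          (κ.sum G Hh s t - (leftLim F t * (Hh t - Hh s) +
            (G t - leftLim F t) * (Hh t - Hh (clamp s t (κ.x j))))) +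
          (G t - leftLim F t) * (Hh t - Hh (clamp s t (κ.x j))) -
          (T t - T s - (F t * jumpL h t + leftLim F t * (leftLim h t - h s))) -
          (J t - J s - c t) + (G s - leftLim F t) * D s := by
        have e1 : jumpL h t = -D t := by rw [D_lt t ht.1, neg_neg]
        have e2 : leftLim h t = h t + D t := by rw [D_lt t ht.1, jumpL]; ring
        have e3 : ∀ x, Hh x = h x + D x := fun x => by simp only [hD]; ring
        simp only [hQ, hc, e1, e2, e3]
        ring
      rw [eq]
      simp only [hW2]
      rw [abs_le] at h1 hT h4 h5 hsm' ⊢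
      constructor <;> linarith
    · intro ε hε t ht
      have ht' := memR t ht
      filter_upwards [Y1.chain_right ht hε, Y3.right ht hε, H.2 ε hε t ht',
        eventually_Ioc_of_nhdsGT (domR ε hε t ht), mem_Ioc_of_nhdsGT ht]
        with s h1 h3 hT hd hst η hη
      refine .of_forall fun κ => ?_
      obtain ⟨j, -, -, -, h1⟩ := h1 _ _ κ ht.1 hst.2.le
      have eG : rightLim G t = rightLim F t :=
        rightLim_eq (tendsto_rightMod_right hF hv ⟨ht'.1, ht.2⟩)
      rw [eG, G_lt t ht.2, sub_self, zero_mul, add_zero] at h1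
      have hus : u < s := ht.1.trans_lt hst.1
      have h4 : |(G s - rightLim F t) * D s| ≤ ε * (W3 s - W3 t) := by
        rw [D_lt s hus, mul_neg, abs_neg]
        refine le_of_tendsto ((tendsto_sub_left (hh.tendsto_left (t := s)
          ⟨hu.trans_lt hus, hst.2.le.trans hv⟩)).const_mul (G s - rightLim F t)).abs ?_
        filter_upwards [Ioo_mem_nhdsLT hst.1] with r hr
        have := h3 1 (fun i => if i = 0 then r else s) (fun _ => s) ?_ ?_ ?_ ?_
        · simpa [eG] using this
        · intro i _ j _ hij
          simp only
          split_ifs with e1 e2 e2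
          · exact le_rfl
          · exact hr.2.le
          · omega
          · exact le_rfl
        · exact monotoneOn_const
        · intro i _
          split_ifs
          · exact ⟨hr.1.le, hr.2.le⟩
          · exact ⟨hst.1.le, le_rfl⟩
        · intro i _
          exact ⟨hst.1, le_rfl⟩
      have h5 := abs_jumpSum_sub_le_right hWl loc ht.1 hst.1 hst.2.le hε.le hd
      have h6 : rightLim W t ≤ rightLim (rightLim W) t := hWl.le_rightLim le_rfl
      have h7 := mul_le_mul_of_nonneg_left (sub_le_sub_left h6 (rightLim W s)) hε.le
      have h8 := mul_nonneg hε.le (sub_nonneg.2 (hWr hst.1.le))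
      have eq : κ.sum G Hh t s - (Q s - Q t) =
          (κ.sum G Hh t s - rightLim F t * (Hh s - Hh t)) -
          (T s - T t - rightLim F t * (h s - h t)) - (J s - J t - 0) -
          (G s - rightLim F t) * D s := by
        simp only [hQ, hD, G_lt t ht.2]
        ring
      simp only
      rw [eq]
      simp only [hW2]
      rw [abs_le] at h1 hT h4 h5 ⊢
      constructor <;> linarith
  have hJv : HasSum (fun x : Ioo u v => jumpR F x * jumpL h x) (J v) := by
    have h1 := (loc.summable hWl le_rfl huv.le le_rfl).1
    have e1 : (Ioc u v).indicator c = (Ioo u v).indicator fun x => jumpR F x * jumpL h x := by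
      ext x
      by_cases hx : x ∈ Ioo u v
      · rw [indicator_of_mem hx, indicator_of_mem (Ioo_subset_Ioc_self hx), c_eq x hx]
      · rw [indicator_of_notMem hx]
        by_cases hx' : x ∈ Ioc u v
        · have : x = v := by
            by_contra hne
            exact hx ⟨hx'.1, lt_of_le_of_ne hx'.2 hne⟩
          rw [indicator_of_mem hx', this]
          simp [hc, G_v]
        · rw [indicator_of_notMem hx']
    have e2 : J v = ∑' x, (Ioo u v).indicator (fun x => jumpR F x * jumpL h x) x := by
      rw [hJ, jumpSum, tsum_zero, add_zero, tsum_subtype, e1]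
    rw [e2]
    rw [e1] at h1
    exact (hasSum_subtype_iff_indicator (f := fun x => jumpR F x * jumpL h x)).2 h1.hasSum
  refine Or.inr ⟨huv, Q v - Q u, J v, hasRRS_of_tendsto huv key, hJv, ?_⟩
  have e1 : J u = 0 := jumpSum_self _ _ _
  simp only [hQ, D_u, D_lt v huv, G_v, e1]
  ring

end YoungIntegral

/-! ### The bracket and its stability under adding a function of finite p-variation -/

section QuadraticVariation

variable {a b t p : ℝ} {lam : ℕ → Part a b} {f g h V W : ℝ → ℝ}

/-- `V` is a monotone function which on `[a, b]` is the bracket function of `f`. -/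
structure IsBracket (lam : ℕ → Part a b) (f V : ℝ → ℝ) : Prop where
  reg : IsRegulated a b f
  mono : Monotone V
  zero : V a = 0
  lim : ∀ s t, a ≤ s → s < t → t ≤ b →
    Tendsto (fun m => sqSum f (lam m) s t) atTop (𝓝 (V t - V s))
  jumpL_eq : ∀ t ∈ Ioc a b, jumpL V t = jumpL f t ^ 2
  jumpR_eq : ∀ s ∈ Ico a b, jumpR V s = jumpR f s ^ 2

theorem eventually_clamp_left (ht : t ∈ Ioc a b) : ∀ᶠ s in 𝓝[<] t, clamp a b s = s := by
  filter_upwards [mem_Ico_of_nhdsLT ht] with s hs using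
    clamp_of_mem ⟨hs.1.le, hs.2.le.trans ht.2⟩

theorem eventually_clamp_right (ht : t ∈ Ico a b) : ∀ᶠ s in 𝓝[>] t, clamp a b s = s := by
  filter_upwards [mem_Ioc_of_nhdsGT ht] with s hs using
    clamp_of_mem ⟨ht.1.trans hs.1.le, hs.2.le⟩

theorem HasQV.exists_isBracket (H : HasQV lam f) (hab : a < b) : ∃ V, IsBracket lam f V := by
  obtain ⟨hf, V, hV, h0, hlim, hL, hR⟩ := H
  have le : ∀ s t, a ≤ s → s ≤ t → t ≤ b → V s ≤ V t := by
    intro s t hs hst ht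
    rcases hst.eq_or_lt with rfl | hst
    · exact le_rfl
    · exact sub_nonneg.1 (ge_of_tendsto' (hlim s t hs hst ht) fun m =>
        Finset.sum_nonneg fun i _ => sq_nonneg _)
  have e : ∀ t ∈ Icc a b, V (clamp a b t) = V t := fun t ht => by rw [clamp_of_mem ht]
  refine ⟨fun x => V (clamp a b x), hf, fun x y hxy => ?_, ?_, fun s t hs hst ht => ?_,
    fun t ht => ?_, fun t ht => ?_⟩
  · exact le _ _ (clamp_mem hab.le x).1 (clamp_mono a b hxy) (clamp_mem hab.le y).2
  · rw [e a ⟨le_rfl, hab.le⟩, h0]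
  · rw [e s ⟨hs, hst.le.trans ht⟩, e t ⟨hs.trans hst.le, ht⟩]
    exact hlim s t hs hst ht
  · rw [← hL t ht]
    refine QVar.jumpL_eq ((tendsto_sub_left (hV.tendsto_left ht)).congr' ?_)
    filter_upwards [eventually_clamp_left ht] with s hs
    rw [hs, e t ⟨ht.1.le, ht.2⟩]
  · rw [← hR t ht]
    refine QVar.jumpR_eq ((tendsto_sub_right (hV.tendsto_right ht)).congr' ?_)
    filter_upwards [eventually_clamp_right ht] with s hs
    rw [hs, e t ⟨ht.1, ht.2.le⟩]

theorem IsBracket.hasQV (H : IsBracket lam f V) : HasQV lam f :=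
  ⟨H.reg, V, H.mono.isRegulated, H.zero, H.lim, H.jumpL_eq, H.jumpR_eq⟩

theorem IsBracket.bracket_eq (H : IsBracket lam f V) (ht : t ∈ Icc a b) : bracket lam f t = V t := by
  rcases ht.1.eq_or_lt with rfl | hat
  · rw [H.zero]
    refine Tendsto.limUnder_eq ?_
    have : ∀ x, clamp a a x = a := fun x =>
      le_antisymm (clamp_mem le_rfl x).2 (clamp_mem le_rfl x).1
    simp [sqSum, this]
  · have := H.lim a t le_rfl hat ht.2
    rw [H.zero, sub_zero] at this
    exact this.limUnder_eq

/-- The sum of the squared jumps of `f` over `[a, t]`. -/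
noncomputable def sqJumpSum (a : ℝ) (f : ℝ → ℝ) : ℝ → ℝ :=
  jumpSum a (fun r => jumpL f r ^ 2) (fun r => jumpR f r ^ 2)

theorem IsBracket.bracketCont_eq (H : IsBracket lam f V) (ht : t ∈ Icc a b) :
    bracketCont lam f t = V t - sqJumpSum a f t := by
  rw [bracketCont, H.bracket_eq ht, sqJumpSum, jumpSum]
  ring

theorem IsBracket.domJump (H : IsBracket lam f V) {r : ℝ} (hr : r ∈ Ioo a b) :
    DomJump 1 (fun r => jumpL f r ^ 2) (fun r => jumpR f r ^ 2) V r := by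
  constructor
  · rw [abs_of_nonneg (sq_nonneg _), one_mul, H.jumpL_eq r ⟨hr.1, hr.2.le⟩]
  · rw [abs_of_nonneg (sq_nonneg _), one_mul, H.jumpR_eq r ⟨hr.1.le, hr.2⟩]

theorem IsBracket.locDomJump (H : IsBracket lam f V) :
    LocDomJump a b (fun r => jumpL f r ^ 2) (fun r => jumpR f r ^ 2) V :=
  .of_forall fun _ hr => H.domJump hr

/-- The squared jumps of f are the jumps of `V`, and a monotone function grows at least by its
jumps. So the continuous part of the bracket is nondecreasing. -/
theorem IsBracket.sqJumpSum_sub_le (H : IsBracket lam f V) {s : ℝ} (hs : a ≤ s) (hst : s ≤ t)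
    (ht : t ≤ b) : sqJumpSum a f t - sqJumpSum a f s ≤ V t - V s := by
  rcases hst.eq_or_lt with rfl | hst
  · simp
  have h1 := abs_tsum_Ioo_le H.mono hst zero_le_one fun r hr =>
    H.domJump (r := r) ⟨hs.trans_lt hr.1, hr.2.trans_le ht⟩
  rw [sqJumpSum, jumpSum_sub_eq H.mono H.locDomJump hs hst ht,
    ← H.jumpL_eq t ⟨hs.trans_lt hst, ht⟩, ← H.jumpR_eq s ⟨hs, hst.trans_le ht⟩, jumpL, jumpR]
  linarith [(abs_le.1 h1).2]

theorem continuousOn_Icc_of_tendsto {F : ℝ → ℝ}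
    (hl : ∀ t ∈ Ioc a b, Tendsto F (𝓝[<] t) (𝓝 (F t)))
    (hr : ∀ t ∈ Ico a b, Tendsto F (𝓝[>] t) (𝓝 (F t))) : ContinuousOn F (Icc a b) := by
  intro t ht
  rw [← Icc_union_Icc_eq_Icc ht.1 ht.2]
  refine ContinuousWithinAt.union ?_ ?_
  · rcases ht.1.eq_or_lt with rfl | h
    · simp
    · exact (continuousWithinAt_Iio_iff_Iic.1 (hl t ⟨h, ht.2⟩)).mono Icc_subset_Iic_self
  · rcases ht.2.eq_or_lt with rfl | h
    · simp
    · exact (continuousWithinAt_Ioi_iff_Ici.1 (hr t ⟨ht.1, h⟩)).mono Icc_subset_Ici_self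

theorem IsBracket.continuousOn (H : IsBracket lam f V) :
    ContinuousOn (fun t => V t - sqJumpSum a f t) (Icc a b) := by
  refine continuousOn_Icc_of_tendsto (fun t ht => ?_) (fun t ht => ?_)
  · have h1 := tendsto_sub_left (H.mono.tendsto_leftLim t)
    rw [H.jumpL_eq t ht] at h1
    have h2 := h1.sub (tendsto_jumpSum_left H.mono H.locDomJump ht)
    rw [sub_self] at h2
    have := tendsto_of_tendsto_sub_left (f := fun t => V t - sqJumpSum a f t) (t := t) (L := 0)
      (h2.congr fun s => by simp only [sqJumpSum]; ring)
    simpa using this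
  · have h1 := tendsto_sub_right (H.mono.tendsto_rightLim t)
    rw [H.jumpR_eq t ht] at h1
    have h2 := h1.sub (tendsto_jumpSum_right H.mono H.locDomJump ht)
    rw [sub_self] at h2
    have := tendsto_of_tendsto_sub_right (f := fun t => V t - sqJumpSum a f t) (t := t) (L := 0)
      (h2.congr fun s => by simp only [sqJumpSum]; ring)
    simpa using this

theorem IsBracket.ctrl_cont (H : IsBracket lam f V) (hab : a < b) :
    ∃ W, Ctrl a b 1 (fun t => V t - sqJumpSum a f t) W := by
  have le : ∀ s t, a ≤ s → s ≤ t → t ≤ b →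
      V s - sqJumpSum a f s ≤ V t - sqJumpSum a f t := fun s t hs hst ht => by
    linarith [H.sqJumpSum_sub_le hs hst ht]
  refine ⟨fun x => V (clamp a b x) - sqJumpSum a f (clamp a b x), fun x y hxy =>
    le _ _ (clamp_mem hab.le x).1 (clamp_mono a b hxy) (clamp_mem hab.le y).2,
    fun s t hs hst ht => ?_⟩
  simp only
  rw [Real.rpow_one, clamp_of_mem ⟨hs, hst.trans ht⟩, clamp_of_mem ⟨hs.trans hst, ht⟩,
    abs_of_nonneg (sub_nonneg.2 (le s t hs hst ht))]

section Local

variable {Ψ : ℝ → ℝ → ℝ} {s k ε L : ℝ}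

/-- Before `t` the terms of `Ψ` are close to `k` times squared increments of g, whose sum tends to
the increment of `V` without the squared jump at `t`. The last term, ending at `t`, is not small and
contributes its own limit `L`. -/
theorem IsBracket.asympWithin_left (H : IsBracket lam g V) (hlam : IsDenseNested lam)
    (hW : Monotone W) (hs : a ≤ s) (hst : s < t) (ht : t ≤ b) (hε : 0 ≤ ε) (h0 : Ψ t t = 0)
    (hΨ : ∀ x y, s ≤ x → x ≤ y → y < t →
      |Ψ x y - k * (g y - g x) ^ 2| ≤ ε * ((g y - g x) ^ 2 + (W y - W x)))
    (hL : Tendsto (fun r => Ψ r t) (𝓝[<] t) (𝓝 L)) :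
    AsympWithin atTop (fun m => intervalSum Ψ (lam m)) s t
      (k * (V t - V s - jumpL g t ^ 2) + L) (ε * ((V t + W t) - (V s + W s))) := by
  intro η hη
  -- The slack is spent as follows: ε times η' on the bound for the squared increments, |k| times η'
  -- on each of two approximations, and η' on the last term.
  set η' := η / (ε + 2 * |k| + 1)
  have hpos : 0 < ε + 2 * |k| + 1 := by positivity
  have hη' : 0 < η' := by positivity
  have eη : (ε + 2 * |k| + 1) * η' = η := mul_div_cancel₀ _ hpos.ne'
  have hj : Tendsto (fun r => (g t - g r) ^ 2) (𝓝[<] t) (𝓝 (jumpL g t ^ 2)) :=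
    (tendsto_sub_left (H.reg.tendsto_left ⟨hs.trans_lt hst, ht⟩)).pow 2
  filter_upwards [intervalSum_left_split hlam hs hst ht
    ((hL.eventually (Metric.closedBall_mem_nhds _ hη')).and
      (hj.eventually (Metric.closedBall_mem_nhds _ hη'))),
    (H.lim s t hs hst ht).eventually (Metric.closedBall_mem_nhds _ hη')] with m hm hV
  obtain ⟨n, w, hw, hws, ⟨h1, h2⟩, hsum⟩ := hm
  have e1 := hsum Ψ h0
  have e2 : sqSum g (lam m) s t = _ := hsum (fun x y => (g y - g x) ^ 2) (by simp)
  have h3 : |∑ i ∈ Finset.range n, Ψ (w i) (w (i + 1)) -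
      k * ∑ i ∈ Finset.range n, (g (w (i + 1)) - g (w i)) ^ 2| ≤
      ε * (∑ i ∈ Finset.range n, (g (w (i + 1)) - g (w i)) ^ 2 + (W (w n) - W (w 0))) := by
    rw [← Finset.sum_range_sub (fun i => W (w i)), ← Finset.sum_add_distrib, Finset.mul_sum,
      Finset.mul_sum, ← Finset.sum_sub_distrib]
    refine (Finset.abs_sum_le_sum_abs _ _).trans (Finset.sum_le_sum fun i hi => ?_)
    have := Finset.mem_range.1 hi
    exact hΨ _ _ (hws i this.le).1 (hw (show i ≤ n by omega) (show i + 1 ≤ n by omega) (by omega))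
      (hws (i + 1) this).2
  have h4 : W (w n) - W (w 0) ≤ W t - W s :=
    sub_le_sub (hW (hws n le_rfl).2.le) (hW (hws 0 (by omega)).1)
  rw [Real.dist_eq, e2] at hV
  rw [Real.dist_eq] at h1 h2
  set X := ∑ i ∈ Finset.range n, Ψ (w i) (w (i + 1))
  set Y := ∑ i ∈ Finset.range n, (g (w (i + 1)) - g (w i)) ^ 2
  have h5 : |k * (Y + (g t - g (w n)) ^ 2 - (V t - V s))| ≤ |k| * η' := by
    rw [abs_mul]; exact mul_le_mul_of_nonneg_left hV (abs_nonneg k)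
  have h6 : |k * ((g t - g (w n)) ^ 2 - jumpL g t ^ 2)| ≤ |k| * η' := by
    rw [abs_mul]; exact mul_le_mul_of_nonneg_left h2 (abs_nonneg k)
  have h7 : Y ≤ V t - V s + η' := by
    nlinarith [(abs_le.1 hV).2, sq_nonneg (g t - g (w n))]
  have h8 := mul_le_mul_of_nonneg_left (add_le_add h7 h4) hε
  rw [e1, show X + Ψ (w n) t - (k * (V t - V s - jumpL g t ^ 2) + L) =
    (X - k * Y) + k * (Y + (g t - g (w n)) ^ 2 - (V t - V s)) -
      k * ((g t - g (w n)) ^ 2 - jumpL g t ^ 2) + (Ψ (w n) t - L) by ring]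
  rw [abs_le] at h1 h3 h5 h6 ⊢
  constructor <;> linarith

theorem IsBracket.asympWithin_right (H : IsBracket lam g V) (hlam : IsDenseNested lam)
    (hW : Monotone W) (ht : a ≤ t) (hst : t < s) (hs : s ≤ b) (hε : 0 ≤ ε) (h0 : Ψ t t = 0)
    (hΨ : ∀ x y, t < x → x ≤ y → y ≤ s →
      |Ψ x y - k * (g y - g x) ^ 2| ≤ ε * ((g y - g x) ^ 2 + (W y - W x)))
    (hL : Tendsto (fun r => Ψ t r) (𝓝[>] t) (𝓝 L)) :
    AsympWithin atTop (fun m => intervalSum Ψ (lam m)) t s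
      (k * (V s - V t - jumpR g t ^ 2) + L) (ε * ((V s + W s) - (V t + W t))) := by
  intro η hη
  set η' := η / (ε + 2 * |k| + 1)
  have hpos : 0 < ε + 2 * |k| + 1 := by positivity
  have hη' : 0 < η' := by positivity
  have eη : (ε + 2 * |k| + 1) * η' = η := mul_div_cancel₀ _ hpos.ne'
  have hj : Tendsto (fun r => (g r - g t) ^ 2) (𝓝[>] t) (𝓝 (jumpR g t ^ 2)) :=
    (tendsto_sub_right (H.reg.tendsto_right ⟨ht, hst.trans_le hs⟩)).pow 2
  filter_upwards [intervalSum_right_split hlam ht hst hs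
    ((hL.eventually (Metric.closedBall_mem_nhds _ hη')).and
      (hj.eventually (Metric.closedBall_mem_nhds _ hη'))),
    (H.lim t s ht hst hs).eventually (Metric.closedBall_mem_nhds _ hη')] with m hm hV
  obtain ⟨n, w, hw, hws, ⟨h1, h2⟩, hsum⟩ := hm
  have e1 := hsum Ψ h0
  have e2 : sqSum g (lam m) t s = _ := hsum (fun x y => (g y - g x) ^ 2) (by simp)
  have h3 : |∑ i ∈ Finset.range n, Ψ (w i) (w (i + 1)) -
      k * ∑ i ∈ Finset.range n, (g (w (i + 1)) - g (w i)) ^ 2| ≤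
      ε * (∑ i ∈ Finset.range n, (g (w (i + 1)) - g (w i)) ^ 2 + (W (w n) - W (w 0))) := by
    rw [← Finset.sum_range_sub (fun i => W (w i)), ← Finset.sum_add_distrib, Finset.mul_sum,
      Finset.mul_sum, ← Finset.sum_sub_distrib]
    refine (Finset.abs_sum_le_sum_abs _ _).trans (Finset.sum_le_sum fun i hi => ?_)
    have := Finset.mem_range.1 hi
    exact hΨ _ _ (hws i this.le).1 (hw (show i ≤ n by omega) (show i + 1 ≤ n by omega) (by omega))
      (hws (i + 1) this).2
  have h4 : W (w n) - W (w 0) ≤ W s - W t :=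
    sub_le_sub (hW (hws n le_rfl).2) (hW (hws 0 (by omega)).1.le)
  rw [Real.dist_eq, e2] at hV
  rw [Real.dist_eq] at h1 h2
  set X := ∑ i ∈ Finset.range n, Ψ (w i) (w (i + 1))
  set Y := ∑ i ∈ Finset.range n, (g (w (i + 1)) - g (w i)) ^ 2
  have h5 : |k * ((g (w 0) - g t) ^ 2 + Y - (V s - V t))| ≤ |k| * η' := by
    rw [abs_mul]; exact mul_le_mul_of_nonneg_left hV (abs_nonneg k)
  have h6 : |k * ((g (w 0) - g t) ^ 2 - jumpR g t ^ 2)| ≤ |k| * η' := by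
    rw [abs_mul]; exact mul_le_mul_of_nonneg_left h2 (abs_nonneg k)
  have h7 : Y ≤ V s - V t + η' := by
    nlinarith [(abs_le.1 hV).2, sq_nonneg (g (w 0) - g t)]
  have h8 := mul_le_mul_of_nonneg_left (add_le_add h7 h4) hε
  rw [e1, show Ψ t (w 0) + X - (k * (V s - V t - jumpR g t ^ 2) + L) =
    (X - k * Y) + k * ((g (w 0) - g t) ^ 2 + Y - (V s - V t)) -
      k * ((g (w 0) - g t) ^ 2 - jumpR g t ^ 2) + (Ψ t (w 0) - L) by ring]
  rw [abs_le] at h1 h3 h5 h6 ⊢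
  constructor <;> linarith

end Local

/-- This is where `p < 2` makes squares of small increments negligible against their p-th powers. -/
theorem exists_sq_le_rpow (hp0 : 0 < p) (hp2 : p < 2) {ε : ℝ} (hε : 0 < ε) :
    ∃ δ > 0, ∀ x : ℝ, |x| < δ → x ^ 2 ≤ ε * |x| ^ p := by
  have h1 : Tendsto (fun x : ℝ => |x| ^ (2 - p)) (𝓝 0) (𝓝 0) := by
    have := tendsto_abs_rpow (p := 2 - p) (by linarith) (tendsto_id (α := ℝ) (x := 𝓝 0))
    simpa [Real.zero_rpow (show 2 - p ≠ 0 by linarith)] using this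
  obtain ⟨δ, hδ, h⟩ := Metric.eventually_nhds_iff.1 (h1.eventually (Iic_mem_nhds hε))
  refine ⟨δ, hδ, fun x hx => ?_⟩
  have h2 : |x| ^ (2 - p) ≤ ε := h (by simpa using hx)
  have h3 : x ^ 2 = |x| ^ (2 - p) * |x| ^ p := by
    rcases eq_or_ne x 0 with rfl | hx0
    · simp [Real.zero_rpow hp0.ne']
    · rw [← Real.rpow_add (abs_pos.2 hx0)]
      norm_num
  rw [h3]
  exact mul_le_mul_of_nonneg_right h2 (by positivity)

theorem Ctrl.sq_le_left (Hh : Ctrl a b p h W) (hh : IsRegulated a b h) (hp0 : 0 < p) (hp2 : p < 2)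
    (ht : t ∈ Ioc a b) {ε : ℝ} (hε : 0 < ε) :
    ∀ᶠ s in 𝓝[<] t, ∀ x y, s ≤ x → x ≤ y → y < t → (h y - h x) ^ 2 ≤ ε * (W y - W x) := by
  obtain ⟨δ, hδ, H⟩ := exists_sq_le_rpow hp0 hp2 hε
  have h1 := eventually_Ico_of_nhdsLT
    ((hh.tendsto_left ht).eventually (Metric.ball_mem_nhds _ (half_pos hδ)))
  filter_upwards [h1, mem_Ico_of_nhdsLT ht] with s hs hst x y hsx hxy hyt
  have h2 := hs x ⟨hsx, hxy.trans_lt hyt⟩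
  have h3 := hs y ⟨hsx.trans hxy, hyt⟩
  refine (H _ ?_).trans (mul_le_mul_of_nonneg_left
    (Hh.2 x y (hst.1.le.trans hsx) hxy (hyt.le.trans ht.2)) hε.le)
  have := dist_triangle_right (h y) (h x) (leftLim h t)
  rw [← Real.dist_eq]
  linarith

theorem Ctrl.sq_le_right (Hh : Ctrl a b p h W) (hh : IsRegulated a b h) (hp0 : 0 < p) (hp2 : p < 2)
    (ht : t ∈ Ico a b) {ε : ℝ} (hε : 0 < ε) :
    ∀ᶠ s in 𝓝[>] t, ∀ x y, t < x → x ≤ y → y ≤ s → (h y - h x) ^ 2 ≤ ε * (W y - W x) := by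
  obtain ⟨δ, hδ, H⟩ := exists_sq_le_rpow hp0 hp2 hε
  have h1 := eventually_Ioc_of_nhdsGT
    ((hh.tendsto_right ht).eventually (Metric.ball_mem_nhds _ (half_pos hδ)))
  filter_upwards [h1, mem_Ioc_of_nhdsGT ht] with s hs hst x y htx hxy hys
  have h2 := hs x ⟨htx, hxy.trans hys⟩
  have h3 := hs y ⟨htx.trans_le hxy, hys⟩
  refine (H _ ?_).trans (mul_le_mul_of_nonneg_left
    (Hh.2 x y (ht.1.trans htx.le) hxy (hys.trans hst.2.le)) hε.le)
  have := dist_triangle_right (h y) (h x) (rightLim h t)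
  rw [← Real.dist_eq]
  linarith

/-- From `2 * |x * y| ≤ ε * x ^ 2 + y ^ 2 / ε`; the divisor `1 / ε + 1` in the hypothesis absorbs
this cross term together with `y ^ 2` itself. -/
theorem abs_add_sq_sub_sq_le {x y ε w : ℝ} (hε : 0 < ε) (hy : y ^ 2 ≤ ε / (1 / ε + 1) * w) :
    |(x + y) ^ 2 - 1 * x ^ 2| ≤ ε * (x ^ 2 + w) := by
  have h1 : (1 / ε + 1) * y ^ 2 ≤ ε * w := by
    have := mul_le_mul_of_nonneg_left hy (show 0 ≤ 1 / ε + 1 by positivity)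
    have hne : (1 / ε + 1) ≠ 0 := by positivity
    rwa [← mul_assoc, mul_div_cancel₀ _ hne] at this
  have h2 : 0 ≤ ε * (x - 1 / ε * y) ^ 2 := by positivity
  have h3 : 0 ≤ ε * (x + 1 / ε * y) ^ 2 := by positivity
  have e : ε * (1 / ε) = 1 := mul_one_div_cancel hε.ne'
  have e2 : ε * (x - 1 / ε * y) ^ 2 = ε * x ^ 2 - 2 * (ε * (1 / ε)) * (x * y) +
    (ε * (1 / ε)) * (1 / ε) * y ^ 2 := by ring
  have e3 : ε * (x + 1 / ε * y) ^ 2 = ε * x ^ 2 + 2 * (ε * (1 / ε)) * (x * y) +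
    (ε * (1 / ε)) * (1 / ε) * y ^ 2 := by ring
  rw [e] at e2 e3
  rw [abs_le]
  constructor <;> nlinarith [sq_nonneg y]

theorem jumpL_add (hf : Tendsto f (𝓝[<] t) (𝓝 (leftLim f t)))
    (hg : Tendsto g (𝓝[<] t) (𝓝 (leftLim g t))) :
    jumpL (fun x => f x + g x) t = jumpL f t + jumpL g t :=
  jumpL_eq (((tendsto_sub_left hf).add (tendsto_sub_left hg)).congr fun s => by ring)

theorem jumpR_add (hf : Tendsto f (𝓝[>] t) (𝓝 (rightLim f t)))
    (hg : Tendsto g (𝓝[>] t) (𝓝 (rightLim g t))) :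
    jumpR (fun x => f x + g x) t = jumpR f t + jumpR g t :=
  jumpR_eq (((tendsto_sub_right hf).add (tendsto_sub_right hg)).congr fun s => by ring)

theorem jumpL_congr (hf : Tendsto f (𝓝[<] t) (𝓝 (leftLim f t))) (ht : t ∈ Ioc a b) {C : ℝ}
    (h : ∀ x ∈ Icc a b, g x = C + f x) : jumpL g t = jumpL f t := by
  refine jumpL_eq ((tendsto_sub_left hf).congr' ?_)
  filter_upwards [mem_Ico_of_nhdsLT ht] with s hs
  rw [h t ⟨ht.1.le, ht.2⟩, h s ⟨hs.1.le, hs.2.le.trans ht.2⟩]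
  ring

theorem jumpR_congr (hf : Tendsto f (𝓝[>] t) (𝓝 (rightLim f t))) (ht : t ∈ Ico a b) {C : ℝ}
    (h : ∀ x ∈ Icc a b, g x = C + f x) : jumpR g t = jumpR f t := by
  refine jumpR_eq ((tendsto_sub_right hf).congr' ?_)
  filter_upwards [mem_Ioc_of_nhdsGT ht] with s hs
  rw [h t ⟨ht.1, ht.2.le⟩, h s ⟨ht.1.trans hs.1.le, hs.2.le⟩]
  ring

theorem sq_jumpL_le {ε s : ℝ} (hh : Tendsto h (𝓝[<] t) (𝓝 (leftLim h t))) (hW : Monotone W)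
    (hst : s < t) (H : ∀ x, s ≤ x → x < t → (h t - h x) ^ 2 ≤ ε * (W t - W x)) :
    jumpL h t ^ 2 ≤ ε * jumpL W t := by
  refine le_of_tendsto_of_tendsto ((tendsto_sub_left hh).pow 2)
    ((tendsto_sub_left (hW.tendsto_leftLim t)).const_mul ε) ?_
  filter_upwards [Ioo_mem_nhdsLT hst] with x hx using H x hx.1.le hx.2

theorem sq_jumpR_le {ε s : ℝ} (hh : Tendsto h (𝓝[>] t) (𝓝 (rightLim h t))) (hW : Monotone W)
    (hst : t < s) (H : ∀ x, t < x → x ≤ s → (h x - h t) ^ 2 ≤ ε * (W x - W t)) :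
    jumpR h t ^ 2 ≤ ε * jumpR W t := by
  refine le_of_tendsto_of_tendsto ((tendsto_sub_right hh).pow 2)
    ((tendsto_sub_right (hW.tendsto_rightLim t)).const_mul ε) ?_
  filter_upwards [Ioo_mem_nhdsGT hst] with x hx using H x hx.1 hx.2.le

/-- At an inaccessible point one of the two jumps of f is zero, so f(t) coincides with a one-sided
limit. One of the three terms of the limiting defect is then on the diagonal, where ψ vanishes, and
the other two cancel. -/
theorem asympAdditive_of_continuousAt (hlam : IsDenseNested lam) (hf : IsRegulated a b f)
    {ψ : ℝ → ℝ → ℝ} (h0 : ∀ x, ψ x x = 0)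
    (hψ : ∀ t ∈ Ioo a b, ∀ x ∈ ({leftLim f t, f t} : Set ℝ), ∀ y ∈ ({f t, rightLim f t} : Set ℝ),
      ContinuousAt (uncurry ψ) (x, y))
    (hacc : ∀ t ∈ Ioo a b, t ∉ ⋃ m, (lam m).pts → jumpR f t = 0 ∨ jumpL f t = 0) :
    AsympAdditive atTop (fun m => intervalSum (fun x y => ψ (f x) (f y)) (lam m)) a b := by
  refine asympAdditive_intervalSum hlam (fun x => h0 _) fun t ht hnot => ?_
  have h1 := (hf.tendsto_left ⟨ht.1, ht.2.le⟩).comp (tendsto_fst (f := 𝓝[<] t) (g := 𝓝[>] t))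
  have h2 := (hf.tendsto_right ⟨ht.1.le, ht.2⟩).comp (tendsto_snd (f := 𝓝[<] t) (g := 𝓝[>] t))
  have h3 : Tendsto (fun _ : ℝ × ℝ => f t) (𝓝[<] t ×ˢ 𝓝[>] t) (𝓝 (f t)) := tendsto_const_nhds
  have c1 := (hψ t ht (leftLim f t) (by simp) (rightLim f t) (by simp)).tendsto.comp
    (h1.prodMk_nhds h2)
  have c2 := (hψ t ht (leftLim f t) (by simp) (f t) (by simp)).tendsto.comp (h1.prodMk_nhds h3)
  have c3 := (hψ t ht (f t) (by simp) (rightLim f t) (by simp)).tendsto.comp (h3.prodMk_nhds h2)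
  refine ((c1.sub c2).sub c3).trans (le_of_eq ?_)
  congr 1
  simp only [uncurry]
  rcases hacc t ht hnot with h | h
  · rw [sub_eq_zero.1 h, h0]; ring
  · rw [← sub_eq_zero.1 h, h0]; ring

/-- Away from the term touching `t`, increments of h do not change the sums of squares to leading
order. The new bracket is therefore that of g with its squared jumps replaced by those of f, and the
continuous parts agree. -/
theorem IsBracket.add (hg : IsBracket lam g V) (hab : a < b) (hlam : IsDenseNested lam)
    (hp0 : 0 < p) (hp2 : p < 2) (hh : IsRegulated a b h) (Hh : Ctrl a b p h W) {C : ℝ}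
    (hf : ∀ t ∈ Icc a b, f t = C + g t + h t) (hfr : IsRegulated a b f)
    (hacc : ∀ t ∈ Ioo a b, t ∉ ⋃ m, (lam m).pts → jumpR f t = 0 ∨ jumpL f t = 0) :
    ∃ Vf, IsBracket lam f Vf ∧
      ∀ t ∈ Icc a b, V t - sqJumpSum a g t = Vf t - sqJumpSum a f t := by
  have hW := Hh.1
  have hVW : Monotone fun x => V x + W x := hg.mono.add hW
  have jL : ∀ t ∈ Ioc a b, jumpL f t = jumpL g t + jumpL h t := fun t ht => by
    rw [← jumpL_add (hg.reg.tendsto_left ht) (hh.tendsto_left ht)]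
    refine jumpL_congr (IsRegulated.tendsto_left (a := a) (b := b) ?_ ht) ht (C := C)
      fun x hx => by rw [hf x hx]; ring
    exact ⟨fun t ht => ⟨_, (hg.reg.tendsto_left ht).add (hh.tendsto_left ht)⟩,
      fun t ht => ⟨_, (hg.reg.tendsto_right ht).add (hh.tendsto_right ht)⟩⟩
  have jR : ∀ t ∈ Ico a b, jumpR f t = jumpR g t + jumpR h t := fun t ht => by
    rw [← jumpR_add (hg.reg.tendsto_right ht) (hh.tendsto_right ht)]
    refine jumpR_congr (IsRegulated.tendsto_right (a := a) (b := b) ?_ ht) ht (C := C)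
      fun x hx => by rw [hf x hx]; ring
    exact ⟨fun t ht => ⟨_, (hg.reg.tendsto_left ht).add (hh.tendsto_left ht)⟩,
      fun t ht => ⟨_, (hg.reg.tendsto_right ht).add (hh.tendsto_right ht)⟩⟩
  have jVL : ∀ t ∈ Ioc a b, jumpL (fun x => V x + W x) t = jumpL g t ^ 2 + jumpL W t :=
    fun t ht => by
      rw [jumpL_add (hg.mono.tendsto_leftLim t) (hW.tendsto_leftLim t), hg.jumpL_eq t ht]
  have jVR : ∀ t ∈ Ico a b, jumpR (fun x => V x + W x) t = jumpR g t ^ 2 + jumpR W t :=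
    fun t ht => by
      rw [jumpR_add (hg.mono.tendsto_rightLim t) (hW.tendsto_rightLim t), hg.jumpR_eq t ht]
  set cl : ℝ → ℝ := fun r => jumpL f r ^ 2 - 1 * jumpL g r ^ 2 with hcl
  set cr : ℝ → ℝ := fun r => jumpR f r ^ 2 - 1 * jumpR g r ^ 2 with hcr
  have dom : ∀ ε > 0, ∀ r ∈ Ioo a b, jumpL h r ^ 2 ≤ ε / (1 / ε + 1) * jumpL W r →
      jumpR h r ^ 2 ≤ ε / (1 / ε + 1) * jumpR W r → DomJump ε cl cr (fun x => V x + W x) r := by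
    intro ε hε r hr h1 h2
    constructor
    · simp only [hcl]
      rw [jL r ⟨hr.1, hr.2.le⟩, jVL r ⟨hr.1, hr.2.le⟩]
      exact abs_add_sq_sub_sq_le hε h1
    · simp only [hcr]
      rw [jR r ⟨hr.1.le, hr.2⟩, jVR r ⟨hr.1.le, hr.2⟩]
      exact abs_add_sq_sub_sq_le hε h2
  have domL : ∀ ε > 0, ∀ t ∈ Ioc a b, ∀ᶠ r in 𝓝[<] t, DomJump ε cl cr (fun x => V x + W x) r := by
    intro ε hε t ht
    have hε' : 0 < ε / (1 / ε + 1) := by positivity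
    obtain ⟨s, hs, hst⟩ := ((Hh.sq_le_left hh hp0 hp2 ht hε').and (mem_Ico_of_nhdsLT ht)).exists
    filter_upwards [Ioo_mem_nhdsLT hst.2] with r hr
    have hr' : r ∈ Ioo a b := ⟨hst.1.trans hr.1, hr.2.trans_le ht.2⟩
    refine dom ε hε r hr' ?_ ?_
    · exact sq_jumpL_le (hh.tendsto_left ⟨hr'.1, hr'.2.le⟩) hW hr.1
        fun x hx hxr => hs x r hx hxr.le hr.2
    · obtain ⟨q, hq⟩ := exists_between hr.2
      exact sq_jumpR_le (hh.tendsto_right ⟨hr'.1.le, hr'.2⟩) hW hq.1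
        fun x hx hxr => hs r x hr.1.le hx.le (hxr.trans_lt hq.2)
  have domR : ∀ ε > 0, ∀ t ∈ Ico a b, ∀ᶠ r in 𝓝[>] t, DomJump ε cl cr (fun x => V x + W x) r := by
    intro ε hε t ht
    have hε' : 0 < ε / (1 / ε + 1) := by positivity
    obtain ⟨s, hs, hst⟩ := ((Hh.sq_le_right hh hp0 hp2 ht hε').and (mem_Ioc_of_nhdsGT ht)).exists
    filter_upwards [Ioo_mem_nhdsGT hst.1] with r hr
    have hr' : r ∈ Ioo a b := ⟨ht.1.trans_lt hr.1, hr.2.trans hst.2⟩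
    refine dom ε hε r hr' ?_ ?_
    · obtain ⟨q, hq⟩ := exists_between hr.1
      exact sq_jumpL_le (hh.tendsto_left ⟨hr'.1, hr'.2.le⟩) hW hq.2
        fun x hx hxr => hs x r (hq.1.trans_le hx) hxr.le hr.2.le
    · exact sq_jumpR_le (hh.tendsto_right ⟨hr'.1.le, hr'.2⟩) hW hr.2
        fun x hx hxr => hs r x hr.1 hx.le hxr
  have loc : LocDomJump a b cl cr fun x => V x + W x :=
    ⟨fun t ht => ⟨1, domL 1 one_pos t ht⟩, fun t ht => ⟨1, domR 1 one_pos t ht⟩⟩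
  -- The jumps `cl`, `cr` are differences of squared jumps. Each of the two series of squares will
  -- be summable, so `jumpSum_sub_const_mul` separates them at the end.
  set T : ℝ → ℝ := fun t => V t + jumpSum a cl cr t with hT
  have incr : ∀ x ∈ Icc a b, ∀ y ∈ Icc a b, f y - f x = (g y - g x) + (h y - h x) :=
    fun x hx y hy => by rw [hf x hx, hf y hy]; ring
  have hadd : AsympAdditive atTop (fun m => sqSum f (lam m)) a b :=
    asympAdditive_of_continuousAt hlam hfr (ψ := fun x y => (y - x) ^ 2) (by simp)
      (fun t _ x _ y _ => by fun_prop) hacc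
  have hlim : ∀ u v, a ≤ u → u < v → v ≤ b →
      Tendsto (fun m => sqSum f (lam m) u v) atTop (𝓝 (T v - T u)) := by
    intro u v hu huv hv
    refine tendsto_of_local (W := fun x => V x + W x) hVW hadd T ?_ ?_ hu huv hv
    · intro ε hε t ht
      have hε2 := half_pos hε
      have hε' : 0 < ε / 2 / (1 / (ε / 2) + 1) := by positivity
      filter_upwards [Hh.sq_le_left hh hp0 hp2 ht hε', eventually_Ico_of_nhdsLT (domL _ hε2 t ht),
        mem_Ico_of_nhdsLT ht] with s hs hd hst η hη
      have h1 := hg.asympWithin_left (Ψ := fun x y => (f y - f x) ^ 2) (k := 1) hlam hW hst.1.le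
        hst.2 ht.2 hε2.le (by simp) (fun x y hx hxy hy => by
          rw [incr x ⟨hst.1.le.trans hx, hxy.trans (hy.le.trans ht.2)⟩
            y ⟨hst.1.le.trans (hx.trans hxy), hy.le.trans ht.2⟩]
          exact abs_add_sq_sub_sq_le hε2 (hs x y hx hxy hy))
        ((tendsto_sub_left (hfr.tendsto_left ht)).pow 2) η hη
      have h2 := abs_jumpSum_sub_le_left hVW loc hst.1.le hst.2 ht.2 hε2.le hd
      have h3 : leftLim (fun x => V x + W x) t ≤ V t + W t := hVW.leftLim_le le_rfl
      have h4 := mul_le_mul_of_nonneg_left h3 hε2.le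
      filter_upwards [h1] with m hm
      change |sqSum f (lam m) s t - _| ≤ _ at hm
      simp only [hT, hcl] at h2 h4 ⊢
      rw [abs_le] at hm h2 ⊢
      constructor <;> linarith
    · intro ε hε t ht
      have hε2 := half_pos hε
      have hε' : 0 < ε / 2 / (1 / (ε / 2) + 1) := by positivity
      filter_upwards [Hh.sq_le_right hh hp0 hp2 ht hε', eventually_Ioc_of_nhdsGT (domR _ hε2 t ht),
        mem_Ioc_of_nhdsGT ht] with s hs hd hst η hη
      have h1 := hg.asympWithin_right (Ψ := fun x y => (f y - f x) ^ 2) (k := 1) hlam hW ht.1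
        hst.1 hst.2.le hε2.le (by simp) (fun x y hx hxy hy => by
          rw [incr x ⟨ht.1.trans hx.le, hxy.trans (hy.trans hst.2.le)⟩
            y ⟨ht.1.trans (hx.le.trans hxy), hy.trans hst.2.le⟩]
          exact abs_add_sq_sub_sq_le hε2 (hs x y hx hxy hy))
        ((tendsto_sub_right (hfr.tendsto_right ht)).pow 2) η hη
      have h2 := abs_jumpSum_sub_le_right hVW loc ht.1 hst.1 hst.2.le hε2.le hd
      have h3 : V t + W t ≤ rightLim (fun x => V x + W x) t := hVW.le_rightLim le_rfl
      have h4 := mul_le_mul_of_nonneg_left h3 hε2.le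
      filter_upwards [h1] with m hm
      change |sqSum f (lam m) t s - _| ≤ _ at hm
      simp only [hT, hcr] at h2 h4 ⊢
      rw [abs_le] at hm h2 ⊢
      constructor <;> linarith
  have TL : ∀ t ∈ Ioc a b, Tendsto (fun s => T t - T s) (𝓝[<] t) (𝓝 (jumpL f t ^ 2)) := by
    intro t ht
    have h1 := (tendsto_sub_left (hg.mono.tendsto_leftLim t)).add
      (tendsto_jumpSum_left hVW loc ht)
    rw [hg.jumpL_eq t ht] at h1
    simp only [hcl, one_mul, add_sub_cancel] at h1
    exact h1.congr fun s => by simp only [hT, hcl, hcr]; ring_nf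
  have TR : ∀ t ∈ Ico a b, Tendsto (fun s => T s - T t) (𝓝[>] t) (𝓝 (jumpR f t ^ 2)) := by
    intro t ht
    have h1 := (tendsto_sub_right (hg.mono.tendsto_rightLim t)).add
      (tendsto_jumpSum_right hVW loc ht)
    rw [hg.jumpR_eq t ht] at h1
    simp only [hcr, one_mul, add_sub_cancel] at h1
    exact h1.congr fun s => by simp only [hT, hcl, hcr]; ring_nf
  have T0 : T a = 0 := by simp only [hT, hg.zero, jumpSum_self, add_zero]
  obtain ⟨Vf, hVf⟩ := HasQV.exists_isBracket (lam := lam) (f := f)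
    ⟨hfr, T, isRegulated_of_tendsto_sub TL TR, T0, hlim, fun t ht => QVar.jumpL_eq (TL t ht),
      fun t ht => QVar.jumpR_eq (TR t ht)⟩ hab
  refine ⟨Vf, hVf, fun t ht => ?_⟩
  have e1 : Vf t = T t := by
    rcases ht.1.eq_or_lt with rfl | hat
    · rw [hVf.zero, T0]
    · have := tendsto_nhds_unique (hVf.lim a t le_rfl hat ht.2) (hlim a t le_rfl hat ht.2)
      rwa [hVf.zero, T0, sub_zero, sub_zero] at this
  have e2 := jumpSum_sub_const_mul hVf.mono hVf.locDomJump hg.mono hg.locDomJump 1 ht.1 ht.2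
  rw [e1]
  simp only [hT, sqJumpSum]
  rw [hcl, hcr, e2]
  ring

end QuadraticVariation

/-! ### Second-order kernels and Taylor's formula -/

section Kernel

variable {U : Set ℝ} {ψ : ℝ → ℝ → ℝ} {k φ : ℝ → ℝ}

/-- A function of two variables which near `(ξ, ξ)` is approximated by `k ξ * (y - x) ^ 2`. -/
structure IsSecondOrder (U : Set ℝ) (ψ : ℝ → ℝ → ℝ) (k : ℝ → ℝ) : Prop where
  diag : ∀ x, ψ x x = 0
  continuousAt : ∀ x ∈ U, ∀ y ∈ U, ContinuousAt (uncurry ψ) (x, y)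
  approx : ∀ ξ ∈ U, ∀ ε > 0, ∃ δ > 0, ∀ x y, dist x ξ < δ → dist y ξ < δ →
    |ψ x y - k ξ * (y - x) ^ 2| ≤ ε * (y - x) ^ 2
  continuousAt_coeff : ∀ x ∈ U, ContinuousAt k x

/-- Reversing the roles of the end points turns the Taylor remainder based at the left end into the
one based at the right end; the sign of the coefficient flips. -/
theorem IsSecondOrder.swap (H : IsSecondOrder U ψ k) :
    IsSecondOrder U (fun x y => -ψ y x) fun x => -k x where
  diag x := by rw [H.diag, neg_zero]
  continuousAt x hx y hy :=
    (ContinuousAt.comp (f := Prod.swap) (x := (x, y)) (H.continuousAt y hy x hx)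
      continuous_swap.continuousAt).neg
  approx ξ hξ ε hε := by
    obtain ⟨δ, hδ, h⟩ := H.approx ξ hξ ε hε
    refine ⟨δ, hδ, fun x y hx hy => ?_⟩
    rw [← abs_neg, show (y - x) ^ 2 = (x - y) ^ 2 by ring]
    convert h y x hy hx using 2
    ring
  continuousAt_coeff x hx := (H.continuousAt_coeff x hx).neg

theorem deriv_facts (hU : IsOpen U) (hφ : ContDiffOn ℝ 2 φ U) :
    (∀ x ∈ U, HasDerivAt φ (deriv φ x) x) ∧
    (∀ x ∈ U, HasDerivAt (deriv φ) (deriv (deriv φ) x) x) ∧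
    ∀ x ∈ U, ContinuousAt (deriv (deriv φ)) x := by
  have h1 := (contDiffOn_succ_iff_deriv_of_isOpen (n := 1) hU).1 (by norm_num; exact hφ)
  have h2 := (contDiffOn_succ_iff_deriv_of_isOpen (n := 0) hU).1 (by norm_num; exact h1.2.2)
  exact ⟨fun x hx => (h1.1.differentiableAt (hU.mem_nhds hx)).hasDerivAt,
    fun x hx => (h2.1.differentiableAt (hU.mem_nhds hx)).hasDerivAt,
    fun x hx => h2.2.2.continuousOn.continuousAt (hU.mem_nhds hx)⟩

/-- The mean value inequality twice, with the second derivative frozen at ξ: first for φ' minus a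
linear function, then for φ minus a quadratic one. The estimate is thus uniform over both points in
a ball around ξ, not merely at a fixed base point. -/
theorem isSecondOrder_taylor (hU : IsOpen U) (hφ : ContDiffOn ℝ 2 φ U) :
    IsSecondOrder U (fun x y => φ y - φ x - deriv φ x * (y - x))
      fun x => 1 / 2 * deriv (deriv φ) x := by
  obtain ⟨d1, d2, c2⟩ := deriv_facts hU hφ
  refine ⟨fun x => by ring, fun x hx y hy => ?_, fun ξ hξ ε hε => ?_,
    fun x hx => continuousAt_const.mul (c2 x hx)⟩
  · have e1 : ContinuousAt (fun z : ℝ × ℝ => φ z.1) (x, y) :=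
      ContinuousAt.comp (f := Prod.fst) (x := (x, y)) (d1 x hx).continuousAt continuousAt_fst
    have e2 : ContinuousAt (fun z : ℝ × ℝ => φ z.2) (x, y) :=
      ContinuousAt.comp (f := Prod.snd) (x := (x, y)) (d1 y hy).continuousAt continuousAt_snd
    have e3 : ContinuousAt (fun z : ℝ × ℝ => deriv φ z.1) (x, y) :=
      ContinuousAt.comp (f := Prod.fst) (x := (x, y)) (d2 x hx).continuousAt continuousAt_fst
    exact (e2.sub e1).sub (e3.mul (continuousAt_snd.sub continuousAt_fst))
  · obtain ⟨δ, hδ, h⟩ := Metric.eventually_nhds_iff_ball.1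
      ((show ∀ᶠ x in 𝓝 ξ, x ∈ U from hU.mem_nhds hξ).and
        ((c2 ξ hξ).eventually (Metric.closedBall_mem_nhds _ hε)))
    refine ⟨δ, hδ, fun x y hx hy => ?_⟩
    have hball : Convex ℝ (Metric.ball ξ δ) := convex_ball ξ δ
    have hseg : uIcc x y ⊆ Metric.ball ξ δ := by
      rw [← segment_eq_uIcc]
      exact hball.segment_subset hx hy
    have s1 : ∀ z ∈ Metric.ball ξ δ,
        |deriv φ z - deriv (deriv φ) ξ * z - (deriv φ x - deriv (deriv φ) ξ * x)| ≤
          ε * |z - x| := fun z hz => by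
      refine hball.norm_image_sub_le_of_norm_hasDerivWithin_le
        (f := fun z => deriv φ z - deriv (deriv φ) ξ * z)
        (f' := fun z => deriv (deriv φ) z - deriv (deriv φ) ξ * 1)
        (fun w hw => ((d2 w (h w hw).1).sub ((hasDerivAt_id w).const_mul _)).hasDerivWithinAt)
        (fun w hw => ?_) hx hz
      rw [mul_one]
      exact (h w hw).2
    have s2 := (convex_uIcc x y).norm_image_sub_le_of_norm_hasDerivWithin_le
      (f := fun z => φ z - deriv φ x * (z - x) - 1 / 2 * deriv (deriv φ) ξ * (z - x) ^ 2)
      (f' := fun z => deriv φ z - deriv φ x * 1 -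
        1 / 2 * deriv (deriv φ) ξ * (((2 : ℕ) : ℝ) * (z - x) ^ (2 - 1) * 1)) (C := ε * |y - x|)
      (fun w hw => (((d1 w (h w (hseg hw)).1).sub
        (((hasDerivAt_id w).sub_const x).const_mul _)).sub
        ((((hasDerivAt_id w).sub_const x).pow 2).const_mul _)).hasDerivWithinAt)
      (fun w hw => ?_) left_mem_uIcc right_mem_uIcc
    · rw [Real.norm_eq_abs, Real.norm_eq_abs, mul_assoc ε, ← sq, sq_abs] at s2
      convert s2 using 2
      ring
    · have s3 := (s1 w (hseg hw)).trans (mul_le_mul_of_nonneg_left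
        (abs_sub_left_of_mem_uIcc hw) hε.le)
      rw [Real.norm_eq_abs]
      refine (le_of_eq (congrArg abs ?_)).trans s3
      push_cast
      ring

end Kernel

/-! ### Limits of sums of second-order kernels along λ -/

section SecondOrderSums

variable {a b t : ℝ} {lam : ℕ → Part a b} {f V : ℝ → ℝ} {U : Set ℝ} {ψ : ℝ → ℝ → ℝ} {k : ℝ → ℝ}

theorem IsRegulated.comp {F : ℝ → ℝ} (hf : IsRegulated a b f)
    (hL : ∀ t ∈ Ioc a b, ContinuousAt F (leftLim f t))
    (hR : ∀ t ∈ Ico a b, ContinuousAt F (rightLim f t)) :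
    IsRegulated a b (F ∘ f) ∧ (∀ t ∈ Ioc a b, leftLim (F ∘ f) t = F (leftLim f t)) ∧
      ∀ t ∈ Ico a b, rightLim (F ∘ f) t = F (rightLim f t) := by
  have h1 : ∀ t ∈ Ioc a b, Tendsto (F ∘ f) (𝓝[<] t) (𝓝 (F (leftLim f t))) := fun t ht =>
    (hL t ht).tendsto.comp (hf.tendsto_left ht)
  have h2 : ∀ t ∈ Ico a b, Tendsto (F ∘ f) (𝓝[>] t) (𝓝 (F (rightLim f t))) := fun t ht =>
    (hR t ht).tendsto.comp (hf.tendsto_right ht)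
  exact ⟨⟨fun t ht => ⟨_, h1 t ht⟩, fun t ht => ⟨_, h2 t ht⟩⟩, fun t ht => leftLim_eq (h1 t ht),
    fun t ht => rightLim_eq (h2 t ht)⟩

theorem tendsto_lims_left (hf : IsRegulated a b f) (ht : t ∈ Ioc a b) :
    Tendsto (leftLim f) (𝓝[<] t) (𝓝 (leftLim f t)) ∧
      Tendsto (rightLim f) (𝓝[<] t) (𝓝 (leftLim f t)) := by
  obtain ⟨h1, h2⟩ := hf.tendsto_jumps_left ht
  have h0 := hf.tendsto_left ht
  constructor
  · simpa [jumpL] using h0.sub h1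
  · simpa [jumpR] using h0.add h2

theorem tendsto_lims_right (hf : IsRegulated a b f) (ht : t ∈ Ico a b) :
    Tendsto (leftLim f) (𝓝[>] t) (𝓝 (rightLim f t)) ∧
      Tendsto (rightLim f) (𝓝[>] t) (𝓝 (rightLim f t)) := by
  obtain ⟨h1, h2⟩ := hf.tendsto_jumps_right ht
  have h0 := hf.tendsto_right ht
  constructor
  · simpa [jumpL] using h0.sub h1
  · simpa [jumpR] using h0.add h2

/-- Near `t` the coefficient is frozen at its one-sided limit, and ψ becomes a multiple of the
squared increment. The bracket splits into a continuous part, which yields the Riemann-Stieltjes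
integral, and a jump part, where the squared jumps are replaced by the values of ψ across each jump.
-/
theorem IsBracket.exists_secondOrder (H : IsBracket lam f V) (hab : a < b)
    (hlam : IsDenseNested lam) (hψ : IsSecondOrder U ψ k) (hf : ∀ t ∈ Icc a b, f t ∈ U)
    (hfL : ∀ t ∈ Ioc a b, leftLim f t ∈ U) (hfR : ∀ t ∈ Ico a b, rightLim f t ∈ U)
    (hacc : ∀ t ∈ Ioo a b, t ∉ ⋃ m, (lam m).pts → jumpR f t = 0 ∨ jumpL f t = 0)
    {cl cr : ℝ → ℝ} (hcl : cl = fun r => ψ (leftLim f r) (f r))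
    (hcr : cr = fun r => ψ (f r) (rightLim f r)) :
    ∃ T : ℝ → ℝ, LocDomJump a b cl cr V ∧
      (∀ u v, a ≤ u → u < v → v ≤ b →
        HasRS (k ∘ f) (fun t => V t - sqJumpSum a f t) u v (T v - T u)) ∧
      (∀ u v, a ≤ u → u < v → v ≤ b →
        Tendsto (fun m => intervalSum (fun x y => ψ (f x) (f y)) (lam m) u v) atTop
          (𝓝 (T v + jumpSum a cl cr v - (T u + jumpSum a cl cr u)))) ∧
      (∀ t ∈ Ioc a b, Tendsto (fun s => T t + jumpSum a cl cr t - (T s + jumpSum a cl cr s))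
        (𝓝[<] t) (𝓝 (cl t))) ∧
      ∀ t ∈ Ico a b, Tendsto (fun s => T s + jumpSum a cl cr s - (T t + jumpSum a cl cr t))
        (𝓝[>] t) (𝓝 (cr t)) := by
  have hfr := H.reg
  set Vc : ℝ → ℝ := fun t => V t - sqJumpSum a f t with hVc
  have hVcc : ContinuousOn Vc (Icc a b) := H.continuousOn
  obtain ⟨Wc, hWc⟩ := H.ctrl_cont hab
  obtain ⟨hkf, hkL, hkR⟩ := hfr.comp (F := k) (fun t ht => hψ.continuousAt_coeff _ (hfL t ht))
    (fun t ht => hψ.continuousAt_coeff _ (hfR t ht))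
  have cL : ∀ t ∈ Ioc a b, Tendsto Vc (𝓝[<] t) (𝓝 (Vc t)) := fun t ht =>
    (hVcc t ⟨ht.1.le, ht.2⟩).tendsto.mono_left (nhdsWithin_le_of_mem (by
      filter_upwards [mem_Ico_of_nhdsLT ht] with s hs using ⟨hs.1.le, hs.2.le.trans ht.2⟩))
  have cR : ∀ t ∈ Ico a b, Tendsto Vc (𝓝[>] t) (𝓝 (Vc t)) := fun t ht =>
    (hVcc t ⟨ht.1, ht.2.le⟩).tendsto.mono_left (nhdsWithin_le_of_mem (by
      filter_upwards [mem_Ioc_of_nhdsGT ht] with s hs using ⟨ht.1.trans hs.1.le, hs.2.le⟩))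
  have jR : ∀ t ∈ Ico a b, jumpR Vc t = 0 := fun t ht => by
    rw [jumpR, rightLim_eq (cR t ht), sub_self]
  have HY : IsYoung a b (k ∘ f) Vc Wc :=
    ⟨hkf, ⟨fun t ht => ⟨_, cL t ht⟩, fun t ht => ⟨_, cR t ht⟩⟩, Or.inl hWc⟩
  -- `Vc` is continuous and monotone on [a, b], so the Young theory in its bounded variation case
  -- applies. Accessibility is automatic since `Vc` has no jumps.
  obtain ⟨T, -, hT⟩ := HY.exists_leftPrim hlam fun t ht _ => jR t ⟨ht.1.le, ht.2⟩
  have dom : ∀ ξ ε, ∀ r ∈ Ioo a b,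
      |ψ (leftLim f r) (f r) - k ξ * (f r - leftLim f r) ^ 2| ≤ ε * (f r - leftLim f r) ^ 2 →
      |ψ (f r) (rightLim f r) - k ξ * (rightLim f r - f r) ^ 2| ≤ ε * (rightLim f r - f r) ^ 2 →
      DomJump ε (fun r => cl r - k ξ * jumpL f r ^ 2) (fun r => cr r - k ξ * jumpR f r ^ 2) V r :=
    fun ξ ε r hr h1 h2 => ⟨by rw [H.jumpL_eq r ⟨hr.1, hr.2.le⟩, hcl]; exact h1,
      by rw [H.jumpR_eq r ⟨hr.1.le, hr.2⟩, hcr]; exact h2⟩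
  have dom' : ∀ ξ ε r, r ∈ Ioo a b →
      DomJump ε (fun r => cl r - k ξ * jumpL f r ^ 2) (fun r => cr r - k ξ * jumpR f r ^ 2) V r →
      DomJump (ε + |k ξ|) cl cr V r := by
    intro ξ ε r hr h
    have h1 := h.1
    have h2 := h.2
    rw [H.jumpL_eq r ⟨hr.1, hr.2.le⟩] at h1
    rw [H.jumpR_eq r ⟨hr.1.le, hr.2⟩] at h2
    constructor
    · rw [H.jumpL_eq r ⟨hr.1, hr.2.le⟩, add_mul, ← abs_of_nonneg (sq_nonneg (jumpL f r)), ← abs_mul,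
        abs_of_nonneg (sq_nonneg (jumpL f r))]
      have := abs_add_le (cl r - k ξ * jumpL f r ^ 2) (k ξ * jumpL f r ^ 2)
      rw [sub_add_cancel] at this
      exact this.trans (add_le_add_left h1 _)
    · rw [H.jumpR_eq r ⟨hr.1.le, hr.2⟩, add_mul, ← abs_of_nonneg (sq_nonneg (jumpR f r)), ← abs_mul,
        abs_of_nonneg (sq_nonneg (jumpR f r))]
      have := abs_add_le (cr r - k ξ * jumpR f r ^ 2) (k ξ * jumpR f r ^ 2)
      rw [sub_add_cancel] at this
      exact this.trans (add_le_add_left h2 _)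
  have domL : ∀ ε > 0, ∀ t ∈ Ioc a b, ∀ᶠ r in 𝓝[<] t,
      DomJump ε (fun r => cl r - k (leftLim f t) * jumpL f r ^ 2)
        (fun r => cr r - k (leftLim f t) * jumpR f r ^ 2) V r := by
    intro ε hε t ht
    obtain ⟨δ, hδ, h⟩ := hψ.approx _ (hfL t ht) ε hε
    have hb := Metric.ball_mem_nhds (leftLim f t) hδ
    obtain ⟨l1, l2⟩ := tendsto_lims_left hfr ht
    filter_upwards [l1.eventually hb, l2.eventually hb, (hfr.tendsto_left ht).eventually hb,
      mem_Ico_of_nhdsLT ht] with r h1 h2 h3 hr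
    exact dom _ ε r ⟨hr.1, hr.2.trans_le ht.2⟩ (h _ _ h1 h3) (h _ _ h3 h2)
  have domR : ∀ ε > 0, ∀ t ∈ Ico a b, ∀ᶠ r in 𝓝[>] t,
      DomJump ε (fun r => cl r - k (rightLim f t) * jumpL f r ^ 2)
        (fun r => cr r - k (rightLim f t) * jumpR f r ^ 2) V r := by
    intro ε hε t ht
    obtain ⟨δ, hδ, h⟩ := hψ.approx _ (hfR t ht) ε hε
    have hb := Metric.ball_mem_nhds (rightLim f t) hδ
    obtain ⟨l1, l2⟩ := tendsto_lims_right hfr ht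
    filter_upwards [l1.eventually hb, l2.eventually hb, (hfr.tendsto_right ht).eventually hb,
      mem_Ioc_of_nhdsGT ht] with r h1 h2 h3 hr
    exact dom _ ε r ⟨ht.1.trans_lt hr.1, hr.2⟩ (h _ _ h1 h3) (h _ _ h3 h2)
  have loc : LocDomJump a b cl cr V := by
    refine ⟨fun t ht => ⟨1 + |k (leftLim f t)|, ?_⟩, fun t ht => ⟨1 + |k (rightLim f t)|, ?_⟩⟩
    · filter_upwards [domL 1 one_pos t ht, mem_Ico_of_nhdsLT ht] with r h hr
      exact dom' _ _ _ ⟨hr.1, hr.2.trans_le ht.2⟩ h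
    · filter_upwards [domR 1 one_pos t ht, mem_Ioc_of_nhdsGT ht] with r h hr
      exact dom' _ _ _ ⟨ht.1.trans_lt hr.1, hr.2⟩ h
  -- The frozen coefficient varies with the point `t`, yet the series must be summable on all of [a,
  -- b] for each such constant; `split` then exchanges squared jumps for values of ψ.
  have locD : ∀ c, LocDomJump a b (fun r => cl r - c * jumpL f r ^ 2)
      (fun r => cr r - c * jumpR f r ^ 2) V := by
    have aux : ∀ c C, ∀ r ∈ Ioo a b, DomJump C cl cr V r →
        DomJump (C + |c|) (fun r => cl r - c * jumpL f r ^ 2)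
          (fun r => cr r - c * jumpR f r ^ 2) V r := by
      intro c C r hr h
      have h1 := h.1
      have h2 := h.2
      rw [H.jumpL_eq r ⟨hr.1, hr.2.le⟩] at h1
      rw [H.jumpR_eq r ⟨hr.1.le, hr.2⟩] at h2
      constructor
      · rw [H.jumpL_eq r ⟨hr.1, hr.2.le⟩, add_mul, ← abs_of_nonneg (sq_nonneg (jumpL f r)),
          ← abs_mul, abs_of_nonneg (sq_nonneg (jumpL f r))]
        exact (abs_sub _ _).trans (add_le_add_left h1 _)
      · rw [H.jumpR_eq r ⟨hr.1.le, hr.2⟩, add_mul, ← abs_of_nonneg (sq_nonneg (jumpR f r)),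
          ← abs_mul, abs_of_nonneg (sq_nonneg (jumpR f r))]
        exact (abs_sub _ _).trans (add_le_add_left h2 _)
    refine fun c => ⟨fun t ht => ?_, fun t ht => ?_⟩
    · obtain ⟨C, hC⟩ := loc.1 t ht
      refine ⟨C + |c|, ?_⟩
      filter_upwards [hC, mem_Ico_of_nhdsLT ht] with r h hr
      exact aux _ _ _ ⟨hr.1, hr.2.trans_le ht.2⟩ h
    · obtain ⟨C, hC⟩ := loc.2 t ht
      refine ⟨C + |c|, ?_⟩
      filter_upwards [hC, mem_Ioc_of_nhdsGT ht] with r h hr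
      exact aux _ _ _ ⟨ht.1.trans_lt hr.1, hr.2⟩ h
  have split : ∀ c, ∀ x ∈ Icc a b, jumpSum a (fun r => cl r - c * jumpL f r ^ 2)
      (fun r => cr r - c * jumpR f r ^ 2) x = jumpSum a cl cr x - c * sqJumpSum a f x :=
    fun c x hx => jumpSum_sub_const_mul H.mono loc H.mono H.locDomJump c hx.1 hx.2
  have hVW : Monotone fun x => V x + Wc x := H.mono.add hWc.1
  refine ⟨T, loc, fun u v hu huv hv => hT.hasRS HY hVcc hu huv hv, fun u v hu huv hv => ?_,
    fun t ht => ?_, fun t ht => ?_⟩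
  · refine tendsto_of_local (W := fun x => V x + Wc x) hVW
      (asympAdditive_of_continuousAt hlam hfr hψ.diag ?_ hacc)
      (fun t => T t + jumpSum a cl cr t) ?_ ?_ hu huv hv
    · intro t ht x hx y hy
      refine hψ.continuousAt x ?_ y ?_
      · rcases hx with rfl | rfl
        · exact hfL t ⟨ht.1, ht.2.le⟩
        · exact hf t ⟨ht.1.le, ht.2.le⟩
      · rcases hy with rfl | rfl
        · exact hf t ⟨ht.1.le, ht.2.le⟩
        · exact hfR t ⟨ht.1.le, ht.2⟩
    · intro ε hε t ht
      have hε2 := half_pos hε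
      obtain ⟨δ, hδ, h⟩ := hψ.approx _ (hfL t ht) _ hε2
      filter_upwards [eventually_Ico_of_nhdsLT ((hfr.tendsto_left ht).eventually
        (Metric.ball_mem_nhds (leftLim f t) hδ)), hT.1 _ hε2 t ht,
        eventually_Ico_of_nhdsLT (domL _ hε2 t ht), mem_Ico_of_nhdsLT ht] with s hs hTs hd hst η hη
      have hlim : Tendsto (fun r => ψ (f r) (f t)) (𝓝[<] t) (𝓝 (cl t)) := by
        rw [hcl]
        exact (hψ.continuousAt _ (hfL t ht) _ (hf t ⟨ht.1.le, ht.2⟩)).tendsto.comp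
          ((hfr.tendsto_left ht).prodMk_nhds tendsto_const_nhds)
      have h1 := H.asympWithin_left (Ψ := fun x y => ψ (f x) (f y)) (k := k (leftLim f t))
        (W := fun _ => 0) hlam monotone_const hst.1.le hst.2 ht.2 hε2.le (hψ.diag _)
        (fun x y hx hxy hy => by
          rw [sub_self, add_zero]
          exact h _ _ (hs x ⟨hx, hxy.trans_lt hy⟩) (hs y ⟨hx.trans hxy, hy⟩)) hlim η hη
      -- Half of ε goes to the kernel against the bracket and half to the jump series, both charged
      -- to `V`; the error of the integral is charged to `Wc`.
      have h2 := abs_jumpSum_sub_le_left H.mono (locD (k (leftLim f t))) hst.1.le hst.2 ht.2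
        hε2.le hd
      have h3 := mul_le_mul_of_nonneg_left (H.mono.leftLim_le (le_refl t)) hε2.le
      rw [split _ t ⟨ht.1.le, ht.2⟩, split _ s ⟨hst.1.le, hst.2.le.trans ht.2⟩] at h2
      rw [hkL t ht] at hTs
      filter_upwards [h1] with m hm
      simp only [hVc] at hTs
      rw [abs_le] at hm h2 hTs ⊢
      constructor <;> linarith
    · intro ε hε t ht
      have hε2 := half_pos hε
      obtain ⟨δ, hδ, h⟩ := hψ.approx _ (hfR t ht) _ hε2
      filter_upwards [eventually_Ioc_of_nhdsGT ((hfr.tendsto_right ht).eventually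
        (Metric.ball_mem_nhds (rightLim f t) hδ)), hT.2 _ hε2 t ht,
        eventually_Ioc_of_nhdsGT (domR _ hε2 t ht), mem_Ioc_of_nhdsGT ht] with s hs hTs hd hst η hη
      have hlim : Tendsto (fun r => ψ (f t) (f r)) (𝓝[>] t) (𝓝 (cr t)) := by
        rw [hcr]
        exact (hψ.continuousAt _ (hf t ⟨ht.1, ht.2.le⟩) _ (hfR t ht)).tendsto.comp
          (tendsto_const_nhds.prodMk_nhds (hfr.tendsto_right ht))
      have h1 := H.asympWithin_right (Ψ := fun x y => ψ (f x) (f y)) (k := k (rightLim f t))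
        (W := fun _ => 0) hlam monotone_const ht.1 hst.1 hst.2.le hε2.le (hψ.diag _)
        (fun x y hx hxy hy => by
          rw [sub_self, add_zero]
          exact h _ _ (hs x ⟨hx, hxy.trans hy⟩) (hs y ⟨hx.trans_le hxy, hy⟩)) hlim η hη
      have h2 := abs_jumpSum_sub_le_right H.mono (locD (k (rightLim f t))) ht.1 hst.1 hst.2.le
        hε2.le hd
      have h3 := mul_le_mul_of_nonneg_left (H.mono.le_rightLim (le_refl t)) hε2.le
      rw [split _ t ⟨ht.1, ht.2.le⟩, split _ s ⟨ht.1.trans hst.1.le, hst.2.le⟩] at h2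
      rw [hkR t ht, jR t ht, mul_zero, zero_add, rightLim_eq (cR t ht)] at hTs
      filter_upwards [h1] with m hm
      simp only [hVc] at hTs
      rw [abs_le] at hm h2 hTs ⊢
      constructor <;> linarith
  · have h1 := (hT.tendsto_left hWc.1 HY.2.1 ht).add (tendsto_jumpSum_left H.mono loc ht)
    rw [jumpL, leftLim_eq (cL t ht), sub_self, mul_zero, zero_add] at h1
    exact h1.congr fun s => by ring
  · have h1 := (hT.tendsto_right hWc.1 HY.2.1 ht).add (tendsto_jumpSum_right H.mono loc ht)
    rw [jR t ht, mul_zero, zero_add] at h1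
    exact h1.congr fun s => by ring

end SecondOrderSums

/-! ### Assembly of the change of variables formula -/

section Main

variable {a b p t : ℝ} {lam : ℕ → Part a b} {f g h F : ℝ → ℝ} {gh : (ℝ → ℝ) × (ℝ → ℝ)}

theorem HasRS.const_mul {g' : ℝ → ℝ} {u v I c : ℝ} (H : HasRS F g u v I)
    (hg : EqOn g g' (Icc u v)) : HasRS (fun x => c * F x) g' u v (c * I) := by
  intro ε hε
  obtain ⟨δ, hδ, h⟩ := H (ε / (|c| + 1)) (by positivity)
  refine ⟨δ, hδ, fun κ y hy hκ => ?_⟩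
  have e : sumRS (fun x => c * F x) g' κ y = c * sumRS F g κ y := by
    rw [sumRS, sumRS, Finset.mul_sum]
    refine Finset.sum_congr rfl fun i hi => ?_
    have := Finset.mem_range.1 hi
    rw [hg (κ.mem_Icc (i := i + 1) this), hg (κ.mem_Icc this.le), mul_assoc]
  have h1 := h κ y hy hκ
  have h2 : |c| * |sumRS F g κ y - I| ≤ |c| * (ε / (|c| + 1)) :=
    mul_le_mul_of_nonneg_left h1.le (abs_nonneg c)
  have h3 : (|c| + 1) * (ε / (|c| + 1)) = ε := mul_div_cancel₀ _ (by positivity)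
  have h4 : 0 < ε / (|c| + 1) := by positivity
  rw [e, ← mul_sub, abs_mul]
  linarith

theorem LocDomJump.exists_hasSum {cl cr W : ℝ → ℝ} (hW : Monotone W) (H : LocDomJump a b cl cr W)
    {z y : ℝ} (hz : a ≤ z) (hzy : z ≤ y) (hy : y ≤ b) :
    ∃ S₁ S₂, HasSum (fun t : Ioc z y => cl t) S₁ ∧ HasSum (fun t : Ico z y => cr t) S₂ ∧
      jumpSum a cl cr y - jumpSum a cl cr z = S₁ + S₂ := by
  obtain ⟨h1, h2⟩ := H.summable hW hz hzy hy
  rw [← summable_subtype_iff_indicator] at h1 h2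
  exact ⟨_, _, h1.hasSum, h2.hasSum, jumpSum_sub_eq_tsum hW H hz hzy hy⟩

theorem jumps_of_mem_dualPairs (H : gh ∈ dualPairs lam p f) :
    (∀ t ∈ Ioc a b, jumpL f t = jumpL gh.1 t + jumpL gh.2 t) ∧
      ∀ t ∈ Ico a b, jumpR f t = jumpR gh.1 t + jumpR gh.2 t := by
  obtain ⟨hg, hh, -, -, -, -, -, C, hf⟩ := H
  have hr : IsRegulated a b fun x => gh.1 x + gh.2 x :=
    ⟨fun t ht => ⟨_, (hg.tendsto_left ht).add (hh.tendsto_left ht)⟩,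
      fun t ht => ⟨_, (hg.tendsto_right ht).add (hh.tendsto_right ht)⟩⟩
  have e : ∀ x ∈ Icc a b, f x = C + (gh.1 x + gh.2 x) := fun x hx => by rw [hf x hx, add_assoc]
  refine ⟨fun t ht => ?_, fun t ht => ?_⟩
  · rw [jumpL_congr (hr.tendsto_left ht) ht e, jumpL_add (hg.tendsto_left ht) (hh.tendsto_left ht)]
  · rw [jumpR_congr (hr.tendsto_right ht) ht e,
      jumpR_add (hg.tendsto_right ht) (hh.tendsto_right ht)]

/-- The jumps of f are sums of the jumps of g and h, so a single admissible pair restricts the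
discontinuities of f itself; this is the form in which accessibility enters the second-order sums.
-/
theorem jump_eq_zero_of_mem (H : gh ∈ dualPairsPlus lam p f ∪ dualPairsMinus lam p f) :
    ∀ t ∈ Ioo a b, t ∉ ⋃ m, (lam m).pts → jumpR f t = 0 ∨ jumpL f t = 0 := by
  intro t ht hnot
  rcases H with ⟨H, hacc⟩ | ⟨H, hacc⟩
  · left
    have := mt (hacc t ht) hnot
    push Not at this
    rw [(jumps_of_mem_dualPairs H).2 t ⟨ht.1.le, ht.2⟩, this.1, this.2, add_zero]
  · right
    have := mt (hacc t ht) hnot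
    push Not at this
    rw [(jumps_of_mem_dualPairs H).1 t ⟨ht.1, ht.2.le⟩, this.1, this.2, add_zero]

theorem exists_isBracket_of_mem (hab : a < b) (hlam : IsDenseNested lam) (hp1 : 1 ≤ p)
    (hp2 : p < 2) (hf : IsRegulated a b f)
    (H : gh ∈ dualPairsPlus lam p f ∪ dualPairsMinus lam p f) :
    ∃ V, IsBracket lam f V ∧ EqOn (bracketCont lam gh.1) (bracketCont lam f) (Icc a b) := by
  have hacc := jump_eq_zero_of_mem H
  have H' : gh ∈ dualPairs lam p f := by
    rcases H with ⟨H, -⟩ | ⟨H, -⟩ <;> exact H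
  obtain ⟨hg, hh, hQ, -, hB, -, -, C, hC⟩ := H'
  obtain ⟨V, hV⟩ := hQ.exists_isBracket hab
  obtain ⟨W, hW⟩ := hB.exists_ctrl hab.le (by linarith)
  obtain ⟨Vf, hVf, e⟩ := hV.add hab hlam (by linarith) hp2 hh hW hC hf hacc
  exact ⟨Vf, hVf, fun t ht => by rw [hV.bracketCont_eq ht, hVf.bracketCont_eq ht, e t ht]⟩

/-- For `p = 1` the function h has bounded variation and F need only be regulated. Otherwise F
inherits from g and h finite variation of order `max q p`, and this order is still dual to `p`: if
the maximum is `p`, because `2 / p > 1`, and if it is `q`, by assumption. -/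
theorem exists_isYoung (hab : a < b) (hp1 : 1 ≤ p) (hp2 : p < 2) (H : gh ∈ dualPairs lam p f)
    (hF : IsRegulated a b F) {K : ℝ} (hK : 0 ≤ K)
    (hFf : ∀ s ∈ Icc a b, ∀ t ∈ Icc a b, |F t - F s| ≤ K * |f t - f s|) :
    ∃ W, IsYoung a b F gh.2 W := by
  obtain ⟨hg, hh, -, hD, hB, -, -, C, hC⟩ := H
  have hp0 : 0 < p := by linarith
  obtain ⟨Wh, hWh⟩ := hB.exists_ctrl hab.le hp0
  rcases hD with ⟨rfl, -⟩ | ⟨hp, q, hq, hpq, hBq⟩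
  · exact ⟨Wh, hF, hh, Or.inl hWh⟩
  · obtain ⟨Wg, hWg⟩ := hBq.exists_ctrl hab.le hq
    have hq' : 1 ≤ max q p := hp1.trans (le_max_right q p)
    obtain ⟨W1, h1⟩ := hWg.exponent_mono hq (le_max_left q p)
    obtain ⟨W2, h2⟩ := hWh.exponent_mono hp0 (le_max_right q p)
    have h3 := (h1.add h2 hq').comp_lipschitz (g := F) (by linarith) hK fun s hs t ht => by
      refine (hFf s hs t ht).trans (le_of_eq ?_)
      rw [hC s hs, hC t ht]
      congr 2
      ring
    refine ⟨_, hF, hh, Or.inr ⟨p, max q p, _, _, hp1, by linarith, ?_, h3, hWh, rfl⟩⟩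
    rcases le_total q p with h | h
    · rw [max_eq_right h, ← two_mul, mul_one_div, lt_div_iff₀ hp0]
      linarith
    · rwa [max_eq_left h]

variable {U : Set ℝ} {φ : ℝ → ℝ}

theorem IsRegulated.mem_closure (hf : IsRegulated a b f) :
    (∀ t ∈ Icc a b, f t ∈ closure (f '' Icc a b)) ∧
    (∀ t ∈ Ioc a b, leftLim f t ∈ closure (f '' Icc a b)) ∧
      ∀ t ∈ Ico a b, rightLim f t ∈ closure (f '' Icc a b) := by
  refine ⟨fun t ht => subset_closure ⟨t, ht, rfl⟩, fun t ht => ?_, fun t ht => ?_⟩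
  · refine mem_closure_of_tendsto (hf.tendsto_left ht) ?_
    filter_upwards [mem_Ico_of_nhdsLT ht] with s hs using ⟨s, ⟨hs.1.le, hs.2.le.trans ht.2⟩, rfl⟩
  · refine mem_closure_of_tendsto (hf.tendsto_right ht) ?_
    filter_upwards [mem_Ioc_of_nhdsGT ht] with s hs using ⟨s, ⟨ht.1.trans hs.1.le, hs.2.le⟩, rfl⟩

/-- The open set need not be convex, so the mean value theorem does not apply directly. Compactness
of the closure of the range upgrades the local Lipschitz bounds to a global one. -/
theorem exists_lipschitz_comp (hab : a < b) (hf : IsRegulated a b f) (hU : IsOpen U)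
    (hfU : closure (f '' Icc a b) ⊆ U) (hF : ContDiffOn ℝ 1 F U) :
    ∃ K, 0 ≤ K ∧ ∀ s ∈ Icc a b, ∀ t ∈ Icc a b, |F (f t) - F (f s)| ≤ K * |f t - f s| := by
  obtain ⟨M, hM⟩ := abs_le_of_isRegulated hab.le hf
  have hc : IsCompact (closure (f '' Icc a b)) := by
    refine ((isCompact_Icc (a := -M) (b := M)).closure_of_subset ?_)
    rintro _ ⟨x, hx, rfl⟩
    exact abs_le.1 (hM x hx)
  have hloc : LocallyLipschitzOn (closure (f '' Icc a b)) F := by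
    intro x hx
    obtain ⟨K, s, hs, hK⟩ := (hF.contDiffAt (hU.mem_nhds (hfU hx))).exists_lipschitzOnWith
    exact ⟨K, s, mem_nhdsWithin_of_mem_nhds hs, hK⟩
  obtain ⟨K, hK⟩ := hloc.exists_lipschitzOnWith_of_compact hc
  refine ⟨K, K.2, fun s hs t ht => ?_⟩
  exact hK.dist_le_mul _ (subset_closure ⟨t, ht, rfl⟩) _ (subset_closure ⟨s, hs, rfl⟩)

theorem intervalSum_congr {Ψ Ψ' : ℝ → ℝ → ℝ} {κ : Part a b} {u v : ℝ} (hu : a ≤ u) (huv : u ≤ v)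
    (hv : v ≤ b) (h : ∀ x ∈ Icc a b, ∀ y ∈ Icc a b, Ψ x y = Ψ' x y) :
    intervalSum Ψ κ u v = intervalSum Ψ' κ u v :=
  Finset.sum_congr rfl fun _ _ => h _ (Icc_subset_Icc hu hv (clamp_mem huv _)) _
    (Icc_subset_Icc hu hv (clamp_mem huv _))

theorem intervalSum_sub (G : ℝ → ℝ) {κ : Part a b} {u v : ℝ} (hu : a ≤ u) (huv : u ≤ v)
    (hv : v ≤ b) : intervalSum (fun x y => G y - G x) κ u v = G v - G u := by
  have := Finset.sum_range_sub (fun i => G (clamp u v (κ.x i))) κ.n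
  rwa [κ.left, κ.right, clamp_of_le hu, clamp_of_ge huv hv] at this

/-- If the sums of `Φ`, `Θ` and `Ξ` converge and add up to the increments of `G`, then
the limit of the sums of `Φ` is an indefinite integral with the expected jumps. -/
theorem exists_indefinite {Φ Θ Ξ : ℝ → ℝ → ℝ} {G T B gl gr hl hr cl cr : ℝ → ℝ}
    (hsum : ∀ x ∈ Icc a b, ∀ y ∈ Icc a b, Φ x y = G y - G x - Θ x y - Ξ x y)
    (hΘ : ∀ u v, a ≤ u → u < v → v ≤ b →
      Tendsto (fun m => intervalSum Θ (lam m) u v) atTop (𝓝 (T v - T u)))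
    (hΞ : ∀ u v, a ≤ u → u < v → v ≤ b →
      Tendsto (fun m => intervalSum Ξ (lam m) u v) atTop (𝓝 (B v - B u)))
    (hG : IsRegulated a b G)
    (hTL : ∀ t ∈ Ioc a b, Tendsto (fun s => T t - T s) (𝓝[<] t) (𝓝 (hl t)))
    (hTR : ∀ t ∈ Ico a b, Tendsto (fun s => T s - T t) (𝓝[>] t) (𝓝 (hr t)))
    (hBL : ∀ t ∈ Ioc a b, Tendsto (fun s => B t - B s) (𝓝[<] t) (𝓝 (cl t)))
    (hBR : ∀ t ∈ Ico a b, Tendsto (fun s => B s - B t) (𝓝[>] t) (𝓝 (cr t)))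
    (hL : ∀ t ∈ Ioc a b, gl t = jumpL G t - hl t - cl t)
    (hR : ∀ t ∈ Ico a b, gr t = jumpR G t - hr t - cr t) :
    ∃ A : ℝ → ℝ, IsRegulated a b A ∧ A a = 0 ∧
      (∀ u v, a ≤ u → u < v → v ≤ b →
        Tendsto (fun m => intervalSum Φ (lam m) u v) atTop (𝓝 (A v - A u))) ∧
      (∀ t ∈ Ioc a b, jumpL A t = gl t) ∧ (∀ t ∈ Ico a b, jumpR A t = gr t) ∧
      ∀ u v, A v - A u = G v - G u - (T v - T u) - (B v - B u) := by
  set A : ℝ → ℝ := fun t => G t - G a - (T t - T a) - (B t - B a) with hA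
  have AL : ∀ t ∈ Ioc a b, Tendsto (fun s => A t - A s) (𝓝[<] t) (𝓝 (gl t)) := fun t ht => by
    rw [hL t ht]
    exact (((tendsto_sub_left (hG.tendsto_left ht)).sub (hTL t ht)).sub (hBL t ht)).congr
      fun s => by simp only [hA]; ring
  have AR : ∀ t ∈ Ico a b, Tendsto (fun s => A s - A t) (𝓝[>] t) (𝓝 (gr t)) := fun t ht => by
    rw [hR t ht]
    exact (((tendsto_sub_right (hG.tendsto_right ht)).sub (hTR t ht)).sub (hBR t ht)).congr
      fun s => by simp only [hA]; ring
  refine ⟨A, isRegulated_of_tendsto_sub AL AR, by simp only [hA]; ring, fun u v hu huv hv => ?_,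
    fun t ht => jumpL_eq (AL t ht), fun t ht => jumpR_eq (AR t ht), fun u v => by
      simp only [hA]; ring⟩
  have h1 := ((hΘ u v hu huv hv).const_sub (G v - G u)).sub (hΞ u v hu huv hv)
  have e : A v - A u = G v - G u - (T v - T u) - (B v - B u) := by simp only [hA]; ring
  rw [e]
  refine h1.congr fun m => ?_
  rw [intervalSum_congr hu huv.le hv hsum, ← intervalSum_sub G (κ := lam m) hu huv.le hv]
  simp only [intervalSum, Finset.sum_sub_distrib]

end Main

end QVar

open QVar
theorem mainTheorem3 {a b : ℝ} (hab : a < b) (lam : ℕ → Part a b) (hlam : IsDenseNested lam)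
    (p : ℝ) (hp1 : 1 ≤ p) (hp2 : p < 2) (f : ℝ → ℝ) (hf : IsDecomposable lam p f)
    (φ : ℝ → ℝ) (U : Set ℝ) (hU : IsOpen U) (hfU : closure (f '' Set.Icc a b) ⊆ U)
    (hφ : ContDiffOn ℝ 2 φ U) :
    ((dualPairsPlus lam p f ∪ dualPairsMinus lam p f).Nonempty →
      HasQV lam f ∧ ∀ gh ∈ dualPairsPlus lam p f ∪ dualPairsMinus lam p f,
        Set.EqOn (bracketCont lam gh.1) (bracketCont lam f) (Set.Icc a b)) ∧
    ((dualPairsPlus lam p f).Nonempty →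
      ∃ L : ℝ → ℝ → ℝ, HasLeftInt lam (dualPairsPlus lam p f) (deriv φ ∘ f) L ∧
        ∀ z y, a ≤ z → z < y → y ≤ b → ∃ I S₁ S₂ : ℝ,
          HasRS (deriv (deriv φ) ∘ f) (bracketCont lam f) z y I ∧
          HasSum (fun t : Set.Ioc z y =>
            jumpL (φ ∘ f) t - Function.leftLim (deriv φ ∘ f) t * jumpL f t) S₁ ∧
          HasSum (fun t : Set.Ico z y =>
            jumpR (φ ∘ f) t - (deriv φ ∘ f) t * jumpR f t) S₂ ∧
          (φ ∘ f) y = (φ ∘ f) z + L z y + 1 / 2 * I + S₁ + S₂) ∧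
    ((dualPairsMinus lam p f).Nonempty →
      ∃ L : ℝ → ℝ → ℝ, HasRightInt lam (dualPairsMinus lam p f) (deriv φ ∘ f) L ∧
        ∀ z y, a ≤ z → z < y → y ≤ b → ∃ I S₁ S₂ : ℝ,
          HasRS (deriv (deriv φ) ∘ f) (bracketCont lam f) z y I ∧
          HasSum (fun t : Set.Ioc z y =>
            jumpL (φ ∘ f) t - (deriv φ ∘ f) t * jumpL f t) S₁ ∧
          HasSum (fun t : Set.Ico z y =>
            jumpR (φ ∘ f) t - Function.rightLim (deriv φ ∘ f) t * jumpR f t) S₂ ∧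
          (φ ∘ f) y = (φ ∘ f) z + L z y - 1 / 2 * I + S₁ + S₂) := by
  have hfr := hf.1
  obtain ⟨hm, hmL, hmR⟩ := hfr.mem_closure
  have hm' : ∀ t ∈ Icc a b, f t ∈ U := fun t ht => hfU (hm t ht)
  have hmL' : ∀ t ∈ Ioc a b, Function.leftLim f t ∈ U := fun t ht => hfU (hmL t ht)
  have hmR' : ∀ t ∈ Ico a b, Function.rightLim f t ∈ U := fun t ht => hfU (hmR t ht)
  obtain ⟨d1, d2, -⟩ := deriv_facts hU hφ
  obtain ⟨hG, hGL, hGR⟩ := hfr.comp (F := φ) (fun t ht => (d1 _ (hmL' t ht)).continuousAt)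
    (fun t ht => (d1 _ (hmR' t ht)).continuousAt)
  obtain ⟨hF, hFL, hFR⟩ := hfr.comp (F := deriv φ) (fun t ht => (d2 _ (hmL' t ht)).continuousAt)
    (fun t ht => (d2 _ (hmR' t ht)).continuousAt)
  have hφ' : ContDiffOn ℝ 1 (deriv φ) U :=
    ((contDiffOn_succ_iff_deriv_of_isOpen (n := 1) hU).1 (by norm_num; exact hφ)).2.2
  obtain ⟨K, hK, hKf⟩ := exists_lipschitz_comp hab hfr hU hfU hφ'
  have hincr : ∀ gh ∈ dualPairs lam p f, ∀ x ∈ Icc a b, ∀ y ∈ Icc a b,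
      f y - f x = (gh.1 y - gh.1 x) + (gh.2 y - gh.2 x) := by
    rintro gh ⟨-, -, -, -, -, -, -, C, hC⟩ x hx y hy
    rw [hC x hx, hC y hy]
    ring
  refine ⟨fun ⟨gh₀, h₀⟩ => ?_, fun ⟨gh₀, h₀⟩ => ?_, fun ⟨gh₀, h₀⟩ => ?_⟩
  · obtain ⟨V, hV, -⟩ := exists_isBracket_of_mem hab hlam hp1 hp2 hfr h₀
    exact ⟨hV.hasQV, fun gh hgh =>
      (exists_isBracket_of_mem hab hlam hp1 hp2 hfr hgh).choose_spec.2⟩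
  · obtain ⟨V, hV, -⟩ := exists_isBracket_of_mem hab hlam hp1 hp2 hfr (Or.inl h₀)
    obtain ⟨T, loc, hRS, hlim, hBL, hBR⟩ := hV.exists_secondOrder hab hlam
      (isSecondOrder_taylor hU hφ) hm' hmL' hmR' (jump_eq_zero_of_mem (Or.inl h₀)) rfl rfl
    set cl : ℝ → ℝ := fun r => φ (f r) - φ (Function.leftLim f r) -
      deriv φ (Function.leftLim f r) * (f r - Function.leftLim f r) with hcl
    set cr : ℝ → ℝ := fun r => φ (Function.rightLim f r) - φ (f r) -
      deriv φ (f r) * (Function.rightLim f r - f r) with hcr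
    set B : ℝ → ℝ := fun t => T t + jumpSum a cl cr t with hB
    have ecl : ∀ t ∈ Ioc a b, jumpL (φ ∘ f) t - Function.leftLim (deriv φ ∘ f) t * jumpL f t =
        cl t := fun t ht => by
      rw [hFL t ht, jumpL, hGL t ht, jumpL]; rfl
    have ecr : ∀ t ∈ Ico a b, jumpR (φ ∘ f) t - (deriv φ ∘ f) t * jumpR f t = cr t :=
      fun t ht => by rw [jumpR, hGR t ht, jumpR]; rfl
    -- The value of the integral is prescribed in terms of f alone, so independence of the pair is
    -- built in; what remains is that each pair realises it.
    refine ⟨fun u v => (φ ∘ f) v - (φ ∘ f) u - (B v - B u), ⟨hF, fun gh hgh => ?_⟩,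
      fun z y hz hzy hy => ?_⟩
    · obtain ⟨W, HY⟩ := exists_isYoung hab hp1 hp2 hgh.1 hF hK hKf
      obtain ⟨Th, hTh, hTp⟩ := HY.exists_leftPrim hlam fun t ht hnot => by
        have := mt (hgh.2 t ht) hnot
        push Not at this
        exact this.2
      -- No convergence is known for the sums against g; it is deduced from the Taylor identity, in
      -- which all other sums converge.
      obtain ⟨A, hA, hA0, hAlim, hAL, hAR, hAe⟩ := exists_indefinite (lam := lam) (cl := cl) (cr := cr)
        (Φ := fun x y => (deriv φ ∘ f) x * (gh.1 y - gh.1 x))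
        (Θ := fun x y => (deriv φ ∘ f) x * (gh.2 y - gh.2 x))
        (gl := fun t => Function.leftLim (deriv φ ∘ f) t * jumpL gh.1 t)
        (gr := fun t => (deriv φ ∘ f) t * jumpR gh.1 t)
        (fun x hx y hy => by
          simp only [Function.comp_apply]
          rw [hincr gh hgh.1 x hx y hy]
          ring) hTh hlim hG (fun t ht => hTp.tendsto_left HY.monotone HY.2.1 ht)
        (fun t ht => hTp.tendsto_right HY.monotone HY.2.1 ht) hBL hBR
        (fun t ht => by rw [← ecl t ht, (jumps_of_mem_dualPairs hgh.1).1 t ht]; ring)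
        (fun t ht => by rw [← ecr t ht, (jumps_of_mem_dualPairs hgh.1).2 t ht]; ring)
      refine ⟨A, ⟨hA, hA0, hAlim, hAL, hAR⟩, fun u v hu huv hv => ⟨Th v - Th u, ?_, ?_⟩⟩
      · rcases huv.eq_or_lt with rfl | huv
        · exact Or.inl ⟨rfl, sub_self _⟩
        · exact hTp.hasLY HY hu huv hv
      · rw [hAe]; ring
    · obtain ⟨S₁, S₂, h1, h2, h3⟩ := loc.exists_hasSum hV.mono hz hzy.le hy
      -- `T` integrates half of the second derivative, hence the factor 2.
      refine ⟨2 * (T y - T z), S₁, S₂, ?_, ?_, ?_, ?_⟩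
      · convert (hRS z y hz hzy hy).const_mul (c := 2) (g' := bracketCont lam f)
          fun t ht => (hV.bracketCont_eq ⟨hz.trans ht.1, ht.2.trans hy⟩).symm using 1
        ext x
        simp only [Function.comp_apply]
        ring
      · convert h1 using 2 with t
        exact ecl t ⟨hz.trans_lt t.2.1, t.2.2.trans hy⟩
      · convert h2 using 2 with t
        exact ecr t ⟨hz.trans t.2.1, t.2.2.trans_le hy⟩
      · simp only [hB]
        linarith
  · obtain ⟨V, hV, -⟩ := exists_isBracket_of_mem hab hlam hp1 hp2 hfr (Or.inr h₀)
    obtain ⟨T, loc, hRS, hlim, hBL, hBR⟩ := hV.exists_secondOrder hab hlam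
      (isSecondOrder_taylor hU hφ).swap hm' hmL' hmR' (jump_eq_zero_of_mem (Or.inr h₀)) rfl rfl
    set cl : ℝ → ℝ := fun r => -(φ (Function.leftLim f r) - φ (f r) -
      deriv φ (f r) * (Function.leftLim f r - f r)) with hcl
    set cr : ℝ → ℝ := fun r => -(φ (f r) - φ (Function.rightLim f r) -
      deriv φ (Function.rightLim f r) * (f r - Function.rightLim f r)) with hcr
    set B : ℝ → ℝ := fun t => T t + jumpSum a cl cr t with hB
    have ecl : ∀ t ∈ Ioc a b, jumpL (φ ∘ f) t - (deriv φ ∘ f) t * jumpL f t = cl t :=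
      fun t ht => by
      rw [jumpL, hGL t ht, jumpL]; simp only [Function.comp_apply, hcl]; ring
    have ecr : ∀ t ∈ Ico a b, jumpR (φ ∘ f) t - Function.rightLim (deriv φ ∘ f) t * jumpR f t =
        cr t := fun t ht => by
      rw [hFR t ht, jumpR, hGR t ht, jumpR]; simp only [Function.comp_apply, hcr]; ring
    refine ⟨fun u v => (φ ∘ f) v - (φ ∘ f) u - (B v - B u), ⟨hF, fun gh hgh => ?_⟩,
      fun z y hz hzy hy => ?_⟩
    · obtain ⟨W, HY⟩ := exists_isYoung hab hp1 hp2 hgh.1 hF hK hKf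
      obtain ⟨Th, hTh, hTp⟩ := HY.exists_rightPrim hlam fun t ht hnot => by
        have := mt (hgh.2 t ht) hnot
        push Not at this
        exact this.2
      obtain ⟨A, hA, hA0, hAlim, hAL, hAR, hAe⟩ := exists_indefinite (lam := lam) (cl := cl) (cr := cr)
        (Φ := fun x y => (deriv φ ∘ f) y * (gh.1 y - gh.1 x))
        (Θ := fun x y => (deriv φ ∘ f) y * (gh.2 y - gh.2 x))
        (gl := fun t => (deriv φ ∘ f) t * jumpL gh.1 t)
        (gr := fun t => Function.rightLim (deriv φ ∘ f) t * jumpR gh.1 t)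
        (fun x hx y hy => by
          -- The Taylor identity based at the right end `y`: here too only the increment of f has to
          -- be split into those of g and h.
          simp only [Function.comp_apply]
          linear_combination -(deriv φ (f y)) * hincr gh hgh.1 x hx y hy) hTh hlim hG (fun t ht => hTp.tendsto_left HY.monotone HY.2.1 ht)
        (fun t ht => hTp.tendsto_right HY.monotone HY.2.1 ht) hBL hBR
        (fun t ht => by rw [← ecl t ht, (jumps_of_mem_dualPairs hgh.1).1 t ht]; ring)
        (fun t ht => by rw [← ecr t ht, (jumps_of_mem_dualPairs hgh.1).2 t ht]; ring)
      refine ⟨A, ⟨hA, hA0, hAlim, hAL, hAR⟩, fun u v hu huv hv => ⟨Th v - Th u, ?_, ?_⟩⟩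
      · rcases huv.eq_or_lt with rfl | huv
        · exact Or.inl ⟨rfl, sub_self _⟩
        · exact hTp.hasRY HY hu huv hv
      · rw [hAe]; ring
    · obtain ⟨S₁, S₂, h1, h2, h3⟩ := loc.exists_hasSum hV.mono hz hzy.le hy
      -- The swapped kernel has minus half of the second derivative as coefficient, which also
      -- produces the minus sign in the formula.
      refine ⟨-2 * (T y - T z), S₁, S₂, ?_, ?_, ?_, ?_⟩
      · convert (hRS z y hz hzy hy).const_mul (c := -2) (g' := bracketCont lam f)
          fun t ht => (hV.bracketCont_eq ⟨hz.trans ht.1, ht.2.trans hy⟩).symm using 1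
        ext x
        simp only [Function.comp_apply]
        ring
      · convert h1 using 2 with t
        exact ecl t ⟨hz.trans_lt t.2.1, t.2.2.trans hy⟩
      · convert h2 using 2 with t
        exact ecr t ⟨hz.trans t.2.1, t.2.2.trans_le hy⟩
      · simp only [hB]
        linarith
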